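/- Let $d\ge 1$, $0<H<1$, $T>0$, and let $B=(B_t)_{t\ge 0}$ be a $d$-dimensional fractional Brownian motion with Hurst parameter $H$, that is, a centered Gaussian process with almost surely continuous paths in $\mathbb R^d$ and $$\mathbb E[B^i_tB^j_s]=\tfrac12\,\delta_{ij}\left(t^{2H}+s^{2H}-|t-s|^{2H}\right).$$ Let $k=(k_1,\dots,k_d)$ be a multi-index of nonnegative integers, $|k|=k_1+\cdots+k_d$. For $\varepsilon>0$, $t\ge0$, $x,y\in\mathbb R^d$ put $$f^{(k)}_\varepsilon(x)=\frac{i^{|k|}}{(2\pi)^d}\int_{\mathbb R^d}p_1^{k_1}\cdots p_d^{k_d}\,e^{i\langle p,x\rangle}e^{-\varepsilon|p|^2/2}\,dp,\qquad \alpha_{t,\varepsilon}(y)=(-1)^{|k|}\int_{0<r<s<t}f^{(k)}_\varepsilon(B_s-B_r-y)\,dr\,ds .$$ If $\alpha_{t,\varepsilon}(y)$ converges in $L^p$ for some $p\in(0,\infty)$ as $\varepsilon\downarrow0$, the limit (defined up to almost sure equality) is denoted by $\alpha_t(y)$ and called the $k$-th derivative of the self-intersection local time (DSLT) of $B$. Assume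 $H(|k|+d)<1$. Then for all $t\in[0,T]$ and $y\in\mathbb R^d$ the DSLT $\alpha_t(y)$ exists, as a limit in $L^p$ for every $p\in(0,\infty)$, and the following hold. 1. For every integer $n\ge 0$ and every $\lambda$ with $0\le\lambda<\min\left(1,\frac{1-Hd-H|k|}{H}\right)$ there is a constant $C>0$ such that, for all $t\in[0,T]$ and $x,y\in\mathbb R^d$, the variable $(\alpha_t(x)-\alpha_t(y))^n$ is integrable and $$\left|\mathbb E\left[(\alpha_t(x)-\alpha_t(y))^n\right]\right|\le C|x-y|^{n\lambda}.$$ 2. For every integer $n\ge 0$ and every $\beta$ with $0\le\beta<1-H|k|-Hd$ there is a constant $C>0$ such that, for all $t,\tilde t\in[0,T]$ and $y\in\mathbb R^d$, the variable $(\alpha_t(y)-\alpha_{\tilde t}(y))^n$ is integrable and $$\left|\mathbb E\left[(\alpha_t(y)-\alpha_{\tilde t}(y))^n\right]\right|\le C|t-\tilde t|^{n\beta}.$$ 3. The random field $(\alpha_t(y))_{t\in[0,T],\,y\in\mathbb R^d}$ has a modification such that almost surely: for every $t\in[0,T]$ the map $y\mapsto\alpha_t(y)$ is Hölder continuous on $\mathbb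 R^d$ of every order $\lambda$ with $0<\lambda<\min\left(1,\frac{1-Hd-H|k|}{H}\right)$, and for every $y\in\mathbb R^d$ the map $t\mapsto\alpha_t(y)$ is Hölder continuous on $[0,T]$ of every order $\beta$ with $0<\beta<1-H|k|-Hd$. (In 1 and 2, $0^0=1$.) -/

import Mathlib

open MeasureTheory ProbabilityTheory Filter Topology
open scoped ENNReal NNReal

namespace SelfIntersection

/-- `B` is a `d`-dimensional fractional Brownian motion with Hurst parameter `H` on `(Ω, P)`:
a centered Gaussian process with almost surely continuous paths, whose components are independent
(that is, uncorrelated) and have covariance `(t^{2H} + s^{2H} - |t - s|^{2H}) / 2`. -/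
structure IsFractionalBrownianMotion {d : ℕ} {Ω : Type*} [MeasurableSpace Ω] (H : ℝ)
    (B : ℝ≥0 → Ω → EuclideanSpace ℝ (Fin d)) (P : Measure Ω) : Prop where
  isGaussianProcess : IsGaussianProcess B P
  centered : ∀ (t : ℝ≥0) (i : Fin d), ∫ ω, B t ω i ∂P = 0
  covariance : ∀ (t s : ℝ≥0) (i j : Fin d),
    ∫ ω, B t ω i * B s ω j ∂P =
      if i = j then
        ((t : ℝ) ^ (2 * H) + (s : ℝ) ^ (2 * H) - |(t : ℝ) - (s : ℝ)| ^ (2 * H)) / 2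
      else 0
  continuous_paths : ∀ᵐ ω ∂P, Continuous fun t : ℝ≥0 => B t ω

/-- The `k`-th partial derivative of the centered Gaussian density with covariance `ε • 1`,
in Fourier form:
`f_ε^{(k)}(x) = i^{|k|} (2π)^{-d} ∫ p_1^{k_1} ⋯ p_d^{k_d} e^{i⟨p,x⟩} e^{-ε|p|²/2} dp`. -/
noncomputable def gaussianDeriv {d : ℕ} (k : Fin d → ℕ) (ε : ℝ)
    (x : EuclideanSpace ℝ (Fin d)) : ℂ :=
  Complex.I ^ (∑ j, k j) / (2 * (Real.pi : ℂ)) ^ d *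
    ∫ p : EuclideanSpace ℝ (Fin d),
      (∏ j, ((p j : ℝ) : ℂ) ^ k j) * Complex.exp (Complex.I * ((inner ℝ p x : ℝ) : ℂ)) *
        Complex.exp (((-(ε * ‖p‖ ^ 2 / 2) : ℝ)) : ℂ)

/-- `gaussianDeriv` is real-valued, so nothing is lost by taking real parts below. -/
theorem gaussianDeriv_im {d : ℕ} (k : Fin d → ℕ) (ε : ℝ) (x : EuclideanSpace ℝ (Fin d)) :
    (gaussianDeriv k ε x).im = 0 := by
  rw [← Complex.conj_eq_iff_im]
  unfold gaussianDeriv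
  rw [map_mul, ← integral_conj, ← integral_neg_eq_self]
  have h : ∀ p : EuclideanSpace ℝ (Fin d),
      (starRingEnd ℂ) ((∏ j, (((-p) j : ℝ) : ℂ) ^ k j) *
        Complex.exp (Complex.I * ((inner ℝ (-p) x : ℝ) : ℂ)) *
        Complex.exp (((-(ε * ‖-p‖ ^ 2 / 2) : ℝ)) : ℂ)) =
      (-1) ^ (∑ j, k j) * ((∏ j, ((p j : ℝ) : ℂ) ^ k j) *
        Complex.exp (Complex.I * ((inner ℝ p x : ℝ) : ℂ)) *
        Complex.exp (((-(ε * ‖p‖ ^ 2 / 2) : ℝ)) : ℂ)) := by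
    intro p
    have h1 : ∏ j, (((-p) j : ℝ) : ℂ) ^ k j = (-1) ^ (∑ j, k j) * ∏ j, ((p j : ℝ) : ℂ) ^ k j := by
      rw [← Finset.prod_pow_eq_pow_sum, ← Finset.prod_mul_distrib]
      refine Finset.prod_congr rfl fun j _ => ?_
      rw [← mul_pow]
      simp
    rw [map_mul, map_mul, ← Complex.exp_conj, ← Complex.exp_conj, map_mul, Complex.conj_ofReal,
      Complex.conj_ofReal, Complex.conj_I, inner_neg_left, norm_neg, h1, map_mul, map_prod]
    simp only [map_pow, map_neg, map_one, Complex.conj_ofReal]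
    push_cast
    ring_nf
  simp only [h]
  rw [integral_const_mul, ← mul_assoc]
  congr 1
  simp only [map_div₀, map_pow, Complex.conj_I, map_mul, Complex.conj_ofReal, map_ofNat]
  rw [div_mul_eq_mul_div, ← mul_pow]
  simp

/-- The approximation
`α_{t,ε}^{(k)}(y) = (-1)^{|k|} ∫_{0<r<s<t} f_ε^{(k)}(B_s - B_r - y) dr ds`;
a point of the plane is `q = (r, s)`. -/
noncomputable def approxDSLT {d : ℕ} {Ω : Type*} (B : ℝ≥0 → Ω → EuclideanSpace ℝ (Fin d))
    (k : Fin d → ℕ) (ε t : ℝ) (y : EuclideanSpace ℝ (Fin d)) (ω : Ω) : ℝ :=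
  (-1) ^ (∑ j, k j) *
    ∫ q in {q : ℝ × ℝ | 0 < q.1 ∧ q.1 < q.2 ∧ q.2 < t},
      (gaussianDeriv k ε (B q.2.toNNReal ω - B q.1.toNNReal ω - y)).re

/-- The random variable `X` is the limit of `α_{t,ε}^{(k)}(y)` in `L^p` as `ε ↓ 0`. -/
def IsLpLimit {d : ℕ} {Ω : Type*} [MeasurableSpace Ω] (B : ℝ≥0 → Ω → EuclideanSpace ℝ (Fin d))
    (P : Measure Ω) (k : Fin d → ℕ) (t : ℝ) (y : EuclideanSpace ℝ (Fin d)) (p : ℝ≥0∞)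
    (X : Ω → ℝ) : Prop :=
  MemLp X p P ∧
    Tendsto (fun ε : ℝ => eLpNorm (fun ω => approxDSLT B k ε t y ω - X ω) p P) (𝓝[>] 0) (𝓝 0)

/-- `X` is (a representative of) the `k`-th derivative of the self-intersection local time of `B`
at time `t` and level `y`: the limit of `α_{t,ε}^{(k)}(y)` in `L^p` for some `0 < p < ∞`. -/
def IsDSLT {d : ℕ} {Ω : Type*} [MeasurableSpace Ω] (B : ℝ≥0 → Ω → EuclideanSpace ℝ (Fin d))
    (P : Measure Ω) (k : Fin d → ℕ) (t : ℝ) (y : EuclideanSpace ℝ (Fin d)) (X : Ω → ℝ) : Prop :=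
  ∃ p : ℝ≥0∞, p ≠ 0 ∧ p ≠ ∞ ∧ IsLpLimit B P k t y p X

end SelfIntersection

/-!
Inserting the Fourier form of the regularized kernel, every difference of approximations (in `ε`,
in `y`, or in `t`) becomes `∫_D Φ_g (B_s - B_r) dr ds`, where `Φ_g` is the Fourier integral of a
symbol with `‖g p‖ ≤ A ‖p‖^κ` and `D` is a part of the triangle `0 < r < s < T`. Differences in
`ε` and in `y` cost an additional power `θ` of `‖p‖`, so `κ = |k| + θ`, and gain `|ε - ε'|^{θ/2}`
or `‖x - y‖^θ` in `A`; differences in time gain a power of the volume of `D`. So everything rests on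
one estimate for the moments of such integrals, `eLpNorm_setIntegral_fourierSymbol_le`, valid for
`H (κ + d) < 1`.

By Fubini and the characteristic function of the increments, the `n`-th moment is at most
`A^n ∫_{D^n} ∫ ∏ ‖p_j‖^κ e^{-V/2} dp`, where `V` is the variance of `∑ ⟨p_j, B_{s_j} - B_{r_j}⟩`.
Order the `2n` endpoints `r_j, s_j`. In the spectral representation, the Cauchy-Schwarz inequality
against the indicator of a gap `(x, y)` between consecutive endpoints gives local nondeterminism,
`u² (y - x)^{2H} ≤ C V`, where `u` is the sum of the `p_j` whose interval covers the gap
(`local_nondeterminism`). Each `p_j` is the difference of the sums `u` on the two sides of `r_j`, and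
likewise on the two sides of `s_j`. Splitting `‖p_j‖^κ` evenly between these two representations
charges every gap with the power `κ` of `gap^{-H}` only. The Gaussian factor that is left is
integrated in the variables `u` attached to the gaps following the `r_j`, a unimodular triangular
change of variables, and gives the remaining power `d` of `gap^{-H}`
(`lintegral_prod_norm_rpow_mul_exp_le`). Since `H (κ + d) < 1`, the product of the powers
`gap^{-H (κ + d)}` over all gaps is integrable in the times, and Hölder's inequality turns the spare
integrability into a power of the volume of `D` (`lintegral_time_momentum_le`).

These bounds make the approximations Cauchy in every `L^p` (`exists_isLpLimit`) and pass to the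
limit, which gives the moment estimates. As they hold for all moments, a chaining argument along
dyadic grids yields a modification that is Hölder continuous on bounded sets
(`exists_holder_modification`). Hölder continuity in `y` on the whole space follows because the
field vanishes for `‖y‖ > 2 sup ‖B‖`: there the approximations tend to `0` pathwise, by the decay of
the derivatives of the Gaussian kernel (`IsDSLT.ae_eq_zero`).
-/


namespace SelfIntersection

/-! ### Local nondeterminism of fractional Brownian increments -/

/-- The spectral constant `c_h = ∫₀^∞ (1 - cos x) x^{-1-2h} dx`, for which
`∫₀^∞ (1 - cos (t x)) x^{-1-2h} dx = c_h |t|^{2h}`. -/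
noncomputable def spectralConst (h : ℝ) : ℝ :=
  ∫ x in Set.Ioi (0 : ℝ), (1 - Real.cos x) * x ^ (-1 - 2 * h)

theorem integrableOn_one_sub_cos_mul_rpow {h : ℝ} (h0 : 0 < h) (h1 : h < 1) :
    IntegrableOn (fun x : ℝ => (1 - Real.cos x) * x ^ (-1 - 2 * h)) (Set.Ioi 0) := by
  have hm : AEStronglyMeasurable (fun x : ℝ => (1 - Real.cos x) * x ^ (-1 - 2 * h)) volume := by
    apply Measurable.aestronglyMeasurable
    fun_prop
  rw [← Set.Ioc_union_Ioi_eq_Ioi (zero_le_one' ℝ)]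
  refine IntegrableOn.union ?_ ?_
  · have hi : IntegrableOn (fun x : ℝ => x ^ (1 - 2 * h)) (Set.Ioc 0 1) := by
      rw [← intervalIntegrable_iff_integrableOn_Ioc_of_le zero_le_one]
      exact intervalIntegral.intervalIntegrable_rpow' (by linarith)
    refine Integrable.mono' hi hm.restrict ?_
    filter_upwards [ae_restrict_mem measurableSet_Ioc] with x hx
    have hx0 : 0 < x := hx.1
    have hc : 1 - Real.cos x ≤ x ^ 2 / 2 := by
      have := Real.one_sub_sq_div_two_le_cos (x := x)
      linarith
    have hc0 : 0 ≤ 1 - Real.cos x := by linarith [Real.cos_le_one x]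
    rw [Real.norm_of_nonneg (mul_nonneg hc0 (Real.rpow_nonneg hx0.le _))]
    have e : x ^ (1 - 2 * h) = x ^ 2 * x ^ (-1 - 2 * h) := by
      rw [← Real.rpow_natCast x 2, ← Real.rpow_add hx0]
      congr 1
      push_cast
      ring
    rw [e]
    exact mul_le_mul_of_nonneg_right (by nlinarith [sq_nonneg x]) (Real.rpow_nonneg hx0.le _)
  · have hi : IntegrableOn (fun x : ℝ => 2 * x ^ (-1 - 2 * h)) (Set.Ioi 1) :=
      (integrableOn_Ioi_rpow_of_lt (by linarith) zero_lt_one).const_mul 2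
    refine Integrable.mono' hi hm.restrict ?_
    filter_upwards [ae_restrict_mem measurableSet_Ioi] with x hx
    have hx0 : 0 < x := lt_trans zero_lt_one hx
    have hc0 : 0 ≤ 1 - Real.cos x := by linarith [Real.cos_le_one x]
    rw [Real.norm_of_nonneg (mul_nonneg hc0 (Real.rpow_nonneg hx0.le _))]
    exact mul_le_mul_of_nonneg_right (by linarith [Real.neg_one_le_cos x])
      (Real.rpow_nonneg hx0.le _)

theorem spectralConst_pos {h : ℝ} (h0 : 0 < h) (h1 : h < 1) : 0 < spectralConst h := by
  unfold spectralConst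
  have hnn : ∀ x ∈ Set.Ioi (0 : ℝ), 0 ≤ (1 - Real.cos x) * x ^ (-1 - 2 * h) := fun x hx =>
    mul_nonneg (by linarith [Real.cos_le_one x]) (Real.rpow_nonneg (le_of_lt hx) _)
  rw [setIntegral_pos_iff_support_of_nonneg_ae
    ((ae_restrict_iff' measurableSet_Ioi).2 (Eventually.of_forall hnn))
    (integrableOn_one_sub_cos_mul_rpow h0 h1)]
  refine lt_of_lt_of_le ?_ (measure_mono (s := Set.Ioo (0 : ℝ) 1) ?_)
  · simp
  · intro x hx
    refine ⟨?_, hx.1⟩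
    have : Real.cos x < 1 := by
      rw [← Real.cos_zero]
      exact Real.cos_lt_cos_of_nonneg_of_le_pi le_rfl (by linarith [hx.2, Real.pi_gt_three]) hx.1
    exact (mul_pos (by linarith) (Real.rpow_pos_of_pos hx.1 _)).ne'

theorem integrableOn_one_sub_cos_smul {h : ℝ} (h0 : 0 < h) (h1 : h < 1) (t : ℝ) :
    IntegrableOn (fun x : ℝ => (1 - Real.cos (t * x)) * x ^ (-1 - 2 * h)) (Set.Ioi 0) ∧
    ∫ x in Set.Ioi (0 : ℝ), (1 - Real.cos (t * x)) * x ^ (-1 - 2 * h) =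
      spectralConst h * |t| ^ (2 * h) := by
  rcases eq_or_ne t 0 with rfl | ht
  · simp [Real.zero_rpow (by linarith : (2 * h) ≠ 0)]
  have ht' : 0 < |t| := abs_pos.2 ht
  -- substitute `x ↦ |t| x`
  have key : ∀ x ∈ Set.Ioi (0 : ℝ), (1 - Real.cos (t * x)) * x ^ (-1 - 2 * h) =
      |t| ^ (1 + 2 * h) * ((1 - Real.cos (|t| * x)) * (|t| * x) ^ (-1 - 2 * h)) := by
    intro x hx
    have hx0 : (0 : ℝ) < x := hx
    have e1 : Real.cos (|t| * x) = Real.cos (t * x) := by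
      rw [← Real.cos_abs (t * x), abs_mul, abs_of_pos hx0]
    have e2 : |t| ^ (1 + 2 * h) * |t| ^ (-1 - 2 * h) = 1 := by
      rw [← Real.rpow_add ht']
      simp
    rw [e1, Real.mul_rpow ht'.le hx0.le]
    linear_combination (-(1 - Real.cos (t * x)) * x ^ (-1 - 2 * h)) * e2
  constructor
  · rw [integrableOn_congr_fun key measurableSet_Ioi]
    refine Integrable.const_mul ?_ _
    have := (integrableOn_Ioi_comp_mul_left_iff
      (fun x : ℝ => (1 - Real.cos x) * x ^ (-1 - 2 * h)) 0 ht').2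
      (by simpa using integrableOn_one_sub_cos_mul_rpow h0 h1)
    exact this
  · rw [setIntegral_congr_fun measurableSet_Ioi key, integral_const_mul,
      integral_comp_mul_left_Ioi (fun x : ℝ => (1 - Real.cos x) * x ^ (-1 - 2 * h)) 0 ht',
      mul_zero, smul_eq_mul, ← mul_assoc, mul_comm (spectralConst h)]
    congr 1
    rw [← Real.rpow_neg_one, ← Real.rpow_add ht']
    congr 1
    ring

/-- The covariance of the increments of a fractional Brownian motion with Hurst parameter `h`
over the intervals `[a, b]` and `[a', b']`. -/
noncomputable def incCov (h a b a' b' : ℝ) : ℝ :=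
  (|b - a'| ^ (2 * h) + |a - b'| ^ (2 * h) - |b - b'| ^ (2 * h) - |a - a'| ^ (2 * h)) / 2

/-- The real part of `(e^{ibξ} - e^{iaξ}) * conj (e^{ib'ξ} - e^{ia'ξ})`. -/
noncomputable def incPair (a b a' b' ξ : ℝ) : ℝ :=
  (Real.cos (b * ξ) - Real.cos (a * ξ)) * (Real.cos (b' * ξ) - Real.cos (a' * ξ)) +
  (Real.sin (b * ξ) - Real.sin (a * ξ)) * (Real.sin (b' * ξ) - Real.sin (a' * ξ))

/-- Spectral representation of the covariance of increments. -/
theorem integral_incPair {h : ℝ} (h0 : 0 < h) (h1 : h < 1) (a b a' b' : ℝ) :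
    IntegrableOn (fun ξ => incPair a b a' b' ξ * ξ ^ (-1 - 2 * h)) (Set.Ioi 0) ∧
    ∫ ξ in Set.Ioi (0 : ℝ), incPair a b a' b' ξ * ξ ^ (-1 - 2 * h) =
      2 * spectralConst h * incCov h a b a' b' := by
  have e : (fun ξ => incPair a b a' b' ξ * ξ ^ (-1 - 2 * h)) = fun ξ =>
      (((1 - Real.cos ((b - a') * ξ)) * ξ ^ (-1 - 2 * h) +
        (1 - Real.cos ((a - b') * ξ)) * ξ ^ (-1 - 2 * h)) -
        (1 - Real.cos ((b - b') * ξ)) * ξ ^ (-1 - 2 * h)) -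
        (1 - Real.cos ((a - a') * ξ)) * ξ ^ (-1 - 2 * h) := by
    funext ξ
    unfold incPair
    simp only [sub_mul (_ : ℝ) (_ : ℝ) ξ, Real.cos_sub]
    ring
  obtain ⟨i1, v1⟩ := integrableOn_one_sub_cos_smul h0 h1 (b - a')
  obtain ⟨i2, v2⟩ := integrableOn_one_sub_cos_smul h0 h1 (a - b')
  obtain ⟨i3, v3⟩ := integrableOn_one_sub_cos_smul h0 h1 (b - b')
  obtain ⟨i4, v4⟩ := integrableOn_one_sub_cos_smul h0 h1 (a - a')
  rw [e]
  have i12 := i1.fun_add i2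
  have i123 := i12.fun_sub i3
  refine ⟨i123.fun_sub i4, ?_⟩
  rw [integral_sub i123 i4, integral_sub i12 i3, integral_add i1 i2,
    v1, v2, v3, v4]
  unfold incCov
  ring

variable {ι : Type*} [Fintype ι]

/-- The variance of `∑ j, p j * (W (s j) - W (r j))` for a one-dimensional fractional Brownian
motion `W` with Hurst parameter `H`. -/
noncomputable def incVar (H : ℝ) (r s p : ι → ℝ) : ℝ :=
  ∑ j, ∑ l, p j * p l * incCov H (r j) (s j) (r l) (s l)

/-- Squared modulus of the Fourier transform `∑ j, p j (e^{i s_j ξ} - e^{i r_j ξ})`. -/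
theorem sum_incPair_eq_sq (r s p : ι → ℝ) (ξ : ℝ) :
    ∑ j, ∑ l, p j * p l * incPair (r j) (s j) (r l) (s l) ξ =
      (∑ j, p j * (Real.cos (s j * ξ) - Real.cos (r j * ξ))) ^ 2 +
      (∑ j, p j * (Real.sin (s j * ξ) - Real.sin (r j * ξ))) ^ 2 := by
  rw [sq, sq, Finset.sum_mul_sum, Finset.sum_mul_sum, ← Finset.sum_add_distrib]
  refine Finset.sum_congr rfl fun j _ => ?_
  rw [← Finset.sum_add_distrib]
  refine Finset.sum_congr rfl fun l _ => ?_
  unfold incPair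
  ring

theorem integral_sum_incPair {h : ℝ} (h0 : 0 < h) (h1 : h < 1) (r s p : ι → ℝ) :
    IntegrableOn (fun ξ => (∑ j, ∑ l, p j * p l * incPair (r j) (s j) (r l) (s l) ξ) *
      ξ ^ (-1 - 2 * h)) (Set.Ioi 0) ∧
    ∫ ξ in Set.Ioi (0 : ℝ), (∑ j, ∑ l, p j * p l * incPair (r j) (s j) (r l) (s l) ξ) *
      ξ ^ (-1 - 2 * h) = 2 * spectralConst h * incVar h r s p := by
  have e : (fun ξ : ℝ => (∑ j, ∑ l, p j * p l * incPair (r j) (s j) (r l) (s l) ξ) *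
      ξ ^ (-1 - 2 * h)) = fun ξ => ∑ j, ∑ l, p j * p l *
        (incPair (r j) (s j) (r l) (s l) ξ * ξ ^ (-1 - 2 * h)) := by
    funext ξ
    simp only [Finset.sum_mul, mul_assoc]
  have hi : ∀ j l, IntegrableOn (fun ξ => p j * p l *
      (incPair (r j) (s j) (r l) (s l) ξ * ξ ^ (-1 - 2 * h))) (Set.Ioi 0) := fun j l =>
    (integral_incPair h0 h1 _ _ _ _).1.const_mul _
  rw [e]
  refine ⟨integrable_finsetSum _ fun j _ => integrable_finsetSum _ fun l _ => hi j l, ?_⟩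
  rw [integral_finsetSum _ fun j _ => integrable_finsetSum _ fun l _ => hi j l]
  unfold incVar
  rw [Finset.mul_sum]
  refine Finset.sum_congr rfl fun j _ => ?_
  rw [integral_finsetSum _ fun l _ => hi j l, Finset.mul_sum]
  refine Finset.sum_congr rfl fun l _ => ?_
  rw [integral_const_mul, (integral_incPair h0 h1 _ _ _ _).2]
  ring

theorem incVar_nonneg {H : ℝ} (h0 : 0 < H) (h1 : H < 1) (r s p : ι → ℝ) :
    0 ≤ incVar H r s p := by
  have h := (integral_sum_incPair h0 h1 r s p).2
  have hnn : 0 ≤ ∫ ξ in Set.Ioi (0 : ℝ), (∑ j, ∑ l, p j * p l *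
      incPair (r j) (s j) (r l) (s l) ξ) * ξ ^ (-1 - 2 * H) := by
    refine setIntegral_nonneg measurableSet_Ioi fun ξ hξ => ?_
    rw [sum_incPair_eq_sq]
    exact mul_nonneg (by positivity) (Real.rpow_nonneg (le_of_lt hξ) _)
  rw [h] at hnn
  exact nonneg_of_mul_nonneg_right hnn (by linarith [spectralConst_pos h0 h1])

/-- Two increments of Brownian motion (`h = 1/2`) have covariance equal to the length of the
overlap of their intervals. -/
theorem incCov_half {a b x y : ℝ} (hab : a ≤ b) (hxy : x ≤ y) (ha : a ≤ x ∨ y ≤ a)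
    (hb : b ≤ x ∨ y ≤ b) :
    incCov (1 / 2) a b x y = if a ≤ x ∧ y ≤ b then y - x else 0 := by
  unfold incCov
  norm_num
  split_ifs with h
  · rw [abs_of_nonneg (by linarith [h.1, h.2] : 0 ≤ b - x),
      abs_of_nonpos (by linarith [h.1, h.2] : a - y ≤ 0),
      abs_of_nonneg (by linarith [h.1, h.2] : 0 ≤ b - y),
      abs_of_nonpos (by linarith [h.1, h.2] : a - x ≤ 0)]
    ring
  · rcases ha with ha | ha
    · rcases hb with hb | hb
      · rw [abs_of_nonpos (by linarith : b - x ≤ 0), abs_of_nonpos (by linarith : a - y ≤ 0),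
          abs_of_nonpos (by linarith : b - y ≤ 0), abs_of_nonpos (by linarith : a - x ≤ 0)]
        ring
      · exact absurd ⟨ha, hb⟩ h
    · rw [abs_of_nonneg (by linarith : 0 ≤ b - x), abs_of_nonneg (by linarith : 0 ≤ a - y),
          abs_of_nonneg (by linarith : 0 ≤ b - y), abs_of_nonneg (by linarith : 0 ≤ a - x)]
      ring

/-- Local nondeterminism: a gap `(x, y)` containing no endpoint of the intervals `[r j, s j]`
controls the sum of the coefficients of those intervals that cover the gap. -/
theorem local_nondeterminism {H : ℝ} (h0 : 0 < H) (h1 : H < 1) :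
    ∃ C : ℝ, 0 < C ∧ ∀ {ι : Type} [Fintype ι] (r s p : ι → ℝ) (x y : ℝ), x < y →
      (∀ j, r j ≤ s j) → (∀ j, r j ≤ x ∨ y ≤ r j) → (∀ j, s j ≤ x ∨ y ≤ s j) →
      (∑ j, if r j ≤ x ∧ y ≤ s j then p j else 0) ^ 2 * (y - x) ^ (2 * H) ≤
        C * incVar H r s p := by
  set A := spectralConst (1 / 2) with hA
  set B := spectralConst H with hB
  set D := spectralConst (1 - H) with hD
  have hA0 : 0 < A := spectralConst_pos (by norm_num) (by norm_num)
  have hB0 : 0 < B := spectralConst_pos h0 h1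
  have hD0 : 0 < D := spectralConst_pos (by linarith) (by linarith)
  refine ⟨B * D / A ^ 2, by positivity, ?_⟩
  intro ι _ r s p x y hxy hrs hr hs
  set u := ∑ j, if r j ≤ x ∧ y ≤ s j then p j else 0 with hu
  have hΔ : 0 < y - x := by linarith
  obtain ⟨iF, vF⟩ := integral_sum_incPair h0 h1 r s p
  obtain ⟨iG, vG⟩ := integral_incPair (h := 1 - H) (by linarith) (by linarith) x y x y
  -- the pairing at `h = 1/2` sees only the covering intervals
  have iP : IntegrableOn (fun ξ => ∑ j, p j *
      (incPair (r j) (s j) x y ξ * ξ ^ (-1 - 2 * (1 / 2) : ℝ))) (Set.Ioi 0) :=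
    integrable_finsetSum _ fun j _ =>
      (integral_incPair (by norm_num) (by norm_num) _ _ _ _).1.const_mul _
  have vP : ∫ ξ in Set.Ioi (0 : ℝ), ∑ j, p j *
      (incPair (r j) (s j) x y ξ * ξ ^ (-1 - 2 * (1 / 2) : ℝ)) = 2 * A * ((y - x) * u) := by
    rw [integral_finsetSum _ fun j _ =>
      (integral_incPair (by norm_num) (by norm_num) _ _ _ _).1.const_mul _, hu, Finset.mul_sum,
      Finset.mul_sum]
    refine Finset.sum_congr rfl fun j _ => ?_
    rw [integral_const_mul, (integral_incPair (by norm_num) (by norm_num) _ _ _ _).2,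
      incCov_half (hrs j) hxy.le (hr j) (hs j), ← hA]
    split_ifs <;> ring
  have eG : incCov (1 - H) x y x y = (y - x) ^ (2 * (1 - H)) := by
    unfold incCov
    rw [abs_of_pos hΔ, abs_sub_comm, abs_of_pos hΔ]
    simp [Real.zero_rpow (by linarith : (2 * (1 - H)) ≠ 0)]
  rw [eG] at vG
  set V := incVar H r s p with hV
  -- Cauchy-Schwarz, as a quadratic inequality in the parameter `τ`
  have quad : ∀ τ : ℝ, 0 ≤ (2 * B * V) * (τ * τ) + (-(4 * A * ((y - x) * u))) * τ +
      2 * D * (y - x) ^ (2 * (1 - H)) := by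
    intro τ
    have hnn : 0 ≤ ∫ ξ in Set.Ioi (0 : ℝ), ((τ * τ) * ((∑ j, ∑ l, p j * p l *
        incPair (r j) (s j) (r l) (s l) ξ) * ξ ^ (-1 - 2 * H)) -
        (2 * τ) * ∑ j, p j * (incPair (r j) (s j) x y ξ * ξ ^ (-1 - 2 * (1 / 2) : ℝ)) +
        incPair x y x y ξ * ξ ^ (-1 - 2 * (1 - H))) := by
      refine setIntegral_nonneg measurableSet_Ioi fun ξ hξ => ?_
      have hξ0 : (0 : ℝ) < ξ := hξ
      set w := ξ ^ ((-1 - 2 * H) / 2) with hw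
      set v := ξ ^ ((-1 - 2 * (1 - H)) / 2) with hv
      have e1 : ξ ^ (-1 - 2 * H) = w * w := by
        rw [hw, ← Real.rpow_add hξ0]; congr 1; ring
      have e2 : ξ ^ (-1 - 2 * (1 - H)) = v * v := by
        rw [hv, ← Real.rpow_add hξ0]; congr 1; ring
      have e3 : ξ ^ (-1 - 2 * (1 / 2) : ℝ) = w * v := by
        rw [hw, hv, ← Real.rpow_add hξ0]; congr 1; ring
      rw [e1, e2, e3, sum_incPair_eq_sq]
      set Fc := ∑ j, p j * (Real.cos (s j * ξ) - Real.cos (r j * ξ)) with hFc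
      set Fs := ∑ j, p j * (Real.sin (s j * ξ) - Real.sin (r j * ξ)) with hFs
      have e4 : ∑ j, p j * (incPair (r j) (s j) x y ξ * (w * v)) =
          (Fc * (Real.cos (y * ξ) - Real.cos (x * ξ)) +
            Fs * (Real.sin (y * ξ) - Real.sin (x * ξ))) * (w * v) := by
        rw [hFc, hFs, Finset.sum_mul, Finset.sum_mul, ← Finset.sum_add_distrib, Finset.sum_mul]
        refine Finset.sum_congr rfl fun j _ => ?_
        unfold incPair
        ring
      rw [e4]
      unfold incPair
      have := add_nonneg
        (sq_nonneg (τ * Fc * w - (Real.cos (y * ξ) - Real.cos (x * ξ)) * v))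
        (sq_nonneg (τ * Fs * w - (Real.sin (y * ξ) - Real.sin (x * ξ)) * v))
      linarith
    have iFP := IntegrableOn.fun_sub (iF.const_mul (τ * τ)) (iP.const_mul (2 * τ))
    rw [integral_add iFP iG,
      integral_sub (iF.const_mul _) (iP.const_mul _), integral_const_mul, integral_const_mul,
      vF, vG, vP] at hnn
    linarith
  have disc := discrim_le_zero quad
  unfold discrim at disc
  have hpow : (y - x) ^ (2 * (1 - H)) * (y - x) ^ (2 * H) = (y - x) ^ 2 := by
    rw [← Real.rpow_add hΔ, ← Real.rpow_natCast]
    congr 1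
    push_cast
    ring
  have hW : 0 < (y - x) ^ (2 * H) := Real.rpow_pos_of_pos hΔ _
  have h2 : A ^ 2 * ((y - x) * u) ^ 2 ≤ B * V * D * (y - x) ^ (2 * (1 - H)) := by nlinarith
  have h3 : A ^ 2 * ((y - x) * u) ^ 2 * (y - x) ^ (2 * H) ≤ B * V * D * (y - x) ^ 2 := by
    rw [← hpow, ← mul_assoc]
    exact mul_le_mul_of_nonneg_right h2 hW.le
  rw [div_mul_eq_mul_div, le_div_iff₀ (by positivity)]
  have hsq : 0 < (y - x) ^ 2 := by positivity
  refine le_of_mul_le_mul_right ?_ hsq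
  calc _ = A ^ 2 * ((y - x) * u) ^ 2 * (y - x) ^ (2 * H) := by ring
    _ ≤ _ := h3
    _ = _ := by ring

/-! ### Ordered endpoints and their gaps -/

section Cover

variable {ι : Type*} [Fintype ι]

/-- The sum of the coefficients `p j` of those intervals that cover the gap between the positions
`i - 1` and `i`, where `a j` and `b j` are the positions of the endpoints of the `j`-th interval. -/
def coverSum (a b : ι → ℕ) (p : ι → ℝ) (i : ℕ) : ℝ :=
  ∑ j, if a j < i ∧ i ≤ b j then p j else 0

theorem coverSum_succ_left {a b : ι → ℕ} (ha : Function.Injective a) (hab : ∀ j l, a j ≠ b l)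
    (hlt : ∀ j, a j < b j) (p : ι → ℝ) (j : ι) :
    p j = coverSum a b p (a j + 1) - coverSum a b p (a j) := by
  classical
  unfold coverSum
  rw [← Finset.sum_sub_distrib, Finset.sum_eq_single j]
  · have := hlt j
    rw [if_pos ⟨by omega, by omega⟩, if_neg (by omega), sub_zero]
  · intro l _ hl
    have h1 : a l ≠ a j := fun h => hl (ha h)
    have h2 := hab j l
    have : (a l < a j + 1 ∧ a j + 1 ≤ b l) ↔ (a l < a j ∧ a j ≤ b l) := by omega
    simp only [this, sub_self]
  · simp

theorem coverSum_succ_right {a b : ι → ℕ} (hb : Function.Injective b) (hab : ∀ j l, a j ≠ b l)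
    (hlt : ∀ j, a j < b j) (p : ι → ℝ) (j : ι) :
    p j = coverSum a b p (b j) - coverSum a b p (b j + 1) := by
  classical
  unfold coverSum
  rw [← Finset.sum_sub_distrib, Finset.sum_eq_single j]
  · have := hlt j
    rw [if_pos ⟨by omega, by omega⟩, if_neg (by omega), sub_zero]
  · intro l _ hl
    have h1 : b l ≠ b j := fun h => hl (hb h)
    have h2 := hab l j
    have : (a l < b j + 1 ∧ b j + 1 ≤ b l) ↔ (a l < b j ∧ b j ≤ b l) := by omega
    simp only [this, sub_self]
  · simp

/-- The matrix of the map `p ↦ (coverSum a b p (a j + 1))_j`. -/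
def coverMatrix (a b : ι → ℕ) : Matrix ι ι ℝ :=
  Matrix.of fun j l => if a l < a j + 1 ∧ a j + 1 ≤ b l then 1 else 0

theorem det_coverMatrix [DecidableEq ι] {a b : ι → ℕ} (ha : Function.Injective a)
    (hlt : ∀ j, a j < b j) : (coverMatrix a b).det = 1 := by
  let _ : LinearOrder ι := LinearOrder.lift' a ha
  have hle : ∀ i j : ι, i < j ↔ a i < a j := fun i j => Iff.rfl
  have h := Matrix.det_of_isLowerTriangular (coverMatrix a b) (by
    intro i j hij
    have hij' : a i < a j := (hle i j).1 hij
    have : ¬ (a j < a i + 1 ∧ a i + 1 ≤ b j) := by omega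
    simp only [coverMatrix, Matrix.of_apply, if_neg this])
  have h1 : (coverMatrix a b).det = ∏ i, coverMatrix a b i i := by convert h
  rw [h1]
  refine Finset.prod_eq_one fun i _ => ?_
  have := hlt i
  have : a i < a i + 1 ∧ a i + 1 ≤ b i := by omega
  simp only [coverMatrix, Matrix.of_apply, if_pos this]

end Cover

/-- The `i`-th gap between consecutive points of an ordered configuration `z ∘ e`; gaps before the
first and after the last point are given the length `T`. -/
noncomputable def gap {κ : Type*} {M : ℕ} (T : ℝ) (z : κ → ℝ) (e : Fin M ≃ κ) (i : ℕ) : ℝ :=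
  if h : 0 < i ∧ i < M then z (e ⟨i, h.2⟩) - z (e ⟨i - 1, by omega⟩) else T

section Gap

variable {κ : Type*} {M : ℕ} {T : ℝ} {z : κ → ℝ} {e : Fin M ≃ κ}

theorem gap_pos (hT : 0 < T) (he : StrictMono (z ∘ e)) (i : ℕ) : 0 < gap T z e i := by
  unfold gap
  split_ifs with h
  · rw [sub_pos]
    exact he (a := ⟨i - 1, by omega⟩) (b := ⟨i, h.2⟩) (by rw [Fin.mk_lt_mk]; omega)
  · exact hT

theorem gap_le (hz : ∀ a, z a ∈ Set.Icc 0 T) (i : ℕ) : gap T z e i ≤ T := by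
  unfold gap
  split_ifs with h
  · linarith [(hz (e ⟨i, h.2⟩)).2, (hz (e ⟨i - 1, by omega⟩)).1]
  · exact le_rfl

theorem prod_gap_pos_eq [Fintype κ] (f : ℕ → ℝ) :
    ∏ x : κ, f (e.symm x) = ∏ i ∈ Finset.range M, f i := by
  rw [← Fin.prod_univ_eq_prod_range, ← Equiv.prod_comp e]
  simp

theorem prod_gap_succ (f : ℝ → ℝ) (hf : f T ≠ 0) :
    ∏ i ∈ Finset.range M, f (gap T z e (i + 1)) = ∏ i ∈ Finset.range M, f (gap T z e i) := by
  have h1 := Finset.prod_range_succ (fun i => f (gap T z e i)) M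
  have h2 := Finset.prod_range_succ' (fun i => f (gap T z e i)) M
  have g0 : gap T z e 0 = T := by simp [gap]
  have gM : gap T z e M = T := by simp [gap]
  rw [h1, gM, g0] at h2
  exact (mul_right_cancel₀ hf h2).symm

end Gap

/-- Local nondeterminism along an ordered configuration of endpoints. -/
theorem local_nondeterminism_gap {H : ℝ} (h0 : 0 < H) (h1 : H < 1) :
    ∃ C : ℝ, 0 < C ∧ ∀ {ι : Type} [Fintype ι] {M : ℕ} (r s p : ι → ℝ) (T : ℝ)
      (e : Fin M ≃ ι ⊕ ι), 0 < T →
      StrictMono (Sum.elim r s ∘ e) → (∀ j, r j < s j) → ∀ i : ℕ,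
      (coverSum (fun j => (e.symm (Sum.inl j) : ℕ)) (fun j => (e.symm (Sum.inr j) : ℕ)) p i) ^ 2 *
        gap T (Sum.elim r s) e i ^ (2 * H) ≤ C * incVar H r s p := by
  obtain ⟨C, hC, hL⟩ := local_nondeterminism h0 h1
  refine ⟨C, hC, ?_⟩
  intro ι _ M r s p T e hT he hrs i
  by_cases hi : 0 < i ∧ i < M
  · have hmono : ∀ (x y : ι ⊕ ι), e.symm x ≤ e.symm y ↔ Sum.elim r s x ≤ Sum.elim r s y := by
      intro x y
      have := he.le_iff_le (a := e.symm x) (b := e.symm y)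
      simpa using this.symm
    have hgap : gap T (Sum.elim r s) e i =
        Sum.elim r s (e ⟨i, hi.2⟩) - Sum.elim r s (e ⟨i - 1, by omega⟩) := by
      unfold gap
      rw [dif_pos hi]
    have hlow : ∀ x : ι ⊕ ι, (e.symm x : ℕ) < i ↔
        Sum.elim r s x ≤ Sum.elim r s (e ⟨i - 1, by omega⟩) := by
      intro x
      rw [← hmono, Equiv.symm_apply_apply, Fin.le_def]
      simp only
      omega
    have hhigh : ∀ x : ι ⊕ ι, i ≤ (e.symm x : ℕ) ↔
        Sum.elim r s (e ⟨i, hi.2⟩) ≤ Sum.elim r s x := by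
      intro x
      rw [← hmono, Equiv.symm_apply_apply, Fin.le_def]
    have hor : ∀ x : ι ⊕ ι, Sum.elim r s x ≤ Sum.elim r s (e ⟨i - 1, by omega⟩) ∨
        Sum.elim r s (e ⟨i, hi.2⟩) ≤ Sum.elim r s x := by
      intro x
      rw [← hlow, ← hhigh]
      exact lt_or_ge _ _
    have key := hL r s p _ _ (by
      have := gap_pos hT he i
      rw [hgap] at this
      linarith) (fun j => (hrs j).le) (fun j => hor (Sum.inl j)) (fun j => hor (Sum.inr j))
    rw [hgap]
    unfold coverSum
    simp only [hlow, hhigh, Sum.elim_inl, Sum.elim_inr]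
    exact key
  · have : coverSum (fun j => (e.symm (Sum.inl j) : ℕ))
        (fun j => (e.symm (Sum.inr j) : ℕ)) p i = 0 := by
      unfold coverSum
      refine Finset.sum_eq_zero fun j _ => ?_
      have := (e.symm (Sum.inr j)).2
      exact if_neg (by dsimp only; omega)
    rw [this]
    simp only [ne_eq, OfNat.ofNat_ne_zero, not_false_eq_true, zero_pow, zero_mul]
    exact mul_nonneg hC.le (incVar_nonneg h0 h1 r s p)

/-! ### Gaussian integrals over the frequencies -/

theorem measurePreserving_uncurry (ι κ : Type*) [Fintype ι] [Fintype κ] :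
    MeasurePreserving (fun (f : ι → κ → ℝ) (x : ι × κ) => f x.1 x.2) volume volume := by
  have hm : Measurable (fun (f : ι → κ → ℝ) (x : ι × κ) => f x.1 x.2) := by fun_prop
  refine ⟨hm, ?_⟩
  rw [volume_pi (ι := ι × κ)]
  refine (Measure.pi_eq fun s hs => ?_).symm
  rw [Measure.map_apply hm (MeasurableSet.univ_pi hs)]
  have : (fun (f : ι → κ → ℝ) (x : ι × κ) => f x.1 x.2) ⁻¹' Set.univ.pi s =
      Set.univ.pi fun i => Set.univ.pi fun k => s (i, k) := by
    ext f
    simp [Set.mem_pi]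
  rw [this, volume_pi, Measure.pi_pi, Fintype.prod_prod_type]
  refine Finset.prod_congr rfl fun i _ => ?_
  rw [volume_pi, Measure.pi_pi]

theorem measurePreserving_uncurry_ofLp (ι : Type*) [Fintype ι] (d : ℕ) :
    MeasurePreserving (fun (p : ι → EuclideanSpace ℝ (Fin d)) (x : ι × Fin d) => p x.1 x.2)
      volume volume := by
  have h1 : MeasurePreserving (fun (p : ι → EuclideanSpace ℝ (Fin d)) (j : ι) => (p j).ofLp)
      volume volume :=
    volume_preserving_pi fun _ => PiLp.volume_preserving_ofLp (Fin d)
  exact (measurePreserving_uncurry ι (Fin d)).comp h1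

theorem lintegral_gaussian_pi {ι : Type*} [Fintype ι] (W : ι → ℝ) (hW : ∀ i, 0 < W i) :
    ∫⁻ v : ι → ℝ, ENNReal.ofReal (Real.exp (-∑ i, W i * v i ^ 2)) =
      ENNReal.ofReal (∏ i, Real.sqrt (Real.pi / W i)) := by
  have e : ∀ v : ι → ℝ, Real.exp (-∑ i, W i * v i ^ 2) = ∏ i, Real.exp (-W i * v i ^ 2) := by
    intro v
    rw [← Real.exp_sum]
    congr 1
    rw [← Finset.sum_neg_distrib]
    refine Finset.sum_congr rfl fun i _ => by ring
  simp only [e]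
  rw [← ofReal_integral_eq_lintegral_ofReal]
  · rw [integral_fintype_prod_volume_eq_prod (fun i (x : ℝ) => Real.exp (-W i * x ^ 2))]
    congr 1
    refine Finset.prod_congr rfl fun i _ => ?_
    exact integral_gaussian (W i)
  · exact Integrable.fintype_prod (f := fun i (x : ℝ) => Real.exp (-W i * x ^ 2))
      fun i => integrable_exp_neg_mul_sq (hW i)
  · exact Eventually.of_forall fun v => Finset.prod_nonneg fun i _ => (Real.exp_pos _).le

/-- Gaussian integral in the variables `coverSum a b p (a j + 1)`, which are related to `p` by a
unimodular triangular change of variables. -/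
theorem lintegral_gaussian_coverSum {ι : Type*} [Fintype ι] (d : ℕ) {a b : ι → ℕ}
    (ha : Function.Injective a) (hlt : ∀ j, a j < b j) (W : ι → ℝ) (hW : ∀ i, 0 < W i) :
    ∫⁻ p : ι → EuclideanSpace ℝ (Fin d), ENNReal.ofReal (Real.exp
      (-∑ j, ∑ l, W j * coverSum a b (fun i => p i l) (a j + 1) ^ 2)) =
      ENNReal.ofReal (∏ j, Real.sqrt (Real.pi / W j) ^ d) := by
  classical
  set A : Matrix (ι × Fin d) (ι × Fin d) ℝ :=
    Matrix.kronecker (coverMatrix a b) (1 : Matrix (Fin d) (Fin d) ℝ) with hA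
  have hdet : A.det = 1 := by
    rw [hA, Matrix.kronecker, Matrix.det_kronecker, det_coverMatrix ha hlt]
    simp
  have hmap := Real.map_matrix_volume_pi_eq_smul_volume_pi (M := A) (by rw [hdet]; norm_num)
  rw [hdet] at hmap
  simp only [inv_one, abs_one, ENNReal.ofReal_one, one_smul] at hmap
  have happ : ∀ (p : ι → EuclideanSpace ℝ (Fin d)) (j : ι) (l : Fin d),
      Matrix.toLin' A (fun x : ι × Fin d => p x.1 x.2) (j, l) =
        coverSum a b (fun i => p i l) (a j + 1) := by
    intro p j l
    rw [Matrix.toLin'_apply, Matrix.mulVec, dotProduct, Fintype.sum_prod_type]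
    unfold coverSum
    refine Finset.sum_congr rfl fun i _ => ?_
    simp [hA, Matrix.kronecker, Matrix.kroneckerMap_apply, coverMatrix, Matrix.one_apply]
  set f : (ι × Fin d → ℝ) → ℝ≥0∞ := fun v =>
    ENNReal.ofReal (Real.exp (-∑ x, W x.1 * v x ^ 2)) with hf
  have hfm : Measurable f := by rw [hf]; fun_prop
  have hlm : Measurable (Matrix.toLin' A) :=
    (LinearMap.continuous_of_finiteDimensional (Matrix.toLin' A)).measurable
  have hcomp := (measurePreserving_uncurry_ofLp ι d).lintegral_comp (hfm.comp hlm)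
  have e1 : ∀ p : ι → EuclideanSpace ℝ (Fin d), ENNReal.ofReal (Real.exp
      (-∑ j, ∑ l, W j * coverSum a b (fun i => p i l) (a j + 1) ^ 2)) =
      (f ∘ Matrix.toLin' A) (fun x : ι × Fin d => p x.1 x.2) := by
    intro p
    simp only [hf, Function.comp, Fintype.sum_prod_type, happ]
  simp only [e1]
  rw [hcomp]
  simp only [Function.comp]
  rw [← lintegral_map hfm hlm, hmap, hf, lintegral_gaussian_pi (fun x : ι × Fin d => W x.1) fun x => hW x.1,
    Fintype.prod_prod_type]
  simp

/-- The variance of `∑ j, ⟪p j, W (s j) - W (r j)⟫` for a `d`-dimensional fractional Brownian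
motion `W` with independent components. -/
noncomputable def totVar {ι : Type*} [Fintype ι] {d : ℕ} (H : ℝ) (r s : ι → ℝ)
    (p : ι → EuclideanSpace ℝ (Fin d)) : ℝ :=
  ∑ l, incVar H r s fun j => p j l

theorem totVar_nonneg {ι : Type*} [Fintype ι] {d : ℕ} {H : ℝ} (h0 : 0 < H) (h1 : H < 1)
    (r s : ι → ℝ) (p : ι → EuclideanSpace ℝ (Fin d)) : 0 ≤ totVar H r s p :=
  Finset.sum_nonneg fun _ _ => incVar_nonneg h0 h1 _ _ _

theorem exists_rpow_mul_exp_neg_le {m c : ℝ} (hm : 0 ≤ m) (hc : 0 < c) :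
    ∃ C : ℝ, 0 < C ∧ ∀ x : ℝ, 0 ≤ x → x ^ m * Real.exp (-(c * x)) ≤ C := by
  obtain ⟨N, hN⟩ := exists_nat_ge m
  refine ⟨1 + N.factorial / c ^ N, by positivity, fun x hx => ?_⟩
  have h1 : x ^ m ≤ 1 + x ^ N := by
    rcases le_total x 1 with h | h
    · have := Real.rpow_le_one hx h hm
      have : 0 ≤ x ^ N := by positivity
      linarith
    · have := Real.rpow_le_rpow_of_exponent_le h hN
      rw [Real.rpow_natCast] at this
      linarith
  have h2 : (c * x) ^ N / N.factorial ≤ Real.exp (c * x) :=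
    Real.pow_div_factorial_le_exp _ (by positivity) N
  have h3 : x ^ N ≤ N.factorial / c ^ N * Real.exp (c * x) := by
    rw [div_le_iff₀ (by positivity), mul_pow] at h2
    rw [div_mul_eq_mul_div, le_div_iff₀ (by positivity)]
    linarith
  have h4 : 1 ≤ Real.exp (c * x) := Real.one_le_exp (by positivity)
  rw [Real.exp_neg, ← div_eq_mul_inv, div_le_iff₀ (Real.exp_pos _)]
  linarith

theorem abs_le_norm_le_sum {d : ℕ} (v : EuclideanSpace ℝ (Fin d)) : ‖v‖ ≤ ∑ l, |v l| := by
  rw [EuclideanSpace.norm_eq]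
  refine Real.sqrt_le_iff.2 ⟨Finset.sum_nonneg fun _ _ => abs_nonneg _, ?_⟩
  simp only [Real.norm_eq_abs]
  exact Finset.sum_sq_le_sq_sum_of_nonneg fun i _ => abs_nonneg _

/-- Pointwise form of the momentum estimate. Each factor `‖p j‖ ^ κ` is split into two halves, one
estimated by the gaps next to `r j`, the other by the gaps next to `s j`; as every gap has two
ends, it carries the power `κ` of its inverse only. -/
theorem prod_norm_rpow_mul_exp_le {H : ℝ} (h0 : 0 < H) (h1 : H < 1) (d n : ℕ) {κ T : ℝ}
    (hκ : 0 ≤ κ) (hT : 0 < T) :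
    ∃ C c : ℝ, 0 < C ∧ 0 < c ∧ ∀ {M : ℕ} (r s : Fin n → ℝ) (e : Fin M ≃ Fin n ⊕ Fin n),
      StrictMono (Sum.elim r s ∘ e) → (∀ j, r j < s j) →
      (∀ a, Sum.elim r s a ∈ Set.Icc 0 T) → ∀ p : Fin n → EuclideanSpace ℝ (Fin d),
      (∏ j, ‖p j‖ ^ κ) * Real.exp (-(totVar H r s p / 2)) ≤
        C * (∏ i ∈ Finset.range M, gap T (Sum.elim r s) e i ^ (-H)) ^ κ *
        Real.exp (-∑ j, ∑ l, (c * gap T (Sum.elim r s) e ((e.symm (Sum.inl j) : ℕ) + 1) ^ (2 * H)) *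
          coverSum (fun j => (e.symm (Sum.inl j) : ℕ)) (fun j => (e.symm (Sum.inr j) : ℕ))
            (fun j => p j l) ((e.symm (Sum.inl j) : ℕ) + 1) ^ 2) := by
  obtain ⟨C₀, hC₀, hL⟩ := local_nondeterminism_gap h0 h1
  set K : ℝ := (d + 1) * (Real.sqrt C₀ * (2 * T ^ H)) with hK
  have hK0 : 0 < K := by positivity
  obtain ⟨C₁, hC₁, hexp⟩ := exists_rpow_mul_exp_neg_le (m := κ * n / 2) (c := 1 / 4)
    (by positivity) (by norm_num)
  refine ⟨K ^ (κ * n) * C₁, 1 / (4 * (n + 1) * C₀), by positivity, by positivity, ?_⟩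
  intro M r s e he hrs hz p
  set z := Sum.elim r s with hzdef
  set a : Fin n → ℕ := fun j => (e.symm (Sum.inl j) : ℕ) with ha
  set b : Fin n → ℕ := fun j => (e.symm (Sum.inr j) : ℕ) with hb
  set V := totVar H r s p with hV
  have hV0 : 0 ≤ V := totVar_nonneg h0 h1 r s p
  have hgp : ∀ i, 0 < gap T z e i := gap_pos hT he
  set g : ℕ → ℝ := fun i => gap T z e i ^ (-H) with hg
  have hg0 : ∀ i, 0 < g i := fun i => Real.rpow_pos_of_pos (hgp i) _
  have hgT : ∀ i, 1 ≤ T ^ H * g i := by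
    intro i
    have : T ^ (-H) ≤ g i := Real.rpow_le_rpow_of_nonpos (hgp i) (gap_le hz i) (by linarith)
    calc (1 : ℝ) = T ^ H * T ^ (-H) := by rw [← Real.rpow_add hT]; simp
      _ ≤ _ := by gcongr
  have hga : Function.Injective a := fun i j hij => by
    have := e.symm.injective (Fin.ext hij)
    simpa using this
  have hgb : Function.Injective b := fun i j hij => by
    have := e.symm.injective (Fin.ext hij)
    simpa using this
  have hgab : ∀ i j, a i ≠ b j := fun i j hij => by
    have := e.symm.injective (Fin.ext hij)
    simp at this
  have hlt : ∀ j, a j < b j := by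
    intro j
    have := (he.lt_iff_lt (a := e.symm (Sum.inl j)) (b := e.symm (Sum.inr j))).1
      (by simpa [hzdef] using hrs j)
    exact this
  have hVl : ∀ l, incVar H r s (fun j => p j l) ≤ V := fun l =>
    Finset.single_le_sum (f := fun l => incVar H r s fun j => p j l)
      (fun l _ => incVar_nonneg h0 h1 _ _ _) (Finset.mem_univ l)
  -- each covering sum is controlled by its gap
  have hu : ∀ i l, |coverSum a b (fun j => p j l) i| ≤ Real.sqrt C₀ * Real.sqrt V * g i := by
    intro i l
    have h2 := (hL r s (fun j => p j l) T e hT he hrs i).trans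
      (mul_le_mul_of_nonneg_left (hVl l) hC₀.le)
    have hw : gap T z e i ^ (2 * H) * (g i * g i) = 1 := by
      rw [hg, ← Real.rpow_add (hgp i), ← Real.rpow_add (hgp i)]
      ring_nf
      exact Real.rpow_zero _
    rw [← Real.sqrt_mul hC₀.le]
    refine abs_le_of_sq_le_sq ?_ (mul_nonneg (Real.sqrt_nonneg _) (hg0 i).le)
    rw [mul_pow, Real.sq_sqrt (mul_nonneg hC₀.le hV0)]
    calc _ = coverSum a b (fun j => p j l) i ^ 2 * (gap T z e i ^ (2 * H) * (g i * g i)) := by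
          rw [hw, mul_one]
      _ = (coverSum a b (fun j => p j l) i ^ 2 * gap T z e i ^ (2 * H)) * (g i * g i) := by ring
      _ ≤ C₀ * V * (g i * g i) :=
          mul_le_mul_of_nonneg_right h2 (mul_nonneg (hg0 i).le (hg0 i).le)
      _ = _ := by ring
  have hadd : ∀ i, g i + g (i + 1) ≤ 2 * T ^ H * (g i * g (i + 1)) := by
    intro i
    have h3 := mul_le_mul_of_nonneg_right (hgT i) (hg0 (i + 1)).le
    have h4 := mul_le_mul_of_nonneg_right (hgT (i + 1)) (hg0 i).le
    nlinarith
  have hcomb : ∀ j i, (∀ l, |p j l| ≤ |coverSum a b (fun j => p j l) i| +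
      |coverSum a b (fun j => p j l) (i + 1)|) →
      ‖p j‖ ≤ K * Real.sqrt V * (g i * g (i + 1)) := by
    intro j i hl
    have hb : ∀ l, |p j l| ≤ Real.sqrt C₀ * Real.sqrt V * (2 * T ^ H * (g i * g (i + 1))) := by
      intro l
      calc |p j l| ≤ Real.sqrt C₀ * Real.sqrt V * g i + Real.sqrt C₀ * Real.sqrt V * g (i + 1) :=
            (hl l).trans (add_le_add (hu i l) (hu (i + 1) l))
        _ = Real.sqrt C₀ * Real.sqrt V * (g i + g (i + 1)) := by ring
        _ ≤ _ := mul_le_mul_of_nonneg_left (hadd i) (by positivity)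
    calc ‖p j‖ ≤ ∑ l, |p j l| := abs_le_norm_le_sum _
      _ ≤ ∑ _l : Fin d, Real.sqrt C₀ * Real.sqrt V * (2 * T ^ H * (g i * g (i + 1))) :=
          Finset.sum_le_sum fun l _ => hb l
      _ = d * (Real.sqrt C₀ * Real.sqrt V * (2 * T ^ H * (g i * g (i + 1)))) := by simp
      _ ≤ (d + 1) * (Real.sqrt C₀ * Real.sqrt V * (2 * T ^ H * (g i * g (i + 1)))) := by
          have := hg0 i
          have := hg0 (i + 1)
          gcongr
          linarith
      _ = _ := by rw [hK]; ring
  have hpa : ∀ j, ‖p j‖ ≤ K * Real.sqrt V * (g (a j) * g (a j + 1)) := by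
    intro j
    refine hcomb j (a j) fun l => ?_
    have e1 := coverSum_succ_left hga hgab hlt (fun j => p j l) j
    simp only at e1
    rw [e1, abs_sub_comm]
    exact abs_sub _ _
  have hpb : ∀ j, ‖p j‖ ≤ K * Real.sqrt V * (g (b j) * g (b j + 1)) := by
    intro j
    refine hcomb j (b j) fun l => ?_
    have e1 := coverSum_succ_right hgb hgab hlt (fun j => p j l) j
    simp only at e1
    rw [e1]
    exact abs_sub _ _
  have hKV : 0 ≤ K * Real.sqrt V := by positivity
  -- split the power into two halves
  have hpj : ∀ j, ‖p j‖ ^ κ ≤ (K * Real.sqrt V) ^ κ *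
      (((g (a j) * g (a j + 1)) * (g (b j) * g (b j + 1))) ^ (κ / 2)) := by
    intro j
    have q1 : 0 ≤ g (a j) * g (a j + 1) := (mul_pos (hg0 _) (hg0 _)).le
    have q2 : 0 ≤ g (b j) * g (b j + 1) := (mul_pos (hg0 _) (hg0 _)).le
    have e2 : ∀ x : ℝ, 0 ≤ x → x ^ κ = x ^ (κ / 2) * x ^ (κ / 2) := by
      intro x hx
      rw [← Real.mul_rpow hx hx, ← sq, ← Real.rpow_natCast, ← Real.rpow_mul hx]
      congr 1
      push_cast
      ring
    rw [e2 _ (norm_nonneg _), e2 _ hKV, Real.mul_rpow q1 q2]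
    calc ‖p j‖ ^ (κ / 2) * ‖p j‖ ^ (κ / 2) ≤ (K * Real.sqrt V * (g (a j) * g (a j + 1))) ^ (κ / 2) *
          (K * Real.sqrt V * (g (b j) * g (b j + 1))) ^ (κ / 2) :=
          mul_le_mul (Real.rpow_le_rpow (norm_nonneg _) (hpa j) (by positivity))
            (Real.rpow_le_rpow (norm_nonneg _) (hpb j) (by positivity))
            (Real.rpow_nonneg (norm_nonneg _) _) (Real.rpow_nonneg (mul_nonneg hKV q1) _)
      _ = _ := by
          rw [Real.mul_rpow hKV q1, Real.mul_rpow hKV q2]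
          ring
  set G := ∏ i ∈ Finset.range M, g i with hG
  have hG0 : 0 < G := Finset.prod_pos fun i _ => hg0 i
  have hprod : ∏ j, ((g (a j) * g (a j + 1)) * (g (b j) * g (b j + 1))) = G ^ 2 := by
    have e3 : G = ∏ i ∈ Finset.range M, g (i + 1) :=
      (prod_gap_succ (fun x => x ^ (-H)) (Real.rpow_pos_of_pos hT _).ne').symm
    have e4 := prod_gap_pos_eq (e := e) g
    have e5 := prod_gap_pos_eq (e := e) fun i => g (i + 1)
    rw [Fintype.prod_sum_type] at e4 e5
    rw [sq]
    nth_rewrite 2 [e3]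
    rw [hG, ← e4, ← e5, ← Finset.prod_mul_distrib, ← Finset.prod_mul_distrib,
      ← Finset.prod_mul_distrib]
    refine Finset.prod_congr rfl fun j _ => ?_
    simp only [ha, hb]
    ring
  have hmain : ∏ j, ‖p j‖ ^ κ ≤ K ^ (κ * n) * V ^ (κ * n / 2) * G ^ κ := by
    calc ∏ j, ‖p j‖ ^ κ ≤ ∏ j, ((K * Real.sqrt V) ^ κ *
        (((g (a j) * g (a j + 1)) * (g (b j) * g (b j + 1))) ^ (κ / 2))) :=
          Finset.prod_le_prod (fun j _ => Real.rpow_nonneg (norm_nonneg _) _) fun j _ => hpj j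
      _ = ((K * Real.sqrt V) ^ κ) ^ n * (G ^ 2) ^ (κ / 2) := by
          rw [Finset.prod_mul_distrib, Finset.prod_const, Finset.card_univ, Fintype.card_fin,
            Real.finsetProd_rpow _ _ fun j _ => (mul_pos (mul_pos (hg0 _) (hg0 _))
              (mul_pos (hg0 _) (hg0 _))).le, hprod]
      _ = _ := by
          rw [← Real.rpow_natCast, ← Real.rpow_mul hKV, ← Real.rpow_natCast,
            ← Real.rpow_mul hG0.le, Real.mul_rpow hK0.le (Real.sqrt_nonneg _),
            Real.sqrt_eq_rpow, ← Real.rpow_mul hV0]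
          congr 2
          · congr 1
            ring
          · push_cast
            ring
  -- half of the variance pays for the power of `V`, the other half for the Gaussian factor
  have hsum : ∑ j, ∑ l, (1 / (4 * (n + 1) * C₀) * gap T z e (a j + 1) ^ (2 * H)) *
      coverSum a b (fun j => p j l) (a j + 1) ^ 2 ≤ V / 4 := by
    have hj : ∀ j, ∑ l, (1 / (4 * (n + 1) * C₀) * gap T z e (a j + 1) ^ (2 * H)) *
        coverSum a b (fun j => p j l) (a j + 1) ^ 2 ≤ 1 / (4 * (n + 1)) * V := by
      intro j
      rw [hV, totVar, Finset.mul_sum]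
      refine Finset.sum_le_sum fun l _ => ?_
      have := hL r s (fun j => p j l) T e hT he hrs (a j + 1)
      calc _ = 1 / (4 * (n + 1) * C₀) * (coverSum a b (fun j => p j l) (a j + 1) ^ 2 *
            gap T z e (a j + 1) ^ (2 * H)) := by ring
        _ ≤ 1 / (4 * (n + 1) * C₀) * (C₀ * incVar H r s fun j => p j l) :=
            mul_le_mul_of_nonneg_left this (by positivity)
        _ = _ := by field_simp
    calc _ ≤ ∑ _j : Fin n, 1 / (4 * ((n : ℝ) + 1)) * V := Finset.sum_le_sum fun j _ => hj j
      _ = n / (n + 1) * (V / 4) := by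
          rw [Finset.sum_const, Finset.card_univ, Fintype.card_fin, nsmul_eq_mul]
          field_simp
      _ ≤ 1 * (V / 4) := by
          gcongr
          rw [div_le_one (by positivity)]
          linarith
      _ = V / 4 := one_mul _
  have hE : Real.exp (-(V / 2)) = Real.exp (-(1 / 4 * V)) * Real.exp (-(V / 4)) := by
    rw [← Real.exp_add]
    congr 1
    ring
  calc (∏ j, ‖p j‖ ^ κ) * Real.exp (-(V / 2))
      ≤ K ^ (κ * n) * V ^ (κ * n / 2) * G ^ κ *
        (Real.exp (-(1 / 4 * V)) * Real.exp (-(V / 4))) := by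
        rw [hE]
        gcongr
    _ = K ^ (κ * n) * (V ^ (κ * n / 2) * Real.exp (-(1 / 4 * V))) * G ^ κ *
        Real.exp (-(V / 4)) := by ring
    _ ≤ K ^ (κ * n) * C₁ * G ^ κ * Real.exp (-∑ j, ∑ l,
        (1 / (4 * (n + 1) * C₀) * gap T z e (a j + 1) ^ (2 * H)) *
          coverSum a b (fun j => p j l) (a j + 1) ^ 2) := by
        have := hexp V hV0
        gcongr

/-- The momentum integral is bounded by a power of the inverse gaps. -/
theorem lintegral_prod_norm_rpow_mul_exp_le {H : ℝ} (h0 : 0 < H) (h1 : H < 1) (d n : ℕ) {κ T : ℝ}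
    (hκ : 0 ≤ κ) (hT : 0 < T) :
    ∃ C : ℝ, 0 < C ∧ ∀ {M : ℕ} (r s : Fin n → ℝ) (e : Fin M ≃ Fin n ⊕ Fin n),
      StrictMono (Sum.elim r s ∘ e) → (∀ j, r j < s j) →
      (∀ a, Sum.elim r s a ∈ Set.Icc 0 T) →
      ∫⁻ p : Fin n → EuclideanSpace ℝ (Fin d),
        ENNReal.ofReal ((∏ j, ‖p j‖ ^ κ) * Real.exp (-(totVar H r s p / 2))) ≤
      ENNReal.ofReal (C * ∏ i ∈ Finset.range M,
        gap T (Sum.elim r s) e i ^ (-(H * (κ + d)))) := by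
  obtain ⟨C, c, hC, hc, hb⟩ := prod_norm_rpow_mul_exp_le h0 h1 d n hκ hT
  refine ⟨C * (Real.sqrt (Real.pi / c) ^ d) ^ n * ((T ^ H) ^ n) ^ d, by positivity, ?_⟩
  intro M r s e he hrs hz
  set z := Sum.elim r s with hzdef
  set a : Fin n → ℕ := fun j => (e.symm (Sum.inl j) : ℕ) with ha
  set b : Fin n → ℕ := fun j => (e.symm (Sum.inr j) : ℕ) with hbd
  have hgp : ∀ i, 0 < gap T z e i := gap_pos hT he
  set g : ℕ → ℝ := fun i => gap T z e i ^ (-H) with hg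
  have hg0 : ∀ i, 0 < g i := fun i => Real.rpow_pos_of_pos (hgp i) _
  have hgT : ∀ i, 1 ≤ T ^ H * g i := by
    intro i
    have : T ^ (-H) ≤ g i := Real.rpow_le_rpow_of_nonpos (hgp i) (gap_le hz i) (by linarith)
    calc (1 : ℝ) = T ^ H * T ^ (-H) := by rw [← Real.rpow_add hT]; simp
      _ ≤ _ := by gcongr
  have hga : Function.Injective a := fun i j hij => by
    have := e.symm.injective (Fin.ext hij)
    simpa using this
  have hlt : ∀ j, a j < b j := by
    intro j
    exact (he.lt_iff_lt (a := e.symm (Sum.inl j)) (b := e.symm (Sum.inr j))).1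
      (by simpa [hzdef] using hrs j)
  set G := ∏ i ∈ Finset.range M, g i with hG
  have hG0 : 0 < G := Finset.prod_pos fun i _ => hg0 i
  have hprod : ∏ j, g (a j + 1) ≤ (T ^ H) ^ n * G := by
    have e3 : G = ∏ i ∈ Finset.range M, g (i + 1) :=
      (prod_gap_succ (fun x => x ^ (-H)) (Real.rpow_pos_of_pos hT _).ne').symm
    have e5 := prod_gap_pos_eq (e := e) fun i => g (i + 1)
    rw [Fintype.prod_sum_type] at e5
    rw [e3, ← e5]
    have h2 : 1 ≤ ∏ j : Fin n, (T ^ H * g (b j + 1)) := by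
      have := Finset.prod_le_prod (s := (Finset.univ : Finset (Fin n))) (f := fun _ => (1 : ℝ))
        (g := fun j => T ^ H * g (b j + 1)) (fun _ _ => zero_le_one) (fun j _ => hgT _)
      simpa using this
    rw [Finset.prod_mul_distrib, Finset.prod_const, Finset.card_univ, Fintype.card_fin] at h2
    have h3 : 0 < ∏ j, g (a j + 1) := Finset.prod_pos fun j _ => hg0 _
    calc ∏ j, g (a j + 1) = (∏ j, g (a j + 1)) * 1 := (mul_one _).symm
      _ ≤ (∏ j, g (a j + 1)) * ((T ^ H) ^ n * ∏ j, g (b j + 1)) := by gcongr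
      _ = _ := by ring
  have hW : ∀ j, 0 < c * gap T z e (a j + 1) ^ (2 * H) := fun j =>
    mul_pos hc (Real.rpow_pos_of_pos (hgp _) _)
  have hsq : ∀ j, Real.sqrt (Real.pi / (c * gap T z e (a j + 1) ^ (2 * H))) =
      Real.sqrt (Real.pi / c) * g (a j + 1) := by
    intro j
    have e6 : Real.pi / (c * gap T z e (a j + 1) ^ (2 * H)) = Real.pi / c * g (a j + 1) ^ 2 := by
      rw [hg, div_mul_eq_div_div, ← Real.rpow_natCast, ← Real.rpow_mul (hgp _).le, div_eq_mul_inv,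
        ← Real.rpow_neg (hgp _).le]
      congr 2
      push_cast
      ring
    rw [e6, Real.sqrt_mul (by positivity), Real.sqrt_sq (hg0 _).le]
  have hGκ : 0 ≤ C * G ^ κ := by positivity
  calc ∫⁻ p : Fin n → EuclideanSpace ℝ (Fin d),
        ENNReal.ofReal ((∏ j, ‖p j‖ ^ κ) * Real.exp (-(totVar H r s p / 2)))
      ≤ ∫⁻ p : Fin n → EuclideanSpace ℝ (Fin d), ENNReal.ofReal (C * G ^ κ) *
        ENNReal.ofReal (Real.exp (-∑ j, ∑ l, (c * gap T z e (a j + 1) ^ (2 * H)) *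
          coverSum a b (fun j => p j l) (a j + 1) ^ 2)) := by
        refine lintegral_mono fun p => ?_
        rw [← ENNReal.ofReal_mul hGκ]
        exact ENNReal.ofReal_le_ofReal (hb r s e he hrs hz p)
    _ = ENNReal.ofReal (C * G ^ κ) * ENNReal.ofReal (∏ j,
          Real.sqrt (Real.pi / (c * gap T z e (a j + 1) ^ (2 * H))) ^ d) := by
        rw [lintegral_const_mul' _ _ ENNReal.ofReal_ne_top,
          lintegral_gaussian_coverSum d hga hlt _ hW]
    _ = ENNReal.ofReal ((C * G ^ κ) * ((Real.sqrt (Real.pi / c) ^ d) ^ n *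
          (∏ j, g (a j + 1)) ^ d)) := by
        rw [← ENNReal.ofReal_mul hGκ]
        congr 2
        simp only [hsq, mul_pow]
        rw [Finset.prod_mul_distrib, Finset.prod_pow, Finset.prod_const, Finset.card_univ,
          Fintype.card_fin, Finset.prod_pow, ← pow_mul, ← pow_mul, mul_comm n d]
    _ ≤ _ := by
        refine ENNReal.ofReal_le_ofReal ?_
        have e7 : ∏ i ∈ Finset.range M, gap T z e i ^ (-(H * (κ + d))) = G ^ κ * G ^ d := by
          rw [← Real.rpow_natCast, ← Real.rpow_add hG0, hG,
            ← Real.finsetProd_rpow _ _ fun i _ => (hg0 i).le]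
          refine Finset.prod_congr rfl fun i _ => ?_
          rw [hg, ← Real.rpow_mul (hgp i).le]
          congr 1
          ring
        rw [e7]
        have h8 : 0 ≤ ∏ j, g (a j + 1) := Finset.prod_nonneg fun j _ => (hg0 _).le
        calc _ ≤ (C * G ^ κ) * ((Real.sqrt (Real.pi / c) ^ d) ^ n * ((T ^ H) ^ n * G) ^ d) := by
              gcongr
          _ = _ := by ring

/-! ### Integration over the time configurations -/

/-- The product of inverse powers of the distances of consecutive points. -/
noncomputable def chainKernel (γ : ℝ) {m : ℕ} (w : Fin (m + 1) → ℝ) : ℝ≥0∞ :=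
  ∏ i : Fin m, ENNReal.ofReal |w i.succ - w i.castSucc| ^ (-γ)

theorem measurable_chainKernel (γ : ℝ) (m : ℕ) :
    Measurable (chainKernel γ : (Fin (m + 1) → ℝ) → ℝ≥0∞) := by
  unfold chainKernel
  fun_prop

theorem exists_lintegral_dist_rpow_le {γ T : ℝ} (hγ0 : 0 ≤ γ) (hγ : γ < 1) (hT : 0 < T) :
    ∃ K : ℝ≥0∞, K ≠ ∞ ∧ ∀ y : ℝ,
      ∫⁻ x in Set.Icc 0 T, ENNReal.ofReal |y - x| ^ (-γ) ≤ K := by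
  set Φ : ℝ → ℝ≥0∞ := (Set.Icc 0 T).indicator fun u => ENNReal.ofReal u ^ (-γ) with hΦ
  have hΦm : Measurable Φ := by
    rw [hΦ]
    exact Measurable.indicator (by fun_prop) measurableSet_Icc
  have hΦi : ∫⁻ u, Φ u ≠ ∞ := by
    have hi : IntegrableOn (fun u : ℝ => u ^ (-γ)) (Set.Ioc 0 T) := by
      rw [← intervalIntegrable_iff_integrableOn_Ioc_of_le hT.le]
      exact intervalIntegral.intervalIntegrable_rpow' (by linarith)
    rw [hΦ, lintegral_indicator measurableSet_Icc, ← Measure.restrict_congr_set Ioc_ae_eq_Icc]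
    have e : ∫⁻ u in Set.Ioc 0 T, ENNReal.ofReal u ^ (-γ) =
        ∫⁻ u in Set.Ioc 0 T, ENNReal.ofReal (u ^ (-γ)) := by
      refine setLIntegral_congr_fun measurableSet_Ioc fun u hu => ?_
      exact ENNReal.ofReal_rpow_of_pos hu.1
    rw [e]
    exact hi.lintegral_lt_top.ne
  have hTγ : ENNReal.ofReal T ^ (-γ) ≠ ∞ :=
    ENNReal.rpow_ne_top_of_ne_zero (by simpa using hT) ENNReal.ofReal_ne_top
  refine ⟨(∫⁻ u, Φ u) + (∫⁻ u, Φ u) + ENNReal.ofReal T ^ (-γ) * volume (Set.Icc 0 T), ?_, ?_⟩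
  · refine ENNReal.add_ne_top.2 ⟨ENNReal.add_ne_top.2 ⟨hΦi, hΦi⟩, ENNReal.mul_ne_top hTγ ?_⟩
    simp
  · intro y
    calc ∫⁻ x in Set.Icc 0 T, ENNReal.ofReal |y - x| ^ (-γ)
        ≤ ∫⁻ x in Set.Icc 0 T, (Φ (y - x) + Φ (x - y) + ENNReal.ofReal T ^ (-γ)) := by
          refine lintegral_mono fun x => ?_
          rcases le_total |y - x| T with h | h
          · rcases abs_cases (y - x) with ⟨h1, h2⟩ | ⟨h1, h2⟩
            · have : Φ (y - x) = ENNReal.ofReal |y - x| ^ (-γ) := by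
                rw [hΦ, Set.indicator_of_mem (Set.mem_Icc.2 ⟨h2, by rwa [← h1]⟩), h1]
              rw [← this, add_assoc]
              exact le_self_add
            · have : Φ (x - y) = ENNReal.ofReal |y - x| ^ (-γ) := by
                rw [hΦ, Set.indicator_of_mem (Set.mem_Icc.2 ⟨by linarith, by linarith⟩), h1, neg_sub]
              rw [← this, add_comm (Φ (y - x)), add_assoc]
              exact le_self_add
          · refine le_trans ?_ le_add_self
            rw [ENNReal.rpow_neg, ENNReal.rpow_neg, ENNReal.inv_le_inv]
            exact ENNReal.rpow_le_rpow (ENNReal.ofReal_le_ofReal h) hγ0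
      _ = (∫⁻ x in Set.Icc 0 T, (Φ (y - x) + Φ (x - y))) +
          ENNReal.ofReal T ^ (-γ) * volume (Set.Icc 0 T) := by
          rw [lintegral_add_right _ measurable_const, setLIntegral_const]
      _ ≤ (∫⁻ x, (Φ (y - x) + Φ (x - y))) +
          ENNReal.ofReal T ^ (-γ) * volume (Set.Icc 0 T) := by
          gcongr
          exact Measure.restrict_le_self
      _ = _ := by
          rw [lintegral_add_left (by fun_prop), lintegral_sub_left_eq_self Φ y,
            lintegral_sub_right_eq_self Φ y]

theorem lintegral_chainKernel_le (γ : ℝ) {K : ℝ≥0∞} (μ : Measure ℝ) [SigmaFinite μ]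
    (hK : ∀ y : ℝ, ∫⁻ x, ENNReal.ofReal |y - x| ^ (-γ) ∂μ ≤ K) (m : ℕ) :
    ∫⁻ w, chainKernel γ w ∂(Measure.pi fun _ : Fin (m + 1) => μ) ≤ μ Set.univ * K ^ m := by
  induction m with
  | zero => simp [chainKernel, Measure.pi_univ]
  | succ m ih =>
    have hmp := measurePreserving_piFinSuccAbove (fun _ : Fin (m + 2) => μ) 0
    have e : ∀ w : Fin (m + 2) → ℝ, chainKernel γ w =
        (fun x : ℝ × (Fin (m + 1) → ℝ) => ENNReal.ofReal |x.2 0 - x.1| ^ (-γ) *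
          chainKernel γ x.2) (MeasurableEquiv.piFinSuccAbove (fun _ => ℝ) 0 w) := by
      intro w
      simp only [chainKernel]
      rw [Fin.prod_univ_succ]
      rfl
    have hmeas : Measurable (fun x : ℝ × (Fin (m + 1) → ℝ) => ENNReal.ofReal |x.2 0 - x.1| ^ (-γ) *
          chainKernel γ x.2) := by
      have := measurable_chainKernel γ m
      fun_prop
    simp only [e]
    rw [hmp.lintegral_comp hmeas, lintegral_prod_symm _ hmeas.aemeasurable]
    have e2 : ∀ v : Fin (m + 1) → ℝ, ∫⁻ x, ENNReal.ofReal |v 0 - x| ^ (-γ) *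
          chainKernel γ v ∂μ ≤ K * chainKernel γ v := by
      intro v
      rw [lintegral_mul_const _ (by fun_prop)]
      gcongr
      exact hK _
    calc _ ≤ ∫⁻ v, K * chainKernel γ v ∂(Measure.pi fun _ : Fin (m + 1) => μ) :=
          lintegral_mono e2
      _ = K * ∫⁻ v, chainKernel γ v ∂(Measure.pi fun _ : Fin (m + 1) => μ) :=
          lintegral_const_mul _ (measurable_chainKernel γ m)
      _ ≤ K * (μ Set.univ * K ^ m) := by gcongr
      _ = _ := by ring

/-- All endpoints of the intervals `(q j).1, (q j).2`. -/
def endpoints {n : ℕ} (q : Fin n → ℝ × ℝ) : Fin n ⊕ Fin n → ℝ :=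
  Sum.elim (fun j => (q j).1) (fun j => (q j).2)

theorem measurePreserving_endpoints (n : ℕ) (μ : Measure ℝ) [SigmaFinite μ] :
    MeasurePreserving (endpoints (n := n)) (Measure.pi fun _ => μ.prod μ)
      (Measure.pi fun _ => μ) := by
  have h1 := measurePreserving_arrowProdEquivProdArrow ℝ ℝ (Fin n) (fun _ => μ) (fun _ => μ)
  have h2 := measurePreserving_sumPiEquivProdPi_symm (X := fun _ : Fin n ⊕ Fin n => ℝ) (fun _ => μ)
  have h3 := h2.comp h1
  have e : (endpoints (n := n)) =
      (MeasurableEquiv.sumPiEquivProdPi (fun _ : Fin n ⊕ Fin n => ℝ)).symm ∘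
        MeasurableEquiv.arrowProdEquivProdArrow ℝ ℝ (Fin n) := by
    funext q a
    cases a <;> rfl
  rw [e]
  exact h3

theorem measurable_endpoints (n : ℕ) : Measurable (endpoints (n := n)) :=
  (measurePreserving_endpoints n volume).measurable

theorem ae_injective_pi {κ : Type*} [Fintype κ] : ∀ᵐ z : κ → ℝ, Function.Injective z := by
  have h : ∀ a b : κ, a ≠ b → ∀ᵐ z : κ → ℝ, z a ≠ z b := by
    intro a b hab
    set S : Submodule ℝ (κ → ℝ) :=
      LinearMap.ker ((LinearMap.proj a : (κ → ℝ) →ₗ[ℝ] ℝ) - LinearMap.proj b) with hS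
    have hne : S ≠ ⊤ := by
      classical
      intro h
      have : (Pi.single a 1 : κ → ℝ) ∈ S := by rw [h]; trivial
      simp [hS, Pi.single_eq_of_ne hab.symm] at this
    have h0 := Measure.addHaar_submodule volume S hne
    rw [ae_iff]
    refine measure_mono_null ?_ h0
    intro z hz
    have : z a = z b := by simpa using hz
    simp [hS, this]
  have h' : ∀ᵐ z : κ → ℝ, ∀ a b : κ, a ≠ b → z a ≠ z b := by
    rw [ae_all_iff]
    intro a
    rw [ae_all_iff]
    intro b
    by_cases hab : a = b
    · exact Eventually.of_forall fun z hz => absurd hab hz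
    · filter_upwards [h a b hab] with z hz _ using hz
  filter_upwards [h'] with z hz a b hab
  by_contra hne
  exact hz a b hne hab

/-- Every injective configuration can be listed in increasing order. -/
theorem exists_strictMono_equiv {κ : Type*} [Fintype κ] {M : ℕ} (hM : Fintype.card κ = M)
    {z : κ → ℝ} (hz : Function.Injective z) : ∃ e : Fin M ≃ κ, StrictMono (z ∘ e) := by
  set e₀ : Fin M ≃ κ := (Fintype.equivFinOfCardEq hM).symm
  refine ⟨(Tuple.sort (z ∘ e₀)).trans e₀, ?_⟩
  have hm : Monotone ((z ∘ e₀) ∘ Tuple.sort (z ∘ e₀)) := Tuple.monotone_sort _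
  exact hm.strictMono_of_injective
    ((hz.comp e₀.injective).comp (Tuple.sort (z ∘ e₀)).injective)

theorem lintegral_chainKernel_endpoints_le {γ β T : ℝ} (hγ0 : 0 < γ) (hβ0 : 0 < β)
    (hβ : β < 1 - γ) (hT : 0 < T) {n m : ℕ} (e : Fin (m + 1) ≃ Fin n ⊕ Fin n) :
    ∃ C : ℝ≥0∞, C ≠ ∞ ∧ ∀ D : Set (ℝ × ℝ), D ⊆ Set.Icc 0 T ×ˢ Set.Icc 0 T →
      ∫⁻ q, chainKernel γ (endpoints q ∘ e)
        ∂(Measure.pi fun _ : Fin n => (volume : Measure (ℝ × ℝ)).restrict D) ≤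
        C * volume D ^ (n * β) := by
  -- Hölder exponents `1 / (1 - β)` and `1 / β`
  set p : ℝ := 1 / (1 - β) with hp
  have hβ1 : 0 < 1 - β := by linarith
  have hp0 : 0 < p := by positivity
  have hpq : p.HolderConjugate (1 / β) := by
    rw [Real.holderConjugate_iff]
    constructor
    · rw [hp, lt_div_iff₀ hβ1]
      linarith
    · rw [hp]
      field_simp
      ring
  have hγp : γ * p < 1 := by
    rw [hp, mul_one_div, div_lt_one hβ1]
    linarith
  obtain ⟨K, hK, hKb⟩ := exists_lintegral_dist_rpow_le (mul_nonneg hγ0.le hp0.le) hγp hT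
  set μ : Measure ℝ := volume.restrict (Set.Icc 0 T) with hμ
  refine ⟨(μ Set.univ * K ^ m) ^ (1 / p), ?_, ?_⟩
  · refine ENNReal.rpow_ne_top_of_nonneg (by positivity) (ENNReal.mul_ne_top ?_ ?_)
    · simp [hμ]
    · exact ENNReal.pow_ne_top hK
  intro D hD
  set ν := Measure.pi fun _ : Fin n => (volume : Measure (ℝ × ℝ)).restrict D with hν
  have hmeas : Measurable fun q : Fin n → ℝ × ℝ => chainKernel γ (endpoints q ∘ e) := by
    refine (measurable_chainKernel γ m).comp ?_
    have := measurable_endpoints n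
    exact measurable_pi_lambda _ fun i => (measurable_pi_apply (e i)).comp this
  have hν_le : ν ≤ Measure.pi fun _ : Fin n => μ.prod μ := by
    rw [hν, hμ, Measure.prod_restrict, ← Measure.volume_eq_prod,
      ← Measure.restrict_pi_pi, ← Measure.restrict_pi_pi]
    exact Measure.restrict_mono (Set.pi_mono fun _ _ => hD) le_rfl
  have hchain : ∫⁻ q, chainKernel γ (endpoints q ∘ e) ^ p ∂ν ≤ μ Set.univ * K ^ m := by
    have e1 : ∀ w : Fin (m + 1) → ℝ, chainKernel γ w ^ p = chainKernel (γ * p) w := by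
      intro w
      unfold chainKernel
      rw [← ENNReal.prod_rpow_of_nonneg hp0.le]
      refine Finset.prod_congr rfl fun i _ => ?_
      rw [← ENNReal.rpow_mul]
      congr 1
      ring
    simp only [e1]
    have hmp := measurePreserving_piCongrLeft (fun _ : Fin (m + 1) => μ) e.symm
    have hmp2 := hmp.comp (measurePreserving_endpoints n μ)
    have e2 : ∀ q : Fin n → ℝ × ℝ, chainKernel (γ * p) (endpoints q ∘ e) =
        chainKernel (γ * p) (((MeasurableEquiv.piCongrLeft (fun _ : Fin (m + 1) => ℝ) e.symm) ∘
          endpoints) q) := by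
      intro q
      congr 1
      funext i
      simp only [Function.comp]
      have := MeasurableEquiv.piCongrLeft_apply_apply (β := fun _ : Fin (m + 1) => ℝ) e.symm
        (endpoints q) (e i)
      simpa using this.symm
    calc _ ≤ ∫⁻ q, chainKernel (γ * p) (endpoints q ∘ e)
          ∂(Measure.pi fun _ : Fin n => μ.prod μ) := lintegral_mono' hν_le le_rfl
      _ = ∫⁻ w, chainKernel (γ * p) w ∂(Measure.pi fun _ : Fin (m + 1) => μ) := by
          simp only [e2]
          exact hmp2.lintegral_comp (measurable_chainKernel _ _)
      _ ≤ _ := lintegral_chainKernel_le _ μ hKb m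
  have hH := ENNReal.lintegral_mul_le_Lp_mul_Lq ν hpq hmeas.aemeasurable
    (measurable_const (a := (1 : ℝ≥0∞))).aemeasurable
  simp only [Pi.mul_apply, mul_one, ENNReal.one_rpow, lintegral_one, one_div_one_div] at hH
  have hνu : ν Set.univ = volume D ^ n := by
    rw [hν, Measure.pi_univ]
    simp
  rw [hνu] at hH
  calc _ ≤ _ := hH
    _ ≤ (μ Set.univ * K ^ m) ^ (1 / p) * volume D ^ (n * β) := by
        rw [ENNReal.rpow_mul, ENNReal.rpow_natCast]
        gcongr

/-- The deterministic estimate behind all moment bounds: the joint integral over frequencies and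
times, with a gain of a power of the volume of the time domain. -/
theorem lintegral_time_momentum_le {H : ℝ} (h0 : 0 < H) (h1 : H < 1) {d n : ℕ} (hd : 0 < d)
    (hn : 0 < n) {κ β T : ℝ} (hκ : 0 ≤ κ) (hβ0 : 0 < β) (hβ : β < 1 - H * (κ + d)) (hT : 0 < T) :
    ∃ C : ℝ≥0∞, C ≠ ∞ ∧ ∀ D : Set (ℝ × ℝ), MeasurableSet D →
      D ⊆ {q : ℝ × ℝ | 0 < q.1 ∧ q.1 < q.2 ∧ q.2 < T} →
      ∫⁻ q : Fin n → ℝ × ℝ, (∫⁻ p : Fin n → EuclideanSpace ℝ (Fin d),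
        ENNReal.ofReal ((∏ j, ‖p j‖ ^ κ) *
          Real.exp (-(totVar H (fun j => (q j).1) (fun j => (q j).2) p / 2))))
        ∂(Measure.pi fun _ : Fin n => (volume : Measure (ℝ × ℝ)).restrict D) ≤
        C * volume D ^ (n * β) := by
  obtain ⟨m, hm⟩ : ∃ m, n + n = m + 1 := ⟨n + n - 1, by omega⟩
  set γ := H * (κ + d) with hγ
  have hγ0 : 0 < γ := by
    have : (0 : ℝ) < d := by exact_mod_cast hd
    positivity
  obtain ⟨C₀, hC₀, hb⟩ := lintegral_prod_norm_rpow_mul_exp_le h0 h1 d n hκ hT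
  choose C₁ hC₁ hb₁ using fun e : Fin (m + 1) ≃ Fin n ⊕ Fin n =>
    lintegral_chainKernel_endpoints_le hγ0 hβ0 hβ hT e
  refine ⟨ENNReal.ofReal (C₀ * T ^ (-γ)) * ∑ e, C₁ e, ?_, ?_⟩
  · exact ENNReal.mul_ne_top ENNReal.ofReal_ne_top (ENNReal.sum_ne_top.2 fun e _ => hC₁ e)
  intro D hDm hD
  have hDsub : D ⊆ Set.Icc 0 T ×ˢ Set.Icc 0 T := by
    intro q hq
    obtain ⟨q1, q2, q3⟩ := hD hq
    exact ⟨⟨q1.le, by linarith⟩, ⟨by linarith, q3.le⟩⟩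
  set ν := Measure.pi fun _ : Fin n => (volume : Measure (ℝ × ℝ)).restrict D with hν
  have hνr : ν = (volume : Measure (Fin n → ℝ × ℝ)).restrict (Set.univ.pi fun _ => D) := by
    rw [hν, ← Measure.restrict_pi_pi, volume_pi]
  have hmem : ∀ᵐ q ∂ν, ∀ j, q j ∈ D := by
    rw [hνr]
    filter_upwards [ae_restrict_mem (MeasurableSet.univ_pi fun _ => hDm)] with q hq j
    exact hq j trivial
  have hinj : ∀ᵐ q ∂ν, Function.Injective (endpoints q) := by
    rw [hνr]
    refine ae_restrict_of_ae ?_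
    have := (measurePreserving_endpoints n (volume : Measure ℝ)).quasiMeasurePreserving.ae
      (ae_injective_pi (κ := Fin n ⊕ Fin n))
    exact this
  have hmeas : ∀ e : Fin (m + 1) ≃ Fin n ⊕ Fin n,
      Measurable fun q : Fin n → ℝ × ℝ => chainKernel γ (endpoints q ∘ e) := by
    intro e
    refine (measurable_chainKernel γ m).comp ?_
    have := measurable_endpoints n
    exact measurable_pi_lambda _ fun i => (measurable_pi_apply (e i)).comp this
  calc _ ≤ ∫⁻ q, ENNReal.ofReal (C₀ * T ^ (-γ)) *
        ∑ e : Fin (m + 1) ≃ Fin n ⊕ Fin n, chainKernel γ (endpoints q ∘ e) ∂ν := by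
        refine lintegral_mono_ae ?_
        filter_upwards [hmem, hinj] with q hq hqi
        obtain ⟨e, he⟩ := exists_strictMono_equiv (M := m + 1) (by simp [hm]) hqi
        have hz : ∀ a, endpoints q a ∈ Set.Icc 0 T := by
          rintro (j | j)
          · exact (hDsub (hq j)).1
          · exact (hDsub (hq j)).2
        refine (hb (fun j => (q j).1) (fun j => (q j).2) e he (fun j => (hD (hq j)).2.1) hz).trans ?_
        have hTγ : 0 ≤ T ^ (-γ) := Real.rpow_nonneg hT.le _
        have e1 : C₀ * ∏ i ∈ Finset.range (m + 1), gap T (endpoints q) e i ^ (-γ) =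
            (C₀ * T ^ (-γ)) * ∏ i : Fin m,
              |endpoints q (e i.succ) - endpoints q (e i.castSucc)| ^ (-γ) := by
          rw [Finset.prod_range_succ', mul_assoc, mul_comm (T ^ (-γ)),
            ← Fin.prod_univ_eq_prod_range (fun i => gap T (endpoints q) e (i + 1) ^ (-γ))]
          congr 2
          · refine Finset.prod_congr rfl fun i _ => ?_
            have hg : gap T (endpoints q) e (i + 1) =
                endpoints q (e i.succ) - endpoints q (e i.castSucc) := by
              unfold gap
              rw [dif_pos ⟨by omega, by omega⟩]
              rfl
            rw [← hg, abs_of_pos (gap_pos hT he _)]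
        have e2 : ENNReal.ofReal (C₀ * ∏ i ∈ Finset.range (m + 1),
            gap T (endpoints q) e i ^ (-γ)) =
            ENNReal.ofReal (C₀ * T ^ (-γ)) * chainKernel γ (endpoints q ∘ e) := by
          rw [e1, ENNReal.ofReal_mul (by positivity), ENNReal.ofReal_prod_of_nonneg
            fun i _ => Real.rpow_nonneg (abs_nonneg _) _]
          congr 1
          refine Finset.prod_congr rfl fun i _ => ?_
          refine (ENNReal.ofReal_rpow_of_pos ?_).symm
          rw [abs_pos, sub_ne_zero]
          intro h
          have := e.injective (hqi h)
          simp [Fin.ext_iff] at this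
        refine (le_of_eq e2).trans ?_
        gcongr
        exact Finset.single_le_sum
          (f := fun e : Fin (m + 1) ≃ Fin n ⊕ Fin n => chainKernel γ (endpoints q ∘ e))
          (fun _ _ => zero_le) (Finset.mem_univ e)
    _ = ENNReal.ofReal (C₀ * T ^ (-γ)) *
        ∑ e : Fin (m + 1) ≃ Fin n ⊕ Fin n, ∫⁻ q, chainKernel γ (endpoints q ∘ e) ∂ν := by
        rw [lintegral_const_mul' _ _ ENNReal.ofReal_ne_top, lintegral_finsetSum _ fun e _ => hmeas e]
    _ ≤ ENNReal.ofReal (C₀ * T ^ (-γ)) *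
        ∑ e : Fin (m + 1) ≃ Fin n ⊕ Fin n, C₁ e * volume D ^ (n * β) := by
        gcongr with e
        exact hb₁ e D hDsub
    _ = _ := by rw [← Finset.sum_mul, mul_assoc]

/-! ### Characteristic functions of fractional Brownian increments -/

section FBM

variable {d : ℕ} {Ω : Type*} [MeasurableSpace Ω] {P : Measure Ω} {H : ℝ}
  {B : ℝ≥0 → Ω → EuclideanSpace ℝ (Fin d)}

/-- The increment of `B` between the times `q.1` and `q.2`. -/
def increment (B : ℝ≥0 → Ω → EuclideanSpace ℝ (Fin d)) (q : ℝ × ℝ) (ω : Ω) :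
    EuclideanSpace ℝ (Fin d) :=
  B q.2.toNNReal ω - B q.1.toNNReal ω

theorem IsFractionalBrownianMotion.memLp_coord (hB : IsFractionalBrownianMotion H B P) (t : ℝ≥0)
    (l : Fin d) : MemLp (fun ω => B t ω l) 2 P := by
  have h1 := hB.isGaussianProcess.hasGaussianLaw_eval t
  have h2 := h1.map_fun (EuclideanSpace.proj l : EuclideanSpace ℝ (Fin d) →L[ℝ] ℝ)
  exact h2.memLp_two

theorem IsFractionalBrownianMotion.integral_increment_mul (hB : IsFractionalBrownianMotion H B P)
    {q q' : ℝ × ℝ} (h1 : 0 ≤ q.1) (h2 : 0 ≤ q.2) (h1' : 0 ≤ q'.1) (h2' : 0 ≤ q'.2) (l l' : Fin d) :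
    ∫ ω, increment B q ω l * increment B q' ω l' ∂P =
      if l = l' then incCov H q.1 q.2 q'.1 q'.2 else 0 := by
  have hi : ∀ t s : ℝ≥0, Integrable (fun ω => B t ω l * B s ω l') P := fun t s =>
    (hB.memLp_coord t l).integrable_mul (hB.memLp_coord s l')
  have e : ∀ ω, increment B q ω l * increment B q' ω l' =
      ((B q.2.toNNReal ω l * B q'.2.toNNReal ω l' - B q.2.toNNReal ω l * B q'.1.toNNReal ω l') -
        B q.1.toNNReal ω l * B q'.2.toNNReal ω l') +
        B q.1.toNNReal ω l * B q'.1.toNNReal ω l' := by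
    intro ω
    simp only [increment, PiLp.sub_apply]
    ring
  simp only [e]
  have i1 : Integrable (fun ω => B q.2.toNNReal ω l * B q'.2.toNNReal ω l' -
      B q.2.toNNReal ω l * B q'.1.toNNReal ω l') P := (hi _ _).sub (hi _ _)
  have i2 : Integrable (fun ω => B q.2.toNNReal ω l * B q'.2.toNNReal ω l' -
      B q.2.toNNReal ω l * B q'.1.toNNReal ω l' -
      B q.1.toNNReal ω l * B q'.2.toNNReal ω l') P := i1.sub (hi _ _)
  rw [integral_add i2 (hi _ _), integral_sub i1 (hi _ _), integral_sub (hi _ _) (hi _ _),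
    hB.covariance, hB.covariance, hB.covariance, hB.covariance, Real.coe_toNNReal _ h1,
    Real.coe_toNNReal _ h2, Real.coe_toNNReal _ h1', Real.coe_toNNReal _ h2']
  split_ifs
  · unfold incCov
    ring
  · simp

/-- The characteristic function of finitely many increments. -/
theorem IsFractionalBrownianMotion.integral_exp_increments [IsProbabilityMeasure P]
    (hB : IsFractionalBrownianMotion H B P) {n : ℕ} (q : Fin n → ℝ × ℝ)
    (h1 : ∀ j, 0 ≤ (q j).1) (h2 : ∀ j, 0 ≤ (q j).2) (p : Fin n → EuclideanSpace ℝ (Fin d)) :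
    ∫ ω, Complex.exp (Complex.I * ((∑ j, inner ℝ (p j) (increment B (q j) ω) : ℝ) : ℂ)) ∂P =
      Complex.exp ((-(totVar H (fun j => (q j).1) (fun j => (q j).2) p / 2) : ℝ) : ℂ) := by
  classical
  set Y : Ω → ℝ := fun ω => ∑ j, inner ℝ (p j) (increment B (q j) ω) with hY
  have hG : HasGaussianLaw Y P := by
    set I : Finset ℝ≥0 := Finset.univ.image (fun j => (q j).1.toNNReal) ∪
      Finset.univ.image (fun j => (q j).2.toNNReal) with hI
    have m1 : ∀ j, (q j).1.toNNReal ∈ I := fun j =>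
      Finset.mem_union_left _ (Finset.mem_image_of_mem _ (Finset.mem_univ j))
    have m2 : ∀ j, (q j).2.toNNReal ∈ I := fun j =>
      Finset.mem_union_right _ (Finset.mem_image_of_mem (fun j => (q j).2.toNNReal)
        (Finset.mem_univ j))
    set Λ : (I → EuclideanSpace ℝ (Fin d)) →L[ℝ] ℝ := ∑ j, (innerSL ℝ (p j)).comp
      (ContinuousLinearMap.proj (R := ℝ) (φ := fun _ : I => EuclideanSpace ℝ (Fin d))
        ⟨_, m2 j⟩ - ContinuousLinearMap.proj ⟨_, m1 j⟩) with hΛ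
    have := (hB.isGaussianProcess.hasGaussianLaw I).map_fun Λ
    refine this.congr (Eventually.of_forall fun ω => ?_)
    simp [hΛ, hY, increment, Finset.restrict, inner_sub_right]
  -- expand in coordinates
  have eY : ∀ ω, Y ω = ∑ x : Fin n × Fin d, p x.1 x.2 * increment B (q x.1) ω x.2 := by
    intro ω
    rw [hY, Fintype.sum_prod_type]
    refine Finset.sum_congr rfl fun j _ => ?_
    rw [PiLp.inner_apply]
    refine Finset.sum_congr rfl fun l _ => ?_
    simp [mul_comm]
  have hm : ∀ x : Fin n × Fin d, MemLp (fun ω => increment B (q x.1) ω x.2) 2 P := fun x =>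
    (hB.memLp_coord _ x.2).sub (hB.memLp_coord _ x.2)
  have hmean : P[Y] = 0 := by
    simp only [eY]
    rw [integral_finsetSum _ fun x _ => ((hm x).integrable one_le_two).const_mul _]
    refine Finset.sum_eq_zero fun x _ => ?_
    rw [integral_const_mul]
    have : ∫ ω, increment B (q x.1) ω x.2 ∂P = 0 := by
      simp only [increment, PiLp.sub_apply]
      rw [integral_sub ((hB.memLp_coord _ _).integrable one_le_two)
        ((hB.memLp_coord _ _).integrable one_le_two), hB.centered, hB.centered, sub_zero]
    rw [this, mul_zero]
  have hvar : Var[Y; P] = totVar H (fun j => (q j).1) (fun j => (q j).2) p := by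
    rw [variance_of_integral_eq_zero hG.aemeasurable hmean]
    have e2 : ∀ ω, Y ω ^ 2 = ∑ x : Fin n × Fin d, ∑ y : Fin n × Fin d,
        (p x.1 x.2 * p y.1 y.2) * (increment B (q x.1) ω x.2 * increment B (q y.1) ω y.2) := by
      intro ω
      rw [eY, sq, Finset.sum_mul_sum]
      refine Finset.sum_congr rfl fun x _ => Finset.sum_congr rfl fun y _ => by ring
    have hi : ∀ x y : Fin n × Fin d, Integrable (fun ω => (p x.1 x.2 * p y.1 y.2) *
        (increment B (q x.1) ω x.2 * increment B (q y.1) ω y.2)) P := fun x y =>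
      ((hm x).integrable_mul (hm y)).const_mul _
    simp only [e2]
    rw [integral_finsetSum _ fun x _ => integrable_finsetSum _ fun y _ => hi x y]
    have e3 : ∀ x : Fin n × Fin d, ∫ ω, ∑ y : Fin n × Fin d, (p x.1 x.2 * p y.1 y.2) *
        (increment B (q x.1) ω x.2 * increment B (q y.1) ω y.2) ∂P =
        ∑ j, p x.1 x.2 * p j x.2 * incCov H (q x.1).1 (q x.1).2 (q j).1 (q j).2 := by
      intro x
      rw [integral_finsetSum _ fun y _ => hi x y, Fintype.sum_prod_type]
      refine Finset.sum_congr rfl fun j _ => ?_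
      rw [Finset.sum_eq_single x.2]
      · rw [integral_const_mul, hB.integral_increment_mul (h1 _) (h2 _) (h1 _) (h2 _), if_pos rfl]
      · intro l _ hl
        rw [integral_const_mul, hB.integral_increment_mul (h1 _) (h2 _) (h1 _) (h2 _),
          if_neg (Ne.symm hl), mul_zero]
      · simp
    simp only [e3]
    unfold totVar incVar
    rw [Fintype.sum_prod_type, Finset.sum_comm]
  have hmap := hG.map_eq_gaussianReal
  rw [hmean, hvar] at hmap
  have hV0 : 0 ≤ totVar H (fun j => (q j).1) (fun j => (q j).2) p := by
    rw [← hvar]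
    exact variance_nonneg _ _
  have hch := charFun_gaussianReal (μ := 0)
    (v := (totVar H (fun j => (q j).1) (fun j => (q j).2) p).toNNReal) 1
  rw [← hmap, charFun_apply_real, integral_map hG.aemeasurable
    (by fun_prop)] at hch
  have e4 : ∀ ω, Complex.exp (Complex.I * ((Y ω : ℝ) : ℂ)) =
      Complex.exp (((1 : ℝ) : ℂ) * (Y ω : ℂ) * Complex.I) := by
    intro ω
    congr 1
    push_cast
    ring
  calc _ = ∫ ω, Complex.exp (((1 : ℝ) : ℂ) * (Y ω : ℂ) * Complex.I) ∂P :=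
        integral_congr_ae (Eventually.of_forall e4)
    _ = _ := by
        rw [hch, Real.coe_toNNReal _ hV0]
        congr 1
        push_cast
        ring

/-! ### Moments of Fourier integrals along the increments -/

/-- The Fourier integral `x ↦ ∫ g(p) e^{i⟨p,x⟩} dp`. -/
noncomputable def fourierSymbol (g : EuclideanSpace ℝ (Fin d) → ℂ)
    (x : EuclideanSpace ℝ (Fin d)) : ℂ :=
  ∫ p, g p * Complex.exp (Complex.I * ((inner ℝ p x : ℝ) : ℂ))

theorem norm_exp_I_mul_ofReal (x : ℝ) : ‖Complex.exp (Complex.I * (x : ℂ))‖ = 1 := by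
  rw [mul_comm]
  exact Complex.norm_exp_ofReal_mul_I x

theorem integrable_symbol_mul_exp {g : EuclideanSpace ℝ (Fin d) → ℂ} (hg : Integrable g)
    (x : EuclideanSpace ℝ (Fin d)) :
    Integrable fun p => g p * Complex.exp (Complex.I * ((inner ℝ p x : ℝ) : ℂ)) := by
  refine hg.mul_bdd (c := 1) ?_ (Eventually.of_forall fun p => (norm_exp_I_mul_ofReal _).le)
  fun_prop

theorem norm_fourierSymbol_le {g : EuclideanSpace ℝ (Fin d) → ℂ}
    (x : EuclideanSpace ℝ (Fin d)) : ‖fourierSymbol g x‖ ≤ ∫ p, ‖g p‖ := by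
  refine (norm_integral_le_integral_norm _).trans (le_of_eq ?_)
  simp

theorem continuous_fourierSymbol {g : EuclideanSpace ℝ (Fin d) → ℂ} (hg : Integrable g) :
    Continuous (fourierSymbol g) := by
  refine continuous_of_dominated (bound := fun p => ‖g p‖) (fun x =>
    (integrable_symbol_mul_exp hg x).aestronglyMeasurable) (fun x => Eventually.of_forall fun p => ?_)
    hg.norm (Eventually.of_forall fun p => by fun_prop)
  simp

theorem measurable_increment (hc : ∀ ω, Continuous fun t => B t ω) (hm : ∀ t, Measurable (B t)) :
    Measurable fun x : (ℝ × ℝ) × Ω => increment B x.1 x.2 := by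
  have h : Measurable (Function.uncurry fun (t : ℝ≥0) ω => B t ω) :=
    measurable_uncurry_of_continuous_of_measurable hc hm
  have h1 : Measurable fun x : (ℝ × ℝ) × Ω => B x.1.1.toNNReal x.2 :=
    h.comp (by fun_prop : Measurable fun x : (ℝ × ℝ) × Ω => (x.1.1.toNNReal, x.2))
  have h2 : Measurable fun x : (ℝ × ℝ) × Ω => B x.1.2.toNNReal x.2 :=
    h.comp (by fun_prop : Measurable fun x : (ℝ × ℝ) × Ω => (x.1.2.toNNReal, x.2))
  exact h2.sub h1

/-- Moments of `∫_D Φ_g (B_s - B_r)` for a Fourier integral `Φ_g`, bounded by absolute integrals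
over times and frequencies. -/
theorem enorm_integral_pow_le [IsProbabilityMeasure P] (hB : IsFractionalBrownianMotion H B P)
    (hc : ∀ ω, Continuous fun t => B t ω) (hm : ∀ t, Measurable (B t)) (n : ℕ)
    {g : EuclideanSpace ℝ (Fin d) → ℂ} (hg : Integrable g) {κ A : ℝ} (hA : 0 ≤ A)
    (hgA : ∀ p, ‖g p‖ ≤ A * ‖p‖ ^ κ) {D : Set (ℝ × ℝ)} (hD : MeasurableSet D)
    (hDfin : volume D ≠ ∞) (hDpos : ∀ q ∈ D, 0 ≤ q.1 ∧ 0 ≤ q.2) :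
    ‖∫ ω, (∫ q in D, fourierSymbol g (increment B q ω)) ^ n ∂P‖ₑ ≤
      ENNReal.ofReal A ^ n * ∫⁻ q : Fin n → ℝ × ℝ, (∫⁻ p : Fin n → EuclideanSpace ℝ (Fin d),
        ENNReal.ofReal ((∏ j, ‖p j‖ ^ κ) *
          Real.exp (-(totVar H (fun j => (q j).1) (fun j => (q j).2) p / 2))))
        ∂(Measure.pi fun _ : Fin n => (volume : Measure (ℝ × ℝ)).restrict D) := by
  set ν : Measure (ℝ × ℝ) := volume.restrict D with hν
  have hνfin : IsFiniteMeasure ν := ⟨by simpa [hν] using hDfin.lt_top⟩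
  set μ : Measure ((ℝ × ℝ) × EuclideanSpace ℝ (Fin d)) := ν.prod volume with hμ
  have hμσ : SigmaFinite μ := by rw [hμ]; infer_instance
  set F : Ω → (ℝ × ℝ) × EuclideanSpace ℝ (Fin d) → ℂ := fun ω y =>
    g y.2 * Complex.exp (Complex.I * ((inner ℝ y.2 (increment B y.1 ω) : ℝ) : ℂ)) with hF
  have hinc := measurable_increment hc hm
  have hg2 : Integrable (fun y : (ℝ × ℝ) × EuclideanSpace ℝ (Fin d) => g y.2) μ :=
    hg.comp_snd ν
  set ex : Ω × ((ℝ × ℝ) × EuclideanSpace ℝ (Fin d)) → ℂ := fun x =>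
      Complex.exp (Complex.I * ((inner ℝ x.2.2 (increment B x.2.1 x.1) : ℝ) : ℂ)) with hex
  have hexpm : Measurable ex := by
    have h1 : Measurable fun x : Ω × ((ℝ × ℝ) × EuclideanSpace ℝ (Fin d)) =>
        increment B x.2.1 x.1 :=
      hinc.comp (by fun_prop :
        Measurable fun x : Ω × ((ℝ × ℝ) × EuclideanSpace ℝ (Fin d)) => (x.2.1, x.1))
    have h2 : Measurable fun x : Ω × ((ℝ × ℝ) × EuclideanSpace ℝ (Fin d)) =>
        (inner ℝ x.2.2 (increment B x.2.1 x.1) : ℝ) :=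
      (measurable_snd.comp measurable_snd).inner h1
    fun_prop
  have hFi : ∀ ω, Integrable (F ω) μ := by
    intro ω
    refine hg2.mul_bdd (c := 1) ?_ (Eventually.of_forall fun p => (norm_exp_I_mul_ofReal _).le)
    exact (hexpm.comp (by fun_prop : Measurable fun y : (ℝ × ℝ) × EuclideanSpace ℝ (Fin d) =>
      (ω, y))).aestronglyMeasurable
  have hZ : ∀ ω, ∫ q in D, fourierSymbol g (increment B q ω) = ∫ y, F ω y ∂μ := by
    intro ω
    rw [hμ, integral_prod _ (hFi ω)]
    rfl
  set π := Measure.pi fun _ : Fin n => μ with hπ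
  have hπσ : SigmaFinite π := by rw [hπ]; infer_instance
  have hpow : ∀ ω, (∫ q in D, fourierSymbol g (increment B q ω)) ^ n =
      ∫ y : Fin n → (ℝ × ℝ) × EuclideanSpace ℝ (Fin d), ∏ j, F ω (y j) ∂π := by
    intro ω
    rw [hZ, hπ, integral_fintype_prod_eq_pow, Fintype.card_fin]
  have hGi : Integrable (fun y : Fin n → (ℝ × ℝ) × EuclideanSpace ℝ (Fin d) =>
      ∏ j, g (y j).2) π := Integrable.fintype_prod (f := fun _ (y : (ℝ × ℝ) × EuclideanSpace ℝ (Fin d)) => g y.2)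
      fun _ => hg2
  have eprod : ∀ ω (y : Fin n → (ℝ × ℝ) × EuclideanSpace ℝ (Fin d)), ∏ j, F ω (y j) =
      (∏ j, g (y j).2) * Complex.exp (Complex.I *
        ((∑ j, inner ℝ (y j).2 (increment B (y j).1 ω) : ℝ) : ℂ)) := by
    intro ω y
    rw [hF, Finset.prod_mul_distrib, ← Complex.exp_sum]
    congr 2
    push_cast
    rw [Finset.mul_sum]
  have hint : Integrable (Function.uncurry fun ω (y : Fin n → (ℝ × ℝ) × EuclideanSpace ℝ (Fin d)) =>
      ∏ j, F ω (y j)) (P.prod π) := by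
    have h1 : Integrable (fun x : Ω × (Fin n → (ℝ × ℝ) × EuclideanSpace ℝ (Fin d)) =>
        ∏ j, g (x.2 j).2) (P.prod π) := hGi.comp_snd P
    have e1 : (Function.uncurry fun ω (y : Fin n → (ℝ × ℝ) × EuclideanSpace ℝ (Fin d)) =>
        ∏ j, F ω (y j)) = fun x => (∏ j, g (x.2 j).2) * ∏ j, ex (x.1, x.2 j) := by
      funext x
      simp only [Function.uncurry, hF, hex, Finset.prod_mul_distrib]
    rw [e1]
    refine h1.mul_bdd (c := 1) ?_ (Eventually.of_forall fun x => ?_)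
    · refine Measurable.aestronglyMeasurable ?_
      exact Finset.measurable_fun_prod _ fun j _ =>
        hexpm.comp (measurable_fst.prodMk ((measurable_pi_apply j).comp measurable_snd))
    · rw [norm_prod]
      simp only [hex, norm_exp_I_mul_ofReal, Finset.prod_const_one, le_refl]
  have hmp := measurePreserving_arrowProdEquivProdArrow (ℝ × ℝ) (EuclideanSpace ℝ (Fin d)) (Fin n)
    (fun _ => ν) (fun _ => volume)
  have hDmem : ∀ᵐ y ∂π, ∀ j, (y j).1 ∈ D := by
    have h1 : ∀ᵐ q ∂(Measure.pi fun _ : Fin n => ν), ∀ j, q j ∈ D := by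
      rw [hν, ← Measure.restrict_pi_pi]
      filter_upwards [ae_restrict_mem (MeasurableSet.univ_pi fun _ => hD)] with q hq j
      exact hq j trivial
    have h2 := Measure.quasiMeasurePreserving_fst (μ := Measure.pi fun _ : Fin n => ν)
      (ν := Measure.pi fun _ : Fin n => (volume : Measure (EuclideanSpace ℝ (Fin d))))
    exact (h2.comp hmp.quasiMeasurePreserving).ae h1
  have hI : ∫ ω, (∫ q, fourierSymbol g (increment B q ω) ∂ν) ^ n ∂P =
      ∫ ω, ∫ y, ∏ j, F ω (y j) ∂π ∂P := integral_congr_ae (Eventually.of_forall hpow)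
  rw [hI, integral_integral_swap hint]
  refine (enorm_integral_le_lintegral_enorm _).trans ?_
  have hbound : ∀ᵐ y ∂π, ‖∫ ω, ∏ j, F ω (y j) ∂P‖ₑ ≤ ENNReal.ofReal A ^ n *
      ENNReal.ofReal ((∏ j, ‖(y j).2‖ ^ κ) * Real.exp (-(totVar H (fun j => (y j).1.1)
        (fun j => (y j).1.2) (fun j => (y j).2) / 2))) := by
    filter_upwards [hDmem] with y hy
    simp only [eprod]
    rw [integral_const_mul, hB.integral_exp_increments (fun j => (y j).1)
      (fun j => (hDpos _ (hy j)).1) (fun j => (hDpos _ (hy j)).2), ← ofReal_norm,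
      norm_mul, norm_prod, Complex.norm_exp_ofReal, ← ENNReal.ofReal_pow hA,
      ← ENNReal.ofReal_mul (by positivity), ← mul_assoc]
    refine ENNReal.ofReal_le_ofReal ?_
    gcongr
    calc ∏ j, ‖g (y j).2‖ ≤ ∏ j, (A * ‖(y j).2‖ ^ κ) :=
          Finset.prod_le_prod (fun j _ => norm_nonneg _) fun j _ => hgA _
      _ = _ := by simp [Finset.prod_mul_distrib]
  refine (lintegral_mono_ae hbound).trans ?_
  rw [lintegral_const_mul' _ _ (ENNReal.pow_ne_top ENNReal.ofReal_ne_top)]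
  gcongr
  set Ψ : (Fin n → ℝ × ℝ) × (Fin n → EuclideanSpace ℝ (Fin d)) → ℝ≥0∞ := fun x =>
    ENNReal.ofReal ((∏ j, ‖x.2 j‖ ^ κ) * Real.exp (-(totVar H (fun j => (x.1 j).1)
        (fun j => (x.1 j).2) x.2 / 2))) with hΨ
  have hΨm : Measurable Ψ := by
    rw [hΨ]
    unfold totVar incVar incCov
    fun_prop
  have := hmp.lintegral_comp hΨm
  refine (le_of_eq this).trans (le_of_eq ?_)
  exact lintegral_prod _ hΨm.aemeasurable

end FBM

section Moments

variable {d : ℕ} {Ω : Type*} [MeasurableSpace Ω] {P : Measure Ω} {H : ℝ}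
  {B : ℝ≥0 → Ω → EuclideanSpace ℝ (Fin d)}

theorem measurable_setIntegral_fourierSymbol (hc : ∀ ω, Continuous fun t => B t ω)
    (hm : ∀ t, Measurable (B t)) {g : EuclideanSpace ℝ (Fin d) → ℂ} (hg : Integrable g)
    (D : Set (ℝ × ℝ)) :
    Measurable fun ω => ∫ q in D, (fourierSymbol g (increment B q ω)).re := by
  have h1 : Measurable fun x : Ω × (ℝ × ℝ) => (fourierSymbol g (increment B x.2 x.1)).re := by
    have h2 := (continuous_fourierSymbol hg).measurable.comp
      ((measurable_increment hc hm).comp (measurable_swap (α := Ω) (β := ℝ × ℝ)))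
    exact Complex.measurable_re.comp h2
  exact (h1.stronglyMeasurable.integral_prod_right (ν := volume.restrict D)).measurable

theorem integrableOn_re_fourierSymbol {Ω : Type*} {B : ℝ≥0 → Ω → EuclideanSpace ℝ (Fin d)}
    (hc : ∀ ω, Continuous fun t => B t ω) {g : EuclideanSpace ℝ (Fin d) → ℂ} (hg : Integrable g)
    {D : Set (ℝ × ℝ)} (hD : volume D ≠ ∞) (ω : Ω) :
    IntegrableOn (fun q => (fourierSymbol g (increment B q ω)).re) D := by
  have hfin : IsFiniteMeasure (volume.restrict D) := ⟨by simpa using hD.lt_top⟩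
  refine Integrable.of_bound (C := ∫ p, ‖g p‖) ?_ (Eventually.of_forall fun q =>
    (Complex.abs_re_le_norm _).trans (norm_fourierSymbol_le _))
  have hcont : Continuous fun q : ℝ × ℝ => increment B q ω := by
    unfold increment
    have := hc ω
    fun_prop
  exact (Complex.continuous_re.comp
    ((continuous_fourierSymbol hg).comp hcont)).aestronglyMeasurable

/-- `L^{2N}` estimate for `∫_D Φ_g (B_s - B_r)`, in terms of a bound of order `κ` on `g` and of the
volume of `D`. -/
theorem eLpNorm_setIntegral_fourierSymbol_le [IsProbabilityMeasure P] (h0 : 0 < H) (h1 : H < 1)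
    (hd : 0 < d) (hB : IsFractionalBrownianMotion H B P)
    (hc : ∀ ω, Continuous fun t => B t ω) (hm : ∀ t, Measurable (B t)) {N : ℕ} (hN : 0 < N)
    {κ β T : ℝ} (hκ : 0 ≤ κ) (hβ0 : 0 < β) (hβ : β < 1 - H * (κ + d)) (hT : 0 < T) :
    ∃ C : ℝ≥0∞, C ≠ ∞ ∧ ∀ (g : EuclideanSpace ℝ (Fin d) → ℂ) (A : ℝ) (D : Set (ℝ × ℝ)),
      Integrable g → 0 ≤ A → (∀ p, ‖g p‖ ≤ A * ‖p‖ ^ κ) → (∀ x, (fourierSymbol g x).im = 0) →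
      MeasurableSet D → D ⊆ {q : ℝ × ℝ | 0 < q.1 ∧ q.1 < q.2 ∧ q.2 < T} →
      eLpNorm (fun ω => ∫ q in D, (fourierSymbol g (increment B q ω)).re) ((2 * N : ℕ) : ℝ≥0∞) P ≤
        C * ENNReal.ofReal A * volume D ^ β := by
  obtain ⟨C, hC, hb⟩ := lintegral_time_momentum_le h0 h1 hd (n := 2 * N) (by omega) hκ hβ0 hβ hT
  have h2N : (0 : ℝ) < ((2 * N : ℕ) : ℝ) := by exact_mod_cast (by omega : 0 < 2 * N)
  refine ⟨C ^ (1 / ((2 * N : ℕ) : ℝ)), ENNReal.rpow_ne_top_of_nonneg (by positivity) hC, ?_⟩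
  intro g A D hg hA hgA him hDm hD
  have hDfin : volume D ≠ ∞ := by
    refine ((measure_mono (t := Set.Icc 0 T ×ˢ Set.Icc 0 T) ?_).trans_lt ?_).ne
    · intro q hq
      obtain ⟨q1, q2, q3⟩ := hD hq
      exact ⟨⟨q1.le, by linarith⟩, ⟨by linarith, q3.le⟩⟩
    · rw [Measure.volume_eq_prod, Measure.prod_prod]
      exact ENNReal.mul_lt_top (by simp) (by simp)
  set W : Ω → ℝ := fun ω => ∫ q in D, (fourierSymbol g (increment B q ω)).re with hW
  have hWm : Measurable W := measurable_setIntegral_fourierSymbol hc hm hg D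
  have hWZ : ∀ ω, ((W ω : ℝ) : ℂ) = ∫ q in D, fourierSymbol g (increment B q ω) := by
    intro ω
    rw [hW]
    simp only
    rw [← integral_complex_ofReal]
    congr 1
    funext q
    exact Complex.ext (by simp) (by simp [him])
  have hWb : ∀ ω, ‖W ω‖ ≤ (∫ p, ‖g p‖) * volume.real D := by
    intro ω
    rw [← Complex.norm_real, hWZ]
    exact norm_setIntegral_le_of_norm_le_const hDfin.lt_top fun q _ => norm_fourierSymbol_le _
  have hWi : Integrable (fun ω => W ω ^ (2 * N)) P := by
    refine Integrable.of_bound (hWm.pow_const _).aestronglyMeasurable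
      (((∫ p, ‖g p‖) * volume.real D) ^ (2 * N)) (Eventually.of_forall fun ω => ?_)
    rw [norm_pow]
    exact pow_le_pow_left₀ (norm_nonneg _) (hWb ω) _
  have hnn : ∀ ω, 0 ≤ W ω ^ (2 * N) := fun ω => (even_two_mul N).pow_nonneg _
  have hlin : ∫⁻ ω, ‖W ω‖ₑ ^ ((2 * N : ℕ) : ℝ) ∂P ≤
      ENNReal.ofReal A ^ (2 * N) * (C * volume D ^ (((2 * N : ℕ) : ℝ) * β)) := by
    have e1 : ∫⁻ ω, ‖W ω‖ₑ ^ ((2 * N : ℕ) : ℝ) ∂P = ENNReal.ofReal (∫ ω, W ω ^ (2 * N) ∂P) := by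
      rw [ofReal_integral_eq_lintegral_ofReal hWi (Eventually.of_forall hnn)]
      refine lintegral_congr fun ω => ?_
      rw [ENNReal.rpow_natCast, ← enorm_pow, Real.enorm_of_nonneg (hnn ω)]
    have e2 : ENNReal.ofReal (∫ ω, W ω ^ (2 * N) ∂P) =
        ‖∫ ω, (∫ q in D, fourierSymbol g (increment B q ω)) ^ (2 * N) ∂P‖ₑ := by
      simp only [← hWZ]
      have : ∫ ω, ((W ω : ℝ) : ℂ) ^ (2 * N) ∂P = ((∫ ω, W ω ^ (2 * N) ∂P : ℝ) : ℂ) := by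
        rw [← integral_complex_ofReal]
        congr 1
        funext ω
        push_cast
        rfl
      rw [this, ← ofReal_norm, Complex.norm_real,
        Real.norm_of_nonneg (integral_nonneg hnn)]
    rw [e1, e2]
    refine (enorm_integral_pow_le hB hc hm (2 * N) hg hA hgA hDm hDfin fun q hq => ?_).trans ?_
    · obtain ⟨q1, q2, q3⟩ := hD hq
      exact ⟨q1.le, by linarith⟩
    · gcongr
      exact hb D hDm hD
  rw [eLpNorm_eq_lintegral_rpow_enorm_toReal (by simpa using hN.ne') (ENNReal.natCast_ne_top _),
    ENNReal.toReal_natCast]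
  calc _ ≤ (ENNReal.ofReal A ^ (2 * N) * (C * volume D ^ (((2 * N : ℕ) : ℝ) * β))) ^
        (1 / ((2 * N : ℕ) : ℝ)) := ENNReal.rpow_le_rpow hlin (by positivity)
    _ = _ := by
        rw [ENNReal.mul_rpow_of_nonneg _ _ (by positivity),
          ENNReal.mul_rpow_of_nonneg _ _ (by positivity), ← ENNReal.rpow_natCast,
          ← ENNReal.rpow_mul, ← ENNReal.rpow_mul, mul_one_div_cancel h2N.ne', ENNReal.rpow_one,
          mul_comm _ β, mul_assoc β, mul_one_div_cancel h2N.ne', mul_one]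
        ring

end Moments

/-! ### The Fourier symbol of the approximations -/

section Symbol

variable {d : ℕ}

/-- The Fourier symbol of `x ↦ gaussianDeriv k ε (x - y)`. -/
noncomputable def dsltSymbol (k : Fin d → ℕ) (ε : ℝ) (y p : EuclideanSpace ℝ (Fin d)) : ℂ :=
  Complex.I ^ (∑ j, k j) / (2 * (Real.pi : ℂ)) ^ d * (∏ j, ((p j : ℝ) : ℂ) ^ k j) *
    Complex.exp (Complex.I * ((inner ℝ p (-y) : ℝ) : ℂ)) *
    ((Real.exp (-(ε * ‖p‖ ^ 2 / 2)) : ℝ) : ℂ)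

theorem gaussianDeriv_sub_eq (k : Fin d → ℕ) (ε : ℝ) (x y : EuclideanSpace ℝ (Fin d)) :
    gaussianDeriv k ε (x - y) = fourierSymbol (dsltSymbol k ε y) x := by
  unfold gaussianDeriv fourierSymbol dsltSymbol
  rw [← integral_const_mul]
  congr 1
  funext p
  have e : Complex.exp (Complex.I * ((inner ℝ p (x - y) : ℝ) : ℂ)) =
      Complex.exp (Complex.I * ((inner ℝ p (-y) : ℝ) : ℂ)) *
        Complex.exp (Complex.I * ((inner ℝ p x : ℝ) : ℂ)) := by
    rw [← Complex.exp_add, sub_eq_add_neg, inner_add_right]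
    congr 1
    push_cast
    ring
  rw [e, Complex.ofReal_exp]
  ring

theorem norm_prefactor_le (k : Fin d → ℕ) (p : EuclideanSpace ℝ (Fin d)) :
    ‖Complex.I ^ (∑ j, k j) / (2 * (Real.pi : ℂ)) ^ d * (∏ j, ((p j : ℝ) : ℂ) ^ k j)‖ ≤
      ‖p‖ ^ (∑ j, k j) := by
  have h1 : ‖Complex.I ^ (∑ j, k j) / (2 * (Real.pi : ℂ)) ^ d‖ ≤ 1 := by
    rw [norm_div, norm_pow, norm_pow, Complex.norm_I, one_pow, norm_mul, Complex.norm_real,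
      Real.norm_of_nonneg Real.pi_pos.le, Complex.norm_ofNat]
    refine div_le_one_of_le₀ (one_le_pow₀ ?_) (by positivity)
    linarith [Real.pi_gt_three]
  have h2 : ‖∏ j, ((p j : ℝ) : ℂ) ^ k j‖ ≤ ‖p‖ ^ (∑ j, k j) := by
    rw [norm_prod, ← Finset.prod_pow_eq_pow_sum]
    refine Finset.prod_le_prod (fun _ _ => norm_nonneg _) fun j _ => ?_
    rw [norm_pow, Complex.norm_real]
    exact pow_le_pow_left₀ (norm_nonneg _) (PiLp.norm_apply_le p j) _
  rw [norm_mul]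
  calc _ ≤ 1 * ‖p‖ ^ (∑ j, k j) := mul_le_mul h1 h2 (norm_nonneg _) zero_le_one
    _ = _ := one_mul _

theorem integrable_dsltSymbol (k : Fin d → ℕ) {ε : ℝ} (hε : 0 < ε)
    (y : EuclideanSpace ℝ (Fin d)) : Integrable (dsltSymbol k ε y) := by
  obtain ⟨C, hC, hb⟩ := exists_rpow_mul_exp_neg_le (m := ((∑ j, k j : ℕ) : ℝ) / 2) (c := ε / 4)
    (by positivity) (by positivity)
  have hgauss : Integrable fun p : EuclideanSpace ℝ (Fin d) => Real.exp (-(ε / 4 * ‖p‖ ^ 2)) := by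
    have := (GaussianFourier.integrable_cexp_neg_mul_sq_norm_add (b := ((ε / 4 : ℝ) : ℂ))
      (V := EuclideanSpace ℝ (Fin d)) (by simpa using hε) 0 0).norm
    refine this.congr (Eventually.of_forall fun p => ?_)
    simp only [zero_mul, add_zero]
    rw [show (-((ε / 4 : ℝ) : ℂ) * (‖p‖ : ℂ) ^ 2) = ((-(ε / 4 * ‖p‖ ^ 2) : ℝ) : ℂ) by push_cast; ring,
      Complex.norm_exp_ofReal]
  refine (hgauss.const_mul C).mono' ?_ (Eventually.of_forall fun p => ?_)
  · unfold dsltSymbol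
    fun_prop
  · unfold dsltSymbol
    rw [norm_mul, norm_mul, norm_exp_I_mul_ofReal, mul_one, Complex.norm_real, Real.norm_eq_abs,
      Real.abs_exp]
    have h1 := hb (‖p‖ ^ 2) (by positivity)
    have e1 : (‖p‖ ^ 2) ^ (((∑ j, k j : ℕ) : ℝ) / 2) = ‖p‖ ^ (∑ j, k j) := by
      rw [← Real.rpow_natCast ‖p‖ 2, ← Real.rpow_mul (norm_nonneg _), ← Real.rpow_natCast]
      congr 1
      push_cast
      ring
    rw [e1] at h1
    have e2 : Real.exp (-(ε * ‖p‖ ^ 2 / 2)) = Real.exp (-(ε / 4 * ‖p‖ ^ 2)) *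
        Real.exp (-(ε / 4 * ‖p‖ ^ 2)) := by
      rw [← Real.exp_add]
      congr 1
      ring
    rw [e2, ← mul_assoc]
    refine mul_le_mul_of_nonneg_right ?_ (Real.exp_pos _).le
    exact (mul_le_mul_of_nonneg_right (norm_prefactor_le k p) (Real.exp_pos _).le).trans h1

theorem fourierSymbol_sub {g₁ g₂ : EuclideanSpace ℝ (Fin d) → ℂ} (h₁ : Integrable g₁)
    (h₂ : Integrable g₂) (x : EuclideanSpace ℝ (Fin d)) :
    fourierSymbol (fun p => g₁ p - g₂ p) x = fourierSymbol g₁ x - fourierSymbol g₂ x := by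
  unfold fourierSymbol
  rw [← integral_sub (integrable_symbol_mul_exp h₁ x) (integrable_symbol_mul_exp h₂ x)]
  congr 1
  funext p
  ring

theorem abs_exp_neg_sub_exp_neg_le {u v θ : ℝ} (hu : 0 ≤ u) (hv : 0 ≤ v) (h0 : 0 ≤ θ)
    (h1 : θ ≤ 1) : |Real.exp (-u) - Real.exp (-v)| ≤ |u - v| ^ θ := by
  wlog huv : u ≤ v generalizing u v
  · rw [abs_sub_comm, abs_sub_comm u]
    exact this hv hu (le_of_not_ge huv)
  have e : Real.exp (-v) = Real.exp (-u) * Real.exp (-(v - u)) := by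
    rw [← Real.exp_add]
    congr 1
    ring
  have hle : Real.exp (-v) ≤ Real.exp (-u) := Real.exp_le_exp.2 (by linarith)
  have hu1 : Real.exp (-u) ≤ 1 := Real.exp_le_one_iff.2 (by linarith)
  rw [abs_of_nonneg (by linarith), abs_sub_comm, abs_of_nonneg (by linarith)]
  rcases le_total (v - u) 1 with h | h
  · have h2 : Real.exp (-u) - Real.exp (-v) ≤ v - u := by
      rw [e]
      have h3 := Real.add_one_le_exp (-(v - u))
      have h4 : 0 ≤ v - u := by linarith
      have h5 : Real.exp (-(v - u)) ≤ 1 := Real.exp_le_one_iff.2 (by linarith)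
      nlinarith [Real.exp_pos (-u)]
    refine h2.trans ?_
    have := Real.rpow_le_rpow_of_exponent_ge' (by linarith : 0 ≤ v - u) h h0 h1
    rwa [Real.rpow_one] at this
  · have := Real.one_le_rpow h h0
    linarith [Real.exp_pos (-v)]

theorem norm_exp_I_sub_exp_I_le {u v θ : ℝ} (h0 : 0 ≤ θ) (h1 : θ ≤ 1) :
    ‖Complex.exp (Complex.I * (u : ℂ)) - Complex.exp (Complex.I * (v : ℂ))‖ ≤
      2 * |u - v| ^ θ := by
  have hx := Real.rpow_nonneg (abs_nonneg (u - v)) θ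
  rcases le_total |u - v| 1 with h | h
  · have e : Complex.exp (Complex.I * (u : ℂ)) - Complex.exp (Complex.I * (v : ℂ)) =
        Complex.exp (Complex.I * (v : ℂ)) * (Complex.exp (Complex.I * ((u - v : ℝ) : ℂ)) - 1) := by
      rw [mul_sub, ← Complex.exp_add, mul_one]
      congr 2
      push_cast
      ring
    rw [e, norm_mul, norm_exp_I_mul_ofReal, one_mul]
    have h2 := Real.norm_exp_I_mul_ofReal_sub_one_le (x := u - v)
    have h3 := Real.rpow_le_rpow_of_exponent_ge' (abs_nonneg (u - v)) h h0 h1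
    rw [Real.rpow_one] at h3
    rw [Real.norm_eq_abs] at h2
    linarith
  · have h3 := Real.one_le_rpow h h0
    refine (norm_sub_le _ _).trans ?_
    rw [norm_exp_I_mul_ofReal, norm_exp_I_mul_ofReal]
    linarith

theorem norm_dsltSymbol_sub_eps_le (k : Fin d → ℕ) {ε ε' θ : ℝ} (hε : 0 ≤ ε) (hε' : 0 ≤ ε')
    (h0 : 0 ≤ θ) (h1 : θ ≤ 1) (y p : EuclideanSpace ℝ (Fin d)) :
    ‖dsltSymbol k ε y p - dsltSymbol k ε' y p‖ ≤
      |ε - ε'| ^ (θ / 2) * ‖p‖ ^ (((∑ j, k j : ℕ) : ℝ) + θ) := by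
  unfold dsltSymbol
  rw [← mul_sub, norm_mul, norm_mul, norm_exp_I_mul_ofReal, mul_one, ← Complex.ofReal_sub,
    Complex.norm_real, Real.norm_eq_abs]
  have h2 := abs_exp_neg_sub_exp_neg_le (u := ε * ‖p‖ ^ 2 / 2) (v := ε' * ‖p‖ ^ 2 / 2)
    (θ := θ / 2) (by positivity) (by positivity) (by linarith) (by linarith)
  have e1 : |ε * ‖p‖ ^ 2 / 2 - ε' * ‖p‖ ^ 2 / 2| ≤ |ε - ε'| * ‖p‖ ^ 2 := by
    rw [← sub_div, ← sub_mul, abs_div, abs_mul, abs_of_nonneg (sq_nonneg ‖p‖), abs_two]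
    have : 0 ≤ |ε - ε'| * ‖p‖ ^ 2 := by positivity
    linarith
  have e2 : (|ε - ε'| * ‖p‖ ^ 2) ^ (θ / 2) = |ε - ε'| ^ (θ / 2) * ‖p‖ ^ θ := by
    rw [Real.mul_rpow (abs_nonneg _) (by positivity), ← Real.rpow_natCast ‖p‖ 2,
      ← Real.rpow_mul (norm_nonneg _)]
    congr 2
    push_cast
    ring
  have h3 := h2.trans (Real.rpow_le_rpow (abs_nonneg _) e1 (by linarith))
  rw [e2] at h3
  rw [Real.rpow_add_of_nonneg (norm_nonneg _) (by positivity) h0, Real.rpow_natCast]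
  calc _ ≤ ‖p‖ ^ (∑ j, k j) * (|ε - ε'| ^ (θ / 2) * ‖p‖ ^ θ) :=
        mul_le_mul (norm_prefactor_le k p) h3 (abs_nonneg _) (by positivity)
    _ = _ := by ring

theorem norm_dsltSymbol_sub_space_le (k : Fin d → ℕ) {ε θ : ℝ} (hε : 0 ≤ ε)
    (h0 : 0 ≤ θ) (h1 : θ ≤ 1) (x y p : EuclideanSpace ℝ (Fin d)) :
    ‖dsltSymbol k ε x p - dsltSymbol k ε y p‖ ≤
      (2 * ‖x - y‖ ^ θ) * ‖p‖ ^ (((∑ j, k j : ℕ) : ℝ) + θ) := by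
  unfold dsltSymbol
  rw [← sub_mul, ← mul_sub, norm_mul, norm_mul, Complex.norm_real, Real.norm_eq_abs, Real.abs_exp]
  have h2 := norm_exp_I_sub_exp_I_le (u := inner ℝ p (-x)) (v := inner ℝ p (-y)) h0 h1
  have e1 : |(inner ℝ p (-x) : ℝ) - inner ℝ p (-y)| ≤ ‖p‖ * ‖x - y‖ := by
    rw [← inner_sub_right, neg_sub_neg, norm_sub_rev x y]
    exact abs_real_inner_le_norm _ _
  have h3 := Real.rpow_le_rpow (abs_nonneg _) e1 h0
  rw [Real.mul_rpow (norm_nonneg _) (norm_nonneg _)] at h3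
  have h4 : Real.exp (-(ε * ‖p‖ ^ 2 / 2)) ≤ 1 := Real.exp_le_one_iff.2 (by
    have : 0 ≤ ε * ‖p‖ ^ 2 / 2 := by positivity
    linarith)
  rw [Real.rpow_add_of_nonneg (norm_nonneg _) (by positivity) h0, Real.rpow_natCast]
  calc _ ≤ (‖p‖ ^ (∑ j, k j) * (2 * (‖p‖ ^ θ * ‖x - y‖ ^ θ))) * 1 := by
        refine mul_le_mul (mul_le_mul (norm_prefactor_le k p) ?_ (norm_nonneg _) (by positivity)) h4
          (Real.exp_pos _).le (by positivity)
        linarith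
    _ = _ := by ring

theorem norm_dsltSymbol_le (k : Fin d → ℕ) {ε : ℝ} (hε : 0 ≤ ε)
    (y p : EuclideanSpace ℝ (Fin d)) :
    ‖dsltSymbol k ε y p‖ ≤ 1 * ‖p‖ ^ ((∑ j, k j : ℕ) : ℝ) := by
  unfold dsltSymbol
  rw [norm_mul, norm_mul, Complex.norm_real, Real.norm_eq_abs, Real.abs_exp,
    norm_exp_I_mul_ofReal, mul_one, one_mul, Real.rpow_natCast]
  have h4 : Real.exp (-(ε * ‖p‖ ^ 2 / 2)) ≤ 1 := Real.exp_le_one_iff.2 (by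
    have : 0 ≤ ε * ‖p‖ ^ 2 / 2 := by positivity
    linarith)
  calc _ ≤ ‖p‖ ^ (∑ j, k j) * 1 :=
        mul_le_mul (norm_prefactor_le k p) h4 (Real.exp_pos _).le (by positivity)
    _ = _ := mul_one _

end Symbol

/-! ### Moment bounds for the approximations -/

section Approx

variable {d : ℕ} {Ω : Type*} [MeasurableSpace Ω] {P : Measure Ω} {H : ℝ}
  {B : ℝ≥0 → Ω → EuclideanSpace ℝ (Fin d)} {k : Fin d → ℕ}

/-- The triangle `0 < r < s < t`. -/
def timeDomain (t : ℝ) : Set (ℝ × ℝ) := {q : ℝ × ℝ | 0 < q.1 ∧ q.1 < q.2 ∧ q.2 < t}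

theorem measurableSet_timeDomain (t : ℝ) : MeasurableSet (timeDomain t) :=
  (measurableSet_lt measurable_const measurable_fst).inter
    ((measurableSet_lt measurable_fst measurable_snd).inter
      (measurableSet_lt measurable_snd measurable_const))

theorem timeDomain_mono {t t' : ℝ} (h : t ≤ t') : timeDomain t ⊆ timeDomain t' :=
  fun _ hq => ⟨hq.1, hq.2.1, hq.2.2.trans_le h⟩

theorem volume_timeDomain_le (t : ℝ) : volume (timeDomain t) ≤ ENNReal.ofReal t ^ 2 := by
  calc volume (timeDomain t) ≤ volume (Set.Ioo 0 t ×ˢ Set.Ioo 0 t) :=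
        measure_mono fun q hq => ⟨⟨hq.1, hq.2.1.trans hq.2.2⟩, ⟨hq.1.trans hq.2.1, hq.2.2⟩⟩
    _ = ENNReal.ofReal t ^ 2 := by
        rw [Measure.volume_eq_prod, Measure.prod_prod, Real.volume_Ioo, sub_zero, sq]

theorem volume_timeDomain_ne_top (t : ℝ) : volume (timeDomain t) ≠ ∞ :=
  ((volume_timeDomain_le t).trans_lt (ENNReal.pow_lt_top ENNReal.ofReal_lt_top)).ne

theorem volume_timeDomain_diff_le {t t' T : ℝ} (h' : t' ≤ T) :
    volume (timeDomain t' \ timeDomain t) ≤ ENNReal.ofReal T * ENNReal.ofReal (t' - t) := by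
  calc volume (timeDomain t' \ timeDomain t) ≤ volume (Set.Ioo 0 T ×ˢ Set.Icc t t') := by
        refine measure_mono fun q hq => ?_
        have h1 := hq.1.1
        have h2 := hq.1.2.1
        have h3 := hq.1.2.2
        refine ⟨⟨h1, by linarith⟩, ⟨?_, h3.le⟩⟩
        by_contra hlt
        exact hq.2 ⟨h1, h2, not_le.1 hlt⟩
    _ = _ := by rw [Measure.volume_eq_prod, Measure.prod_prod, Real.volume_Ioo, sub_zero,
        Real.volume_Icc]

theorem approxDSLT_eq {Ω : Type*} {B : ℝ≥0 → Ω → EuclideanSpace ℝ (Fin d)} (ε t : ℝ) (y : EuclideanSpace ℝ (Fin d)) (ω : Ω) :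
    approxDSLT B k ε t y ω = (-1) ^ (∑ j, k j) *
      ∫ q in timeDomain t, (fourierSymbol (dsltSymbol k ε y) (increment B q ω)).re := by
  unfold approxDSLT
  congr 1
  refine integral_congr_ae (Eventually.of_forall fun q => ?_)
  simp only
  rw [← gaussianDeriv_sub_eq]
  rfl

theorem im_fourierSymbol_dsltSymbol (ε : ℝ) (y x : EuclideanSpace ℝ (Fin d)) :
    (fourierSymbol (dsltSymbol k ε y) x).im = 0 := by
  rw [← gaussianDeriv_sub_eq]
  exact gaussianDeriv_im _ _ _

theorem measurable_approxDSLT (hc : ∀ ω, Continuous fun t => B t ω) (hm : ∀ t, Measurable (B t))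
    {ε : ℝ} (hε : 0 < ε) (t : ℝ) (y : EuclideanSpace ℝ (Fin d)) :
    Measurable (approxDSLT B k ε t y) := by
  have h := (measurable_setIntegral_fourierSymbol hc hm (integrable_dsltSymbol k hε y)
    (timeDomain t)).const_mul ((-1) ^ (∑ j, k j))
  have e : approxDSLT B k ε t y = fun ω => (-1) ^ (∑ j, k j) *
      ∫ q in timeDomain t, (fourierSymbol (dsltSymbol k ε y) (increment B q ω)).re :=
    funext fun ω => approxDSLT_eq ε t y ω
  rw [e]
  exact h

theorem memLp_approxDSLT [IsProbabilityMeasure P] (hc : ∀ ω, Continuous fun t => B t ω)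
    (hm : ∀ t, Measurable (B t)) {ε : ℝ} (hε : 0 < ε) (t : ℝ) (y : EuclideanSpace ℝ (Fin d))
    (p : ℝ≥0∞) : MemLp (approxDSLT B k ε t y) p P := by
  refine MemLp.of_bound (measurable_approxDSLT hc hm hε t y).aestronglyMeasurable
    ((∫ p, ‖dsltSymbol k ε y p‖) * volume.real (timeDomain t)) (Eventually.of_forall fun ω => ?_)
  rw [approxDSLT_eq, norm_mul, norm_pow, norm_neg, norm_one, one_pow, one_mul]
  refine norm_setIntegral_le_of_norm_le_const (volume_timeDomain_ne_top t).lt_top fun q _ => ?_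
  exact (Complex.abs_re_le_norm _).trans (norm_fourierSymbol_le _)

theorem eLpNorm_neg_one_pow_mul (m : ℕ) (f : Ω → ℝ) (p : ℝ≥0∞) :
    eLpNorm (fun ω => (-1) ^ m * f ω) p P = eLpNorm f p P := by
  have := eLpNorm_const_smul ((-1 : ℝ) ^ m) f p P
  rw [enorm_pow, enorm_neg, enorm_one, one_pow, one_mul] at this
  exact this

theorem setIntegral_fourierSymbol_sub {Ω : Type*} {B : ℝ≥0 → Ω → EuclideanSpace ℝ (Fin d)}
    (hc : ∀ ω, Continuous fun t => B t ω)
    {g₁ g₂ : EuclideanSpace ℝ (Fin d) → ℂ} (h₁ : Integrable g₁) (h₂ : Integrable g₂) (t : ℝ)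
    (ω : Ω) :
    (∫ q in timeDomain t, (fourierSymbol g₁ (increment B q ω)).re) -
      ∫ q in timeDomain t, (fourierSymbol g₂ (increment B q ω)).re =
      ∫ q in timeDomain t, (fourierSymbol (fun p => g₁ p - g₂ p) (increment B q ω)).re := by
  rw [← integral_sub (integrableOn_re_fourierSymbol hc h₁ (volume_timeDomain_ne_top t) ω)
    (integrableOn_re_fourierSymbol hc h₂ (volume_timeDomain_ne_top t) ω)]
  congr 1
  funext q
  rw [fourierSymbol_sub h₁ h₂, Complex.sub_re]

theorem im_fourierSymbol_sub {ε ε' : ℝ} (hε : 0 < ε) (hε' : 0 < ε')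
    (x y z : EuclideanSpace ℝ (Fin d)) :
    (fourierSymbol (fun p => dsltSymbol k ε x p - dsltSymbol k ε' y p) z).im = 0 := by
  rw [fourierSymbol_sub (integrable_dsltSymbol k hε x) (integrable_dsltSymbol k hε' y),
    Complex.sub_im, im_fourierSymbol_dsltSymbol, im_fourierSymbol_dsltSymbol, sub_zero]

/-- The DSLT is unique up to almost sure equality, whatever the exponents of convergence. -/
theorem IsDSLT.ae_eq (hc : ∀ ω, Continuous fun t => B t ω) (hm : ∀ t, Measurable (B t))
    {t : ℝ} {y : EuclideanSpace ℝ (Fin d)} {X X' : Ω → ℝ} (hX : IsDSLT B P k t y X)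
    (hX' : IsDSLT B P k t y X') : X =ᵐ[P] X' := by
  have h : ∀ {X : Ω → ℝ}, IsDSLT B P k t y X →
      TendstoInMeasure P (fun m : ℕ => approxDSLT B k (1 / ((m : ℝ) + 1)) t y) atTop X := by
    rintro X ⟨p, hp0, hp, hXm, hXl⟩
    have h2 : Tendsto (fun m : ℕ => 1 / ((m : ℝ) + 1)) atTop (𝓝[>] 0) :=
      tendsto_nhdsWithin_iff.2 ⟨tendsto_one_div_add_atTop_nhds_zero_nat,
        Eventually.of_forall fun m => by simp only [Set.mem_Ioi]; positivity⟩
    exact tendstoInMeasure_of_tendsto_eLpNorm hp0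
      (fun m => (measurable_approxDSLT hc hm (by positivity) t y).aestronglyMeasurable)
      hXm.aestronglyMeasurable (hXl.comp h2)
  exact tendstoInMeasure_ae_unique (h hX) (h hX')

/-- Bounds uniform in `ε` for differences of approximations pass to the limit. -/
theorem eLpNorm_sub_le_of_isLpLimit (hc : ∀ ω, Continuous fun t => B t ω)
    (hm : ∀ t, Measurable (B t)) {t t' : ℝ} {x y : EuclideanSpace ℝ (Fin d)} {p : ℝ≥0∞}
    (hp : 1 ≤ p) {X Y : Ω → ℝ} (hX : IsLpLimit B P k t x p X) (hY : IsLpLimit B P k t' y p Y)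
    {C : ℝ≥0∞} (hb : ∀ ε : ℝ, 0 < ε →
      eLpNorm (fun ω => approxDSLT B k ε t x ω - approxDSLT B k ε t' y ω) p P ≤ C) :
    eLpNorm (fun ω => X ω - Y ω) p P ≤ C := by
  have hlim : Tendsto (fun ε : ℝ => eLpNorm (fun ω => approxDSLT B k ε t x ω - X ω) p P + C +
      eLpNorm (fun ω => approxDSLT B k ε t' y ω - Y ω) p P) (𝓝[>] 0) (𝓝 (0 + C + 0)) :=
    (hX.2.add tendsto_const_nhds).add hY.2
  rw [zero_add, add_zero] at hlim
  refine ge_of_tendsto hlim ?_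
  filter_upwards [self_mem_nhdsWithin] with ε hε
  have m1 := (measurable_approxDSLT (k := k) hc hm hε t x).aestronglyMeasurable (μ := P)
  have m2 := (measurable_approxDSLT (k := k) hc hm hε t' y).aestronglyMeasurable (μ := P)
  have e : (fun ω => X ω - Y ω) = ((-fun ω => approxDSLT B k ε t x ω - X ω) +
      fun ω => approxDSLT B k ε t x ω - approxDSLT B k ε t' y ω) +
      fun ω => approxDSLT B k ε t' y ω - Y ω := by
    funext ω
    simp
  rw [e]
  refine (eLpNorm_add_le ((m1.sub hX.1.aestronglyMeasurable).neg.add (m1.sub m2))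
    (m2.sub hY.1.aestronglyMeasurable) hp).trans ?_
  refine add_le_add ?_ le_rfl
  refine (eLpNorm_add_le (m1.sub hX.1.aestronglyMeasurable).neg (m1.sub m2) hp).trans ?_
  rw [eLpNorm_neg]
  exact add_le_add le_rfl (hb ε hε)

variable [IsProbabilityMeasure P]

/-- A common form of the estimates in `ε` and in space: if the difference of two symbols gains a
factor `A ‖p‖^θ`, the difference of the approximations is `O(A)` in `L^{2N}`. -/
theorem exists_eLpNorm_approxDSLT_sub_le (h0 : 0 < H) (h1 : H < 1) (hd : 0 < d)
    (hB : IsFractionalBrownianMotion H B P) (hc : ∀ ω, Continuous fun t => B t ω)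
    (hm : ∀ t, Measurable (B t)) {N : ℕ} (hN : 0 < N) {θ T : ℝ} (hθ : 0 ≤ θ)
    (hθ' : H * (((∑ j, k j : ℕ) : ℝ) + θ + d) < 1) (hT : 0 < T) :
    ∃ C : ℝ≥0∞, C ≠ ∞ ∧ ∀ t ≤ T, ∀ ε ε' : ℝ, 0 < ε → 0 < ε' →
      ∀ (x y : EuclideanSpace ℝ (Fin d)) (A : ℝ), 0 ≤ A →
      (∀ p, ‖dsltSymbol k ε x p - dsltSymbol k ε' y p‖ ≤
        A * ‖p‖ ^ (((∑ j, k j : ℕ) : ℝ) + θ)) →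
      eLpNorm (fun ω => approxDSLT B k ε t x ω - approxDSLT B k ε' t y ω) ((2 * N : ℕ) : ℝ≥0∞) P ≤
        C * ENNReal.ofReal A := by
  set γ := H * (((∑ j, k j : ℕ) : ℝ) + θ + d) with hγ
  have hβ0 : 0 < (1 - γ) / 2 := by linarith
  obtain ⟨C, hC, hb⟩ := eLpNorm_setIntegral_fourierSymbol_le h0 h1 hd hB hc hm hN
    (κ := ((∑ j, k j : ℕ) : ℝ) + θ) (β := (1 - γ) / 2) (by positivity) hβ0
    (by rw [← hγ]; linarith) hT
  refine ⟨C * (ENNReal.ofReal T ^ 2) ^ ((1 - γ) / 2), ENNReal.mul_ne_top hC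
    (ENNReal.rpow_ne_top_of_nonneg hβ0.le (ENNReal.pow_ne_top ENNReal.ofReal_ne_top)), ?_⟩
  intro t ht ε ε' hε hε' x y A hA hgA
  have i1 := integrable_dsltSymbol k hε x
  have i2 := integrable_dsltSymbol k hε' y
  have e : (fun ω => approxDSLT B k ε t x ω - approxDSLT B k ε' t y ω) = fun ω =>
      (-1) ^ (∑ j, k j) * ∫ q in timeDomain t, (fourierSymbol
        (fun p => dsltSymbol k ε x p - dsltSymbol k ε' y p) (increment B q ω)).re := by
    funext ω
    rw [approxDSLT_eq, approxDSLT_eq, ← mul_sub, setIntegral_fourierSymbol_sub hc i1 i2]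
  rw [e, eLpNorm_neg_one_pow_mul]
  refine (hb _ A (timeDomain t) (i1.sub i2) hA hgA (im_fourierSymbol_sub hε hε' x y)
    (measurableSet_timeDomain t) (timeDomain_mono ht)).trans ?_
  calc _ ≤ C * ENNReal.ofReal A * (ENNReal.ofReal T ^ 2) ^ ((1 - γ) / 2) := by
        gcongr
        exact (volume_timeDomain_le t).trans (by gcongr)
    _ = _ := by ring

theorem exists_eLpNorm_approxDSLT_eps_le (h0 : 0 < H) (h1 : H < 1) (hd : 0 < d)
    (hB : IsFractionalBrownianMotion H B P) (hc : ∀ ω, Continuous fun t => B t ω)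
    (hm : ∀ t, Measurable (B t)) {N : ℕ} (hN : 0 < N) {θ T : ℝ} (hθ : 0 ≤ θ) (hθ1 : θ ≤ 1)
    (hθ' : H * (((∑ j, k j : ℕ) : ℝ) + θ + d) < 1) (hT : 0 < T) :
    ∃ C : ℝ≥0∞, C ≠ ∞ ∧ ∀ t ≤ T, ∀ ε ε' : ℝ, 0 < ε → 0 < ε' →
      ∀ y : EuclideanSpace ℝ (Fin d),
      eLpNorm (fun ω => approxDSLT B k ε t y ω - approxDSLT B k ε' t y ω) ((2 * N : ℕ) : ℝ≥0∞) P ≤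
        C * ENNReal.ofReal (|ε - ε'| ^ (θ / 2)) := by
  obtain ⟨C, hC, hb⟩ := exists_eLpNorm_approxDSLT_sub_le h0 h1 hd hB hc hm hN hθ hθ' hT
  exact ⟨C, hC, fun t ht ε ε' hε hε' y => hb t ht ε ε' hε hε' y y _
    (Real.rpow_nonneg (abs_nonneg _) _) (norm_dsltSymbol_sub_eps_le k hε.le hε'.le hθ hθ1 y)⟩

theorem exists_eLpNorm_approxDSLT_space_le (h0 : 0 < H) (h1 : H < 1) (hd : 0 < d)
    (hB : IsFractionalBrownianMotion H B P) (hc : ∀ ω, Continuous fun t => B t ω)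
    (hm : ∀ t, Measurable (B t)) {N : ℕ} (hN : 0 < N) {θ T : ℝ} (hθ : 0 ≤ θ) (hθ1 : θ ≤ 1)
    (hθ' : H * (((∑ j, k j : ℕ) : ℝ) + θ + d) < 1) (hT : 0 < T) :
    ∃ C : ℝ≥0∞, C ≠ ∞ ∧ ∀ t ≤ T, ∀ ε : ℝ, 0 < ε →
      ∀ x y : EuclideanSpace ℝ (Fin d),
      eLpNorm (fun ω => approxDSLT B k ε t x ω - approxDSLT B k ε t y ω) ((2 * N : ℕ) : ℝ≥0∞) P ≤
        C * ENNReal.ofReal (‖x - y‖ ^ θ) := by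
  obtain ⟨C, hC, hb⟩ := exists_eLpNorm_approxDSLT_sub_le h0 h1 hd hB hc hm hN hθ hθ' hT
  refine ⟨C * ENNReal.ofReal 2, ENNReal.mul_ne_top hC ENNReal.ofReal_ne_top,
    fun t ht ε hε x y => ?_⟩
  rw [mul_assoc, ← ENNReal.ofReal_mul zero_le_two]
  exact hb t ht ε ε hε hε x y _ (mul_nonneg zero_le_two (Real.rpow_nonneg (norm_nonneg _) _))
    (norm_dsltSymbol_sub_space_le k hε.le hθ hθ1 x y)

theorem exists_eLpNorm_approxDSLT_time_le (h0 : 0 < H) (h1 : H < 1) (hd : 0 < d)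
    (hB : IsFractionalBrownianMotion H B P) (hc : ∀ ω, Continuous fun t => B t ω)
    (hm : ∀ t, Measurable (B t)) {N : ℕ} (hN : 0 < N) {β T : ℝ} (hβ0 : 0 < β)
    (hβ : β < 1 - H * (((∑ j, k j : ℕ) : ℝ) + d)) (hT : 0 < T) :
    ∃ C : ℝ≥0∞, C ≠ ∞ ∧ ∀ t ≤ T, ∀ t' ≤ T, ∀ ε : ℝ, 0 < ε →
      ∀ y : EuclideanSpace ℝ (Fin d),
      eLpNorm (fun ω => approxDSLT B k ε t y ω - approxDSLT B k ε t' y ω) ((2 * N : ℕ) : ℝ≥0∞) P ≤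
        C * ENNReal.ofReal (|t - t'| ^ β) := by
  obtain ⟨C, hC, hb⟩ := eLpNorm_setIntegral_fourierSymbol_le h0 h1 hd hB hc hm hN
    (κ := ((∑ j, k j : ℕ) : ℝ)) (β := β) (by positivity) hβ0 hβ hT
  refine ⟨C * ENNReal.ofReal T ^ β, ENNReal.mul_ne_top hC
    (ENNReal.rpow_ne_top_of_nonneg hβ0.le ENNReal.ofReal_ne_top), ?_⟩
  intro t ht t' ht' ε hε y
  wlog htt : t' ≤ t generalizing t t'
  · have := this t' ht' t ht (le_of_not_ge htt)
    rw [abs_sub_comm t t']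
    refine le_trans (le_of_eq ?_) this
    rw [← eLpNorm_neg]
    congr 1
    funext ω
    simp
  have i1 := integrable_dsltSymbol k hε y
  have e : (fun ω => approxDSLT B k ε t y ω - approxDSLT B k ε t' y ω) = fun ω =>
      (-1) ^ (∑ j, k j) * ∫ q in timeDomain t \ timeDomain t', (fourierSymbol
        (dsltSymbol k ε y) (increment B q ω)).re := by
    funext ω
    rw [approxDSLT_eq, approxDSLT_eq, ← mul_sub, setIntegral_sdiff (measurableSet_timeDomain t')
      (integrableOn_re_fourierSymbol hc i1 (volume_timeDomain_ne_top t) ω) (timeDomain_mono htt)]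
  rw [e, eLpNorm_neg_one_pow_mul]
  refine (hb _ 1 (timeDomain t \ timeDomain t') i1 zero_le_one (norm_dsltSymbol_le k hε.le y)
    (im_fourierSymbol_dsltSymbol ε y)
    ((measurableSet_timeDomain t).diff (measurableSet_timeDomain t'))
    (Set.sdiff_subset.trans (timeDomain_mono ht))).trans ?_
  rw [ENNReal.ofReal_one, mul_one, abs_of_nonneg (by linarith),
    ← ENNReal.ofReal_rpow_of_nonneg (by linarith) hβ0.le, mul_assoc,
    ← ENNReal.mul_rpow_of_nonneg _ _ hβ0.le]
  gcongr
  exact volume_timeDomain_diff_le ht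

/-! ### The limit and its moments -/

theorem exists_pos_exponent {a : ℝ} (h0 : 0 < H) (ha : H * a < 1) :
    ∃ θ : ℝ, 0 < θ ∧ θ ≤ 1 ∧ H * (a + θ) < 1 := by
  refine ⟨min 1 ((1 - H * a) / (2 * H)), lt_min one_pos (div_pos (by linarith) (by linarith)),
    min_le_left _ _, ?_⟩
  have h2 : H * min 1 ((1 - H * a) / (2 * H)) ≤ H * ((1 - H * a) / (2 * H)) :=
    mul_le_mul_of_nonneg_left (min_le_right _ _) h0.le
  have h3 : H * ((1 - H * a) / (2 * H)) = (1 - H * a) / 2 := by field_simp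
  linarith

/-- Existence of the DSLT in all `L^p`. -/
theorem exists_isLpLimit (h0 : 0 < H) (h1 : H < 1) (hd : 0 < d)
    (hB : IsFractionalBrownianMotion H B P) (hc : ∀ ω, Continuous fun t => B t ω)
    (hm : ∀ t, Measurable (B t)) (hk : H * (((∑ j, k j : ℕ) : ℝ) + (d : ℝ)) < 1)
    (t : ℝ) (y : EuclideanSpace ℝ (Fin d)) :
    ∃ X : Ω → ℝ, ∀ p : ℝ≥0∞, p ≠ 0 → p ≠ ∞ → IsLpLimit B P k t y p X := by
  obtain ⟨θ, hθ0, hθ1, hθ'⟩ := exists_pos_exponent h0 hk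
  have hT : 0 < max t 1 := lt_max_of_lt_right one_pos
  have hθ'' : H * (((∑ j, k j : ℕ) : ℝ) + θ + d) < 1 := by
    rwa [add_right_comm]
  have key := fun (N : ℕ) (hN : 0 < N) =>
    exists_eLpNorm_approxDSLT_eps_le h0 h1 hd hB hc hm hN hθ0.le hθ1 hθ'' hT
  -- a sequence `ε_m → 0` with `ε_m ^ (θ / 2) = 2 ^ (-m)`
  set e : ℕ → ℝ := fun m => ((1 / 2 : ℝ) ^ m) ^ (2 / θ) with he
  have he0 : ∀ m, 0 < e m := fun m => by positivity
  have heθ : ∀ m, e m ^ (θ / 2) = (1 / 2 : ℝ) ^ m := by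
    intro m
    rw [he, ← Real.rpow_mul (by positivity)]
    rw [show 2 / θ * (θ / 2) = 1 by field_simp, Real.rpow_one]
  have he_anti : ∀ m n, m ≤ n → e n ≤ e m := fun m n hmn =>
    Real.rpow_le_rpow (by positivity) (pow_le_pow_of_le_one (by norm_num) (by norm_num) hmn)
      (by positivity)
  have he_lim : Tendsto e atTop (𝓝 0) := by
    have h2 : Tendsto (fun m : ℕ => (1 / 2 : ℝ) ^ m) atTop (𝓝 0) :=
      tendsto_pow_atTop_nhds_zero_of_lt_one (by norm_num) (by norm_num)
    have h3 := h2.rpow_const (p := 2 / θ) (Or.inr (by positivity))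
    rwa [Real.zero_rpow (by positivity)] at h3
  obtain ⟨C₁, hC₁, hb₁⟩ := key 1 one_pos
  have hmem := fun (ε : ℝ) (hε : 0 < ε) (p : ℝ≥0∞) =>
    memLp_approxDSLT (P := P) (k := k) hc hm hε t y p
  obtain ⟨X, hX, hXlim⟩ := Lp.cauchy_complete_eLpNorm (μ := P) (p := ((2 * 1 : ℕ) : ℝ≥0∞))
    (by norm_num) (f := fun m => approxDSLT B k (e m) t y) (fun m => hmem _ (he0 m) _)
    (B := fun m => (C₁ + 1) * (1 / 2 : ℝ≥0∞) ^ m)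
    (by
      rw [ENNReal.tsum_mul_left, ENNReal.tsum_geometric]
      refine ENNReal.mul_ne_top (ENNReal.add_ne_top.2 ⟨hC₁, ENNReal.one_ne_top⟩) ?_
      simp)
    (by
      intro M n m hn hm'
      refine (hb₁ t (le_max_left _ _) (e n) (e m) (he0 n) (he0 m) y).trans_lt ?_
      have h2 : |e n - e m| ≤ e M := by
        have := he_anti M n hn
        have := he_anti M m hm'
        have := he0 n
        have := he0 m
        rw [abs_le]
        constructor <;> linarith
      have h3 : ENNReal.ofReal (|e n - e m| ^ (θ / 2)) ≤ (1 / 2 : ℝ≥0∞) ^ M := by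
        refine (ENNReal.ofReal_le_ofReal (Real.rpow_le_rpow (abs_nonneg _) h2
          (by positivity))).trans (le_of_eq ?_)
        rw [heθ, ENNReal.ofReal_pow (by norm_num)]
        congr 1
        rw [ENNReal.ofReal_div_of_pos two_pos]
        simp
      calc _ ≤ C₁ * (1 / 2 : ℝ≥0∞) ^ M := by gcongr
        _ < _ := by
          refine ENNReal.mul_lt_mul_left (by simp) (by simp) ?_
          exact ENNReal.lt_add_right hC₁ one_ne_zero)
  have hae : ∃ ns : ℕ → ℕ, StrictMono ns ∧ ∀ᵐ ω ∂P, Tendsto (fun i =>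
      approxDSLT B k (e (ns i)) t y ω) atTop (𝓝 (X ω)) :=
    (tendstoInMeasure_of_tendsto_eLpNorm (p := ((2 * 1 : ℕ) : ℝ≥0∞)) (by norm_num)
      (fun m => (hmem _ (he0 m) 1).aestronglyMeasurable) hX.aestronglyMeasurable
      hXlim).exists_seq_tendsto_ae
  obtain ⟨ns, hns, hlim⟩ := hae
  -- Fatou's lemma gives a rate of convergence in every `L^{2N}`
  have rate : ∀ N : ℕ, 0 < N → ∃ C : ℝ≥0∞, C ≠ ∞ ∧ ∀ ε : ℝ, 0 < ε →
      eLpNorm (fun ω => approxDSLT B k ε t y ω - X ω) ((2 * N : ℕ) : ℝ≥0∞) P ≤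
        C * ENNReal.ofReal (ε ^ (θ / 2)) := by
    intro N hN
    obtain ⟨C, hC, hb⟩ := key N hN
    refine ⟨C, hC, fun ε hε => ?_⟩
    refine (Lp.eLpNorm_lim_le_liminf_eLpNorm (f := fun i ω =>
      approxDSLT B k ε t y ω - approxDSLT B k (e (ns i)) t y ω) (fun i =>
        ((hmem ε hε 1).sub (hmem _ (he0 _) 1)).aestronglyMeasurable) _ (by
        filter_upwards [hlim] with ω hω
        exact tendsto_const_nhds.sub hω)).trans ?_
    refine liminf_le_of_frequently_le' (Eventually.frequently ?_)
    have hev : ∀ᶠ i in atTop, e (ns i) ≤ ε :=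
      ((he_lim.comp hns.tendsto_atTop).eventually (gt_mem_nhds hε)).mono fun i hi => le_of_lt hi
    filter_upwards [hev] with i hi
    refine (hb t (le_max_left _ _) ε _ hε (he0 _) y).trans ?_
    gcongr
    rw [abs_of_nonneg (by linarith)]
    linarith [he0 (ns i)]
  refine ⟨X, fun p hp0 hp => ?_⟩
  obtain ⟨N, hN0, hpN⟩ : ∃ N : ℕ, 0 < N ∧ p ≤ ((2 * N : ℕ) : ℝ≥0∞) := by
    obtain ⟨N, hN⟩ := ENNReal.exists_nat_gt hp
    refine ⟨N + 1, Nat.succ_pos _, hN.le.trans ?_⟩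
    exact_mod_cast (by omega : N ≤ 2 * (N + 1))
  obtain ⟨C, hC, hb⟩ := rate N hN0
  constructor
  · have h2 : MemLp (fun ω => approxDSLT B k 1 t y ω - X ω) ((2 * N : ℕ) : ℝ≥0∞) P :=
      ⟨(hmem 1 one_pos 1).aestronglyMeasurable.sub hX.aestronglyMeasurable,
        (hb 1 one_pos).trans_lt (ENNReal.mul_lt_top hC.lt_top ENNReal.ofReal_lt_top)⟩
    have h3 := (hmem 1 one_pos ((2 * N : ℕ) : ℝ≥0∞)).sub h2
    have h4 : MemLp X ((2 * N : ℕ) : ℝ≥0∞) P := by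
      refine h3.ae_eq (Eventually.of_forall fun ω => ?_)
      simp
    exact h4.mono_exponent hpN
  · have hz : Tendsto (fun ε : ℝ => C * ENNReal.ofReal (ε ^ (θ / 2))) (𝓝[>] 0) (𝓝 0) := by
      have h2 : Tendsto (fun ε : ℝ => ε ^ (θ / 2)) (𝓝[>] 0) (𝓝 0) := by
        have h3 : Tendsto (fun ε : ℝ => ε) (𝓝[>] (0 : ℝ)) (𝓝 0) := nhdsWithin_le_nhds
        have h4 := h3.rpow_const (p := θ / 2) (Or.inr (by positivity))
        rwa [Real.zero_rpow (by positivity)] at h4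
      have h3 := ENNReal.Tendsto.const_mul (a := C) (ENNReal.tendsto_ofReal h2) (Or.inr hC)
      simpa using h3
    refine tendsto_of_tendsto_of_tendsto_of_le_of_le' tendsto_const_nhds hz
      (Eventually.of_forall fun _ => zero_le) ?_
    filter_upwards [self_mem_nhdsWithin] with ε hε
    exact (eLpNorm_le_eLpNorm_of_exponent_le hpN
      ((hmem ε hε 1).aestronglyMeasurable.sub hX.aestronglyMeasurable)).trans (hb ε hε)

end Approx

/-! ### Regularization of the fractional Brownian motion -/

section Regularize

variable {d : ℕ} {Ω : Type*} [MeasurableSpace Ω] {P : Measure Ω} {H : ℝ}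
  {B B' : ℝ≥0 → Ω → EuclideanSpace ℝ (Fin d)} {k : Fin d → ℕ}

/-- A fractional Brownian motion is indistinguishable from one all of whose paths are continuous
and all of whose marginals are measurable (and not merely almost everywhere measurable). -/
theorem IsFractionalBrownianMotion.exists_regular (hB : IsFractionalBrownianMotion H B P) :
    ∃ B' : ℝ≥0 → Ω → EuclideanSpace ℝ (Fin d), IsFractionalBrownianMotion H B' P ∧
      (∀ ω, Continuous fun t => B' t ω) ∧ (∀ t, Measurable (B' t)) ∧
      ∀ᵐ ω ∂P, ∀ t, B' t ω = B t ω := by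
  classical
  have ham := fun t => hB.isGaussianProcess.aemeasurable t
  set u : ℕ → ℝ≥0 := TopologicalSpace.denseSeq ℝ≥0 with hu
  have hgood : ∀ᵐ ω ∂P, (Continuous fun t => B t ω) ∧ ∀ n, B (u n) ω = (ham (u n)).mk _ ω := by
    filter_upwards [hB.continuous_paths, ae_all_iff.2 fun n => (ham (u n)).ae_eq_mk] with ω h1 h2
    exact ⟨h1, h2⟩
  set S : Set Ω := (toMeasurable P {ω | ¬ ((Continuous fun t => B t ω) ∧
    ∀ n, B (u n) ω = (ham (u n)).mk _ ω)})ᶜ with hS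
  have hSm : MeasurableSet S := (measurableSet_toMeasurable _ _).compl
  have hSae : ∀ᵐ ω ∂P, ω ∈ S := by
    rw [ae_iff]
    simp only [hS, Set.mem_compl_iff, not_not]
    change P (toMeasurable P _) = 0
    rw [measure_toMeasurable]
    exact ae_iff.1 hgood
  have hSgood : ∀ ω ∈ S, (Continuous fun t => B t ω) ∧ ∀ n, B (u n) ω = (ham (u n)).mk _ ω := by
    intro ω hω
    by_contra h
    exact hω (subset_toMeasurable _ _ h)
  set B' : ℝ≥0 → Ω → EuclideanSpace ℝ (Fin d) := fun t => S.indicator (B t) with hB'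
  have heq : ∀ᵐ ω ∂P, ∀ t, B' t ω = B t ω := by
    filter_upwards [hSae] with ω hω t
    exact Set.indicator_of_mem hω _
  have heq' : ∀ t, B' t =ᵐ[P] B t := fun t => heq.mono fun ω h => h t
  have hcont : ∀ ω, Continuous fun t => B' t ω := by
    intro ω
    by_cases hω : ω ∈ S
    · simpa [hB', hω] using (hSgood ω hω).1
    · simpa [hB', hω] using continuous_const
  have hmu : ∀ n, Measurable (B' (u n)) := by
    intro n
    have : B' (u n) = S.indicator ((ham (u n)).mk _) := by
      refine funext fun ω => ?_
      by_cases hω : ω ∈ S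
      · simp [hB', hω, (hSgood ω hω).2 n]
      · simp [hB', hω]
    rw [this]
    exact (ham (u n)).measurable_mk.indicator hSm
  refine ⟨B', ⟨?_, ?_, ?_, Eventually.of_forall hcont⟩, hcont, ?_, heq⟩
  · exact hB.isGaussianProcess.congr fun t => (heq' t).symm
  · intro t i
    rw [← hB.centered t i]
    exact integral_congr_ae ((heq' t).mono fun ω h => by simp only [h])
  · intro t s i j
    rw [← hB.covariance t s i j]
    refine integral_congr_ae ?_
    filter_upwards [heq' t, heq' s] with ω h1 h2
    rw [h1, h2]
  · intro t
    have hmem : t ∈ closure (Set.range u) := TopologicalSpace.denseRange_denseSeq ℝ≥0 t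
    obtain ⟨v, hv, hlim⟩ := mem_closure_iff_seq_limit.1 hmem
    refine measurable_of_tendsto_metrizable (f := fun n => B' (v n)) (fun n => ?_)
      (tendsto_pi_nhds.2 fun ω => ((hcont ω).tendsto t).comp hlim)
    obtain ⟨m, hm⟩ := hv n
    rw [← hm]
    exact hmu m

theorem approxDSLT_congr {Ω : Type*} {B B' : ℝ≥0 → Ω → EuclideanSpace ℝ (Fin d)} {ω : Ω}
    (h : ∀ t, B' t ω = B t ω) (ε t : ℝ) (y : EuclideanSpace ℝ (Fin d)) :
    approxDSLT B' k ε t y ω = approxDSLT B k ε t y ω := by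
  simp only [approxDSLT, h]

theorem isLpLimit_congr (h : ∀ᵐ ω ∂P, ∀ t, B' t ω = B t ω) {t : ℝ}
    {y : EuclideanSpace ℝ (Fin d)} {p : ℝ≥0∞} {X : Ω → ℝ} :
    IsLpLimit B' P k t y p X ↔ IsLpLimit B P k t y p X := by
  have e : ∀ ε : ℝ, eLpNorm (fun ω => approxDSLT B' k ε t y ω - X ω) p P =
      eLpNorm (fun ω => approxDSLT B k ε t y ω - X ω) p P := fun ε =>
    eLpNorm_congr_ae (h.mono fun ω hω => by simp only [approxDSLT_congr hω])
  simp only [IsLpLimit, e]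

theorem isDSLT_congr (h : ∀ᵐ ω ∂P, ∀ t, B' t ω = B t ω) {t : ℝ}
    {y : EuclideanSpace ℝ (Fin d)} {X : Ω → ℝ} :
    IsDSLT B' P k t y X ↔ IsDSLT B P k t y X := by
  simp only [IsDSLT, isLpLimit_congr h]

end Regularize

/-! ### Decay of the regularized kernels away from the origin -/

/-- The one-dimensional integral `∫ p^m e^{ipx} e^{-εp²/2} dp`. -/
noncomputable def gaussMoment (m : ℕ) (ε x : ℝ) : ℂ :=
  ∫ p : ℝ, (p : ℂ) ^ m * Complex.exp (Complex.I * (p * x : ℝ)) *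
    Complex.exp ((-(ε * p ^ 2 / 2) : ℝ) : ℂ)

theorem integrable_gaussMoment (m : ℕ) {ε : ℝ} (hε : 0 < ε) (x : ℝ) :
    Integrable fun p : ℝ => (p : ℂ) ^ m * Complex.exp (Complex.I * (p * x : ℝ)) *
      Complex.exp ((-(ε * p ^ 2 / 2) : ℝ) : ℂ) := by
  have h := integrable_rpow_mul_exp_neg_mul_sq (b := ε / 2) (by positivity) (s := m)
    (by have : (0 : ℝ) ≤ m := by positivity
        linarith)
  refine h.norm.mono' (by fun_prop) (Eventually.of_forall fun p => le_of_eq ?_)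
  rw [norm_mul, norm_mul, norm_exp_I_mul_ofReal, ← Complex.ofReal_exp, norm_mul, norm_pow]
  simp only [Complex.norm_real, Real.rpow_natCast, norm_pow]
  ring_nf

theorem gaussMoment_zero {ε : ℝ} (hε : 0 < ε) (x : ℝ) :
    ‖gaussMoment 0 ε x‖ = (2 * Real.pi / ε) ^ (1 / 2 : ℝ) * Real.exp (-(x ^ 2 / (2 * ε))) := by
  have h := fourierIntegral_gaussian (b := ((ε / 2 : ℝ) : ℂ)) (by
    rw [Complex.ofReal_re]; positivity) (x : ℂ)
  have e : gaussMoment 0 ε x = ∫ p : ℝ, Complex.exp (Complex.I * x * p) *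
      Complex.exp (-((ε / 2 : ℝ) : ℂ) * p ^ 2) := by
    unfold gaussMoment
    congr 1
    funext p
    rw [pow_zero, one_mul]
    congr 2
    · push_cast; ring
    · push_cast; ring
  rw [e, h, norm_mul]
  congr 1
  · rw [← Complex.ofReal_div, show (1 / 2 : ℂ) = ((1 / 2 : ℝ) : ℂ) by push_cast; rfl,
      ← Complex.ofReal_cpow (by positivity), Complex.norm_real, Real.norm_of_nonneg (by positivity)]
    congr 1
    field_simp
  · rw [show -(x : ℂ) ^ 2 / (4 * ((ε / 2 : ℝ) : ℂ)) = ((-(x ^ 2 / (2 * ε)) : ℝ) : ℂ) by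
      push_cast
      have : (ε : ℂ) ≠ 0 := by exact_mod_cast hε.ne'
      field_simp
      ring, ← Complex.ofReal_exp, Complex.norm_real, Real.norm_of_nonneg (Real.exp_pos _).le]

/-- Integration by parts. -/
theorem gaussMoment_succ (m : ℕ) {ε : ℝ} (hε : 0 < ε) (x : ℝ) :
    (ε : ℂ) * gaussMoment (m + 1) ε x =
      Complex.I * x * gaussMoment m ε x + m * gaussMoment (m - 1) ε x := by
  set e : ℝ → ℂ := fun p => Complex.exp (Complex.I * (p * x : ℝ)) *
    Complex.exp ((-(ε * p ^ 2 / 2) : ℝ) : ℂ) with he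
  have hi : ∀ m, Integrable fun p : ℝ => (p : ℂ) ^ m * e p := fun m => by
    simpa only [he, mul_assoc] using integrable_gaussMoment m hε x
  have hg : ∀ m, gaussMoment m ε x = ∫ p : ℝ, (p : ℂ) ^ m * e p := fun m => by
    simp only [gaussMoment, he, mul_assoc]
  have hd : ∀ p : ℝ, HasDerivAt (fun p : ℝ => (p : ℂ) ^ m * e p)
      (m * ((p : ℂ) ^ (m - 1) * e p) + Complex.I * x * ((p : ℂ) ^ m * e p) -
        ε * ((p : ℂ) ^ (m + 1) * e p)) p := by
    intro p
    have h1 : HasDerivAt (fun p : ℝ => (p : ℂ)) 1 p := Complex.ofRealCLM.hasDerivAt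
    have h2 : HasDerivAt (fun p : ℝ => Complex.I * ((p * x : ℝ) : ℂ)) (Complex.I * x) p := by
      have := (h1.mul_const (x : ℂ)).const_mul Complex.I
      simpa using this
    have h3 : HasDerivAt (fun p : ℝ => ((-(ε * p ^ 2 / 2) : ℝ) : ℂ)) ((-(ε * p) : ℝ) : ℂ) p := by
      refine HasDerivAt.ofReal_comp ?_
      have := (((hasDerivAt_id p).fun_pow 2).const_mul ε).div_const 2 |>.neg
      convert! this using 1
      simp
      ring
    have := (h1.fun_pow m).mul (h2.cexp.mul h3.cexp)
    convert! this using 1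
    simp only [he, pow_succ, Pi.mul_apply]
    push_cast
    ring
  have i1 := ((hi (m - 1)).const_mul (m : ℂ))
  have i2 := ((hi m).const_mul (Complex.I * x))
  have i3 := ((hi (m + 1)).const_mul (ε : ℂ))
  have i12 : Integrable fun p : ℝ => m * ((p : ℂ) ^ (m - 1) * e p) +
      Complex.I * x * ((p : ℂ) ^ m * e p) := i1.add i2
  have := integral_eq_zero_of_hasDerivAt_of_integrable hd (i12.sub i3) (hi m)
  rw [integral_sub i12 i3, integral_add i1 i2, integral_const_mul,
    integral_const_mul, integral_const_mul, ← hg, ← hg, ← hg] at this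
  linear_combination -this

theorem exists_norm_gaussMoment_le (m : ℕ) : ∃ C : ℝ, 0 < C ∧ ∀ ε x : ℝ, 0 < ε → ε ≤ 1 →
    ‖gaussMoment m ε x‖ ≤
      C * (1 + |x|) ^ m * (1 / ε) ^ (m + 1) * Real.exp (-(x ^ 2 / (2 * ε))) := by
  induction m using Nat.strong_induction_on with
  | _ m ih =>
    obtain _ | m := m
    · refine ⟨(2 * Real.pi) ^ (1 / 2 : ℝ), by positivity, fun ε x h0 h1 => ?_⟩
      rw [gaussMoment_zero h0, pow_zero, mul_one, zero_add, pow_one]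
      gcongr
      rw [div_eq_mul_one_div, Real.mul_rpow (by positivity) (by positivity)]
      gcongr
      have : (1 : ℝ) ≤ 1 / ε := (one_le_div h0).2 h1
      calc (1 / ε) ^ (1 / 2 : ℝ) ≤ (1 / ε) ^ (1 : ℝ) :=
            Real.rpow_le_rpow_of_exponent_le this (by norm_num)
        _ = _ := Real.rpow_one _
    · obtain ⟨C₁, hC₁, h₁⟩ := ih m (Nat.lt_succ_self _)
      obtain ⟨C₂, hC₂, h₂⟩ := ih (m - 1) (by omega)
      refine ⟨C₁ + m * C₂, by positivity, fun ε x h0 h1 => ?_⟩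
      have hε : (1 : ℝ) ≤ 1 / ε := (one_le_div h0).2 h1
      have hx : (1 : ℝ) ≤ 1 + |x| := by linarith [abs_nonneg x]
      have e1 : gaussMoment (m + 1) ε x = (1 / ε : ℝ) *
          (Complex.I * x * gaussMoment m ε x + m * gaussMoment (m - 1) ε x) := by
        rw [← gaussMoment_succ m h0, ← mul_assoc, ← Complex.ofReal_mul,
          one_div_mul_cancel h0.ne', Complex.ofReal_one, one_mul]
      rw [e1, norm_mul, Complex.norm_real, Real.norm_of_nonneg (by positivity)]
      set G := Real.exp (-(x ^ 2 / (2 * ε)))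
      have hG : 0 < G := Real.exp_pos _
      have b1 : ‖Complex.I * x * gaussMoment m ε x‖ ≤
          C₁ * (1 + |x|) ^ (m + 1) * (1 / ε) ^ (m + 1) * G := by
        rw [norm_mul, norm_mul, Complex.norm_I, one_mul, Complex.norm_real, Real.norm_eq_abs]
        calc |x| * ‖gaussMoment m ε x‖
            ≤ (1 + |x|) * (C₁ * (1 + |x|) ^ m * (1 / ε) ^ (m + 1) * G) := by
              gcongr
              · linarith
              · exact h₁ ε x h0 h1
          _ = _ := by ring
      have b2 : ‖(m : ℂ) * gaussMoment (m - 1) ε x‖ ≤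
          m * C₂ * (1 + |x|) ^ (m + 1) * (1 / ε) ^ (m + 1) * G := by
        rw [norm_mul, Complex.norm_natCast]
        calc m * ‖gaussMoment (m - 1) ε x‖
            ≤ m * (C₂ * (1 + |x|) ^ (m - 1) * (1 / ε) ^ (m - 1 + 1) * G) := by
              gcongr
              exact h₂ ε x h0 h1
          _ ≤ m * (C₂ * (1 + |x|) ^ (m + 1) * (1 / ε) ^ (m + 1) * G) := by
              gcongr
              · omega
              · omega
          _ = _ := by ring
      calc _ ≤ 1 / ε * (C₁ * (1 + |x|) ^ (m + 1) * (1 / ε) ^ (m + 1) * G +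
            m * C₂ * (1 + |x|) ^ (m + 1) * (1 / ε) ^ (m + 1) * G) := by
            gcongr
            exact (norm_add_le _ _).trans (add_le_add b1 b2)
        _ = _ := by ring

section Kernel

variable {d : ℕ} (k : Fin d → ℕ)

theorem gaussianDeriv_eq_prod (ε : ℝ) (x : EuclideanSpace ℝ (Fin d)) :
    gaussianDeriv k ε x = Complex.I ^ (∑ j, k j) / (2 * (Real.pi : ℂ)) ^ d *
      ∏ j, gaussMoment (k j) ε (x j) := by
  unfold gaussianDeriv
  congr 1
  rw [← (PiLp.volume_preserving_toLp (Fin d)).integral_comp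
    (MeasurableEquiv.toLp 2 (Fin d → ℝ)).measurableEmbedding]
  unfold gaussMoment
  rw [← integral_fintype_prod_volume_eq_prod (f := fun (j : Fin d) (p : ℝ) => (p : ℂ) ^ k j *
    Complex.exp (Complex.I * (p * x j : ℝ)) * Complex.exp ((-(ε * p ^ 2 / 2) : ℝ) : ℂ))]
  congr 1
  funext p
  rw [Finset.prod_mul_distrib, Finset.prod_mul_distrib, ← Complex.exp_sum, ← Complex.exp_sum]
  congr 2
  · congr 1
    rw [← Finset.mul_sum, PiLp.inner_apply]
    push_cast
    simp [mul_comm]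
  · rw [EuclideanSpace.norm_sq_eq, ← Complex.ofReal_sum]
    congr 1
    simp only [Real.norm_eq_abs, sq_abs]
    rw [Finset.sum_neg_distrib, Finset.mul_sum, Finset.sum_div]

theorem exists_norm_gaussianDeriv_le : ∃ C : ℝ, 0 < C ∧ ∀ (ε : ℝ) (x : EuclideanSpace ℝ (Fin d)),
    0 < ε → ε ≤ 1 → ‖gaussianDeriv k ε x‖ ≤
      C * (1 + ‖x‖) ^ (∑ j, k j) * (1 / ε) ^ (∑ j, (k j + 1)) *
        Real.exp (-(‖x‖ ^ 2 / (2 * ε))) := by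
  choose C hC hb using fun j => exists_norm_gaussMoment_le (k j)
  refine ⟨1 / (2 * Real.pi) ^ d * ∏ j, C j, mul_pos (by positivity)
    (Finset.prod_pos fun j _ => hC j), fun ε x h0 h1 => ?_⟩
  rw [gaussianDeriv_eq_prod, norm_mul, norm_div, norm_pow, Complex.norm_I, one_pow, norm_pow,
    norm_mul, Complex.norm_real, Real.norm_of_nonneg Real.pi_pos.le, Complex.norm_ofNat, norm_prod]
  have h2 : ∏ j, ‖gaussMoment (k j) ε (x j)‖ ≤ ∏ j, (C j * (1 + ‖x‖) ^ k j * (1 / ε) ^ (k j + 1) *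
      Real.exp (-(x j ^ 2 / (2 * ε)))) := by
    refine Finset.prod_le_prod (fun _ _ => norm_nonneg _) fun j _ => (hb j ε (x j) h0 h1).trans ?_
    have := (hC j).le
    have : |x j| ≤ ‖x‖ := PiLp.norm_apply_le x j
    gcongr
  have h3 : ∏ j, (C j * (1 + ‖x‖) ^ k j * (1 / ε) ^ (k j + 1) *
      Real.exp (-(x j ^ 2 / (2 * ε)))) = (∏ j, C j) * (1 + ‖x‖) ^ (∑ j, k j) *
      (1 / ε) ^ (∑ j, (k j + 1)) * Real.exp (-(‖x‖ ^ 2 / (2 * ε))) := by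
    rw [Finset.prod_mul_distrib, Finset.prod_mul_distrib, Finset.prod_mul_distrib,
      Finset.prod_pow_eq_pow_sum, Finset.prod_pow_eq_pow_sum, ← Real.exp_sum,
      EuclideanSpace.norm_sq_eq]
    congr 2
    simp only [Real.norm_eq_abs, sq_abs]
    rw [Finset.sum_neg_distrib, Finset.sum_div]
  calc _ ≤ _ := mul_le_mul_of_nonneg_left (h2.trans_eq h3) (by positivity)
    _ = _ := by ring

variable {k} {Ω : Type*} {B : ℝ≥0 → Ω → EuclideanSpace ℝ (Fin d)}

/-- At levels `y` that no increment of the path can reach, the approximations vanish in the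
limit. -/
theorem tendsto_approxDSLT_zero {t M : ℝ} {ω : Ω} {y : EuclideanSpace ℝ (Fin d)}
    (hM : ∀ s : ℝ≥0, (s : ℝ) ≤ t → ‖B s ω‖ ≤ M) (hy : 2 * M < ‖y‖) :
    Tendsto (fun ε : ℝ => approxDSLT B k ε t y ω) (𝓝[>] 0) (𝓝 0) := by
  obtain ⟨C, hC, hb⟩ := exists_norm_gaussianDeriv_le k
  rcases le_or_gt t 0 with ht | ht
  · have : {q : ℝ × ℝ | 0 < q.1 ∧ q.1 < q.2 ∧ q.2 < t} = ∅ := by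
      ext q
      simp only [Set.mem_ofPred_eq, Set.mem_empty_iff_false, iff_false]
      rintro ⟨h1, h2, h3⟩
      linarith
    simp [approxDSLT, this]
  have hM0 : 0 ≤ M := (norm_nonneg _).trans (hM 0 (by simpa using ht.le))
  set c := (‖y‖ - 2 * M) ^ 2 / 2 with hc
  have hc0 : 0 < c := by
    have : 0 < ‖y‖ - 2 * M := by linarith
    positivity
  set n := ∑ j, (k j + 1) with hn
  set A := C * (1 + (2 * M + ‖y‖)) ^ (∑ j, k j) * volume.real (timeDomain t) with hA
  have hbound : ∀ᶠ ε : ℝ in 𝓝[>] 0, ‖approxDSLT B k ε t y ω‖ ≤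
      A * (ε⁻¹ ^ (n : ℝ) * Real.exp (-c * ε⁻¹)) := by
    have h1 : ∀ᶠ ε : ℝ in 𝓝[>] 0, ε < 1 := nhdsWithin_le_nhds (gt_mem_nhds one_pos)
    filter_upwards [self_mem_nhdsWithin, h1] with ε hε hε1
    have hε0 : 0 < ε := hε
    unfold approxDSLT
    rw [norm_mul, norm_pow, norm_neg, norm_one, one_pow, one_mul]
    have h2 := norm_setIntegral_le_of_norm_le_const (μ := volume) (s := timeDomain t)
      (f := fun q : ℝ × ℝ => (gaussianDeriv k ε (B q.2.toNNReal ω - B q.1.toNNReal ω - y)).re)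
      (C := C * (1 + (2 * M + ‖y‖)) ^ (∑ j, k j) * (ε⁻¹ ^ (n : ℝ) * Real.exp (-c * ε⁻¹)))
      (volume_timeDomain_ne_top t).lt_top (fun q hq => ?_)
    · refine h2.trans (le_of_eq ?_)
      rw [hA]
      ring
    set x := B q.2.toNNReal ω - B q.1.toNNReal ω - y with hx
    have b1 : ‖B q.1.toNNReal ω‖ ≤ M := hM _ (by
      rw [Real.coe_toNNReal _ hq.1.le]; linarith [hq.2.1, hq.2.2])
    have b2 : ‖B q.2.toNNReal ω‖ ≤ M := hM _ (by
      rw [Real.coe_toNNReal _ (hq.1.trans hq.2.1).le]; exact hq.2.2.le)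
    have b3 : ‖B q.2.toNNReal ω - B q.1.toNNReal ω‖ ≤ 2 * M :=
      (norm_sub_le _ _).trans (by linarith)
    have b4 : ‖x‖ ≤ 2 * M + ‖y‖ := (norm_sub_le _ _).trans (by linarith)
    have b5 : ‖y‖ - 2 * M ≤ ‖x‖ := by
      have := norm_sub_norm_le y (B q.2.toNNReal ω - B q.1.toNNReal ω)
      rw [norm_sub_rev y, ← hx] at this
      linarith
    refine ((Complex.abs_re_le_norm _).trans (hb ε x hε0 hε1.le)).trans ?_
    rw [mul_assoc, one_div, Real.rpow_natCast]
    have b6 : Real.exp (-(‖x‖ ^ 2 / (2 * ε))) ≤ Real.exp (-c * ε⁻¹) := by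
      refine Real.exp_le_exp.2 ?_
      rw [hc, neg_mul, neg_le_neg_iff]
      calc (‖y‖ - 2 * M) ^ 2 / 2 * ε⁻¹ ≤ ‖x‖ ^ 2 / 2 * ε⁻¹ := by
            gcongr
        _ = _ := by field_simp
    gcongr
  have hlim : Tendsto (fun ε : ℝ => A * (ε⁻¹ ^ (n : ℝ) * Real.exp (-c * ε⁻¹))) (𝓝[>] 0)
      (𝓝 (A * 0)) :=
    ((tendsto_rpow_mul_exp_neg_mul_atTop_nhds_zero n c hc0).comp
      tendsto_inv_nhdsGT_zero).const_mul A
  rw [mul_zero] at hlim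
  exact squeeze_zero_norm' hbound hlim

/-- The DSLT vanishes at levels that no increment of the path can reach. -/
theorem IsDSLT.ae_eq_zero [MeasurableSpace Ω] {P : Measure Ω}
    (hc : ∀ ω, Continuous fun t => B t ω) (hm : ∀ t, Measurable (B t)) {t : ℝ}
    {y : EuclideanSpace ℝ (Fin d)} {X : Ω → ℝ} (hX : IsDSLT B P k t y X) :
    ∀ᵐ ω ∂P, ∀ M : ℝ, (∀ s : ℝ≥0, (s : ℝ) ≤ t → ‖B s ω‖ ≤ M) → 2 * M < ‖y‖ → X ω = 0 := by
  obtain ⟨p, hp0, hp, hXm, hXl⟩ := hX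
  have h2 : Tendsto (fun m : ℕ => 1 / ((m : ℝ) + 1)) atTop (𝓝[>] 0) :=
    tendsto_nhdsWithin_iff.2 ⟨tendsto_one_div_add_atTop_nhds_zero_nat,
      Eventually.of_forall fun m => by simp only [Set.mem_Ioi]; positivity⟩
  obtain ⟨ns, hns, hlim⟩ := (tendstoInMeasure_of_tendsto_eLpNorm hp0
    (fun m => (measurable_approxDSLT (k := k) hc hm (by positivity) t y).aestronglyMeasurable)
    hXm.aestronglyMeasurable (hXl.comp h2)).exists_seq_tendsto_ae
  filter_upwards [hlim] with ω hω M hM hy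
  exact tendsto_nhds_unique hω
    (((tendsto_approxDSLT_zero hM hy).comp h2).comp hns.tendsto_atTop)

end Kernel

/-! ### Chaining -/

/-- A family of random variables `Z m i`, `i ∈ F m`, with `L^p` norms `O(2^{-m})` and cardinalities
`O(2^{Qm})` is almost surely `O(2^{-θm})`, as soon as `Q < p (1 - θ)`. -/
theorem ae_exists_forall_abs_le {Ω ι : Type*} [MeasurableSpace Ω] {P : Measure Ω}
    (Z : ℕ → ι → Ω → ℝ) (F : ℕ → Finset ι) (hZ : ∀ m i, AEStronglyMeasurable (Z m i) P)
    {p Q : ℕ} (hp : 0 < p) {θ : ℝ} (hQ : (Q : ℝ) + 1 ≤ p * (1 - θ)) {A C : ℝ≥0∞} (hA : A ≠ ∞)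
    (hC : C ≠ ∞) (hcard : ∀ m, ((F m).card : ℝ≥0∞) ≤ C * (2 : ℝ≥0∞) ^ (Q * m))
    (hnorm : ∀ m, ∀ i ∈ F m, eLpNorm (Z m i) p P ≤ A * (1 / 2 : ℝ≥0∞) ^ m) :
    ∀ᵐ ω ∂P, ∃ K : ℝ, 0 ≤ K ∧ ∀ m, ∀ i ∈ F m, |Z m i ω| ≤ K * ((1 / 2 : ℝ) ^ θ) ^ m := by
  set r : ℝ≥0∞ := (2 : ℝ≥0∞) ^ θ with hr
  set g : Ω → ℝ≥0∞ := fun ω => ∑' m, ∑ i ∈ F m, (r ^ m * ‖Z m i ω‖ₑ) ^ p with hg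
  have hmeas : ∀ m i, AEMeasurable (fun ω => (r ^ m * ‖Z m i ω‖ₑ) ^ p) P := fun m i =>
    ((hZ m i).enorm.const_mul _).pow_const _
  have hterm : ∀ m, ∀ i ∈ F m, ∫⁻ ω, (r ^ m * ‖Z m i ω‖ₑ) ^ p ∂P ≤
      (r ^ m * (A * (1 / 2 : ℝ≥0∞) ^ m)) ^ p := by
    intro m i hi
    have h1 : ∫⁻ ω, ‖Z m i ω‖ₑ ^ p ∂P = eLpNorm (Z m i) p P ^ p := by
      have := eLpNorm_nnreal_pow_eq_lintegral (μ := P) (f := Z m i) (p := (p : ℝ≥0))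
        (by exact_mod_cast hp.ne')
      simpa using this.symm
    simp_rw [mul_pow _ _ p]
    rw [lintegral_const_mul'' _ ((hZ m i).enorm.pow_const _), h1]
    gcongr
    simpa only [mul_pow] using (pow_le_pow_left' (hnorm m i hi) p)
  have hcomb : ∀ m, (2 : ℝ≥0∞) ^ (Q * m) * (r ^ m * (1 / 2 : ℝ≥0∞) ^ m) ^ p ≤
      (1 / 2 : ℝ≥0∞) ^ m := by
    intro m
    have h2 : (2 : ℝ≥0∞) ≠ 0 := by norm_num
    have h2' : (2 : ℝ≥0∞) ≠ ∞ := by norm_num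
    have e1 : (1 / 2 : ℝ≥0∞) ^ m = (2 : ℝ≥0∞) ^ (-(m : ℝ)) := by
      rw [ENNReal.rpow_neg, ENNReal.rpow_natCast, one_div, ENNReal.inv_pow]
    rw [e1, hr, ← ENNReal.rpow_natCast, ← ENNReal.rpow_natCast, ← ENNReal.rpow_natCast,
      ← ENNReal.rpow_mul, ← ENNReal.rpow_add _ _ h2 h2', ← ENNReal.rpow_mul,
      ← ENNReal.rpow_add _ _ h2 h2']
    refine ENNReal.rpow_le_rpow_of_exponent_le (by norm_num) ?_
    have hm : (0 : ℝ) ≤ m := by positivity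
    push_cast
    nlinarith
  have hfin : ∫⁻ ω, g ω ∂P ≠ ∞ := by
    have h1 : ∫⁻ ω, g ω ∂P ≤ ∑' m : ℕ, C * A ^ p * (1 / 2 : ℝ≥0∞) ^ m := by
      rw [hg, lintegral_tsum fun m => Finset.aemeasurable_fun_sum _ fun i _ => hmeas m i]
      refine ENNReal.tsum_le_tsum fun m => ?_
      rw [lintegral_finsetSum' _ fun i _ => hmeas m i]
      calc _ ≤ ∑ _i ∈ F m, (r ^ m * (A * (1 / 2 : ℝ≥0∞) ^ m)) ^ p :=
            Finset.sum_le_sum fun i hi => hterm m i hi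
        _ = (F m).card * (A ^ p * (r ^ m * (1 / 2 : ℝ≥0∞) ^ m) ^ p) := by
            rw [Finset.sum_const, nsmul_eq_mul, ← mul_pow]
            ring
        _ ≤ C * (2 : ℝ≥0∞) ^ (Q * m) * (A ^ p * (r ^ m * (1 / 2 : ℝ≥0∞) ^ m) ^ p) := by
            gcongr
            exact hcard m
        _ = C * A ^ p * ((2 : ℝ≥0∞) ^ (Q * m) * (r ^ m * (1 / 2 : ℝ≥0∞) ^ m) ^ p) := by ring
        _ ≤ _ := by
            gcongr
            exact hcomb m
    refine (h1.trans_lt ?_).ne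
    rw [ENNReal.tsum_mul_left, ENNReal.tsum_geometric]
    refine ENNReal.mul_lt_top (ENNReal.mul_lt_top hC.lt_top (ENNReal.pow_lt_top hA.lt_top)) ?_
    simp
  have hgm : AEMeasurable g P := AEMeasurable.tsum fun m =>
    Finset.aemeasurable_fun_sum _ fun i _ => hmeas m i
  filter_upwards [ae_lt_top' hgm hfin] with ω hω
  refine ⟨(g ω ^ (p : ℝ)⁻¹).toReal, ENNReal.toReal_nonneg, fun m i hi => ?_⟩
  have h1 : (r ^ m * ‖Z m i ω‖ₑ) ^ p ≤ g ω :=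
    (Finset.single_le_sum (f := fun i => (r ^ m * ‖Z m i ω‖ₑ) ^ p) (fun _ _ => zero_le) hi).trans
      (ENNReal.le_tsum m)
  have h2 : r ^ m * ‖Z m i ω‖ₑ ≤ g ω ^ (p : ℝ)⁻¹ := by
    rw [ENNReal.le_rpow_inv_iff (by exact_mod_cast hp), ENNReal.rpow_natCast]
    exact h1
  have h3 := ENNReal.toReal_mono (ENNReal.rpow_ne_top_of_nonneg (by positivity) hω.ne) h2
  rw [ENNReal.toReal_mul, ENNReal.toReal_pow, hr, ← ENNReal.toReal_rpow, toReal_enorm,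
    ENNReal.toReal_ofNat, Real.norm_eq_abs] at h3
  have h4 : (0 : ℝ) < 2 ^ θ := by positivity
  have h5 : ((1 / 2 : ℝ) ^ θ) ^ m = ((2 ^ θ) ^ m)⁻¹ := by
    rw [one_div, Real.inv_rpow (by norm_num), inv_pow]
  rw [h5, ← div_eq_mul_inv, le_div_iff₀ (by positivity), mul_comm]
  exact h3

/-- The deterministic part of the chaining argument: `π m` rounds to the net of level `m`, and `x`
is a path with controlled increments along the nets. -/
theorem exists_holder_of_net {S : Type*} {ρ : S → S → ℝ} {A : Set S} {π : ℕ → S → S}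
    {x X : S → ℝ} {c D θ K : ℝ} (hθ : 0 < θ) (hc : 0 ≤ c) (hD : 0 < D) (hK : 0 ≤ K)
    (hρ0 : ∀ u v, 0 ≤ ρ u v) (hρ : ∀ u v, ρ u v = 0 → u = v) (hsymm : ∀ u v, ρ u v = ρ v u)
    (htri : ∀ u v w, ρ u w ≤ ρ u v + ρ v w) (hπ : ∀ m u, ρ u (π m u) ≤ c * (1 / 2) ^ m)
    (hAD : ∀ u ∈ A, ∀ v ∈ A, ρ u v ≤ D)
    (hx : ∀ u ∈ A, ∀ v ∈ A, ∀ m, ∀ δ ∈ Finset.range 2,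
      ρ (π m u) (π (m + δ) v) ≤ (2 * c + D) * (1 / 2) ^ m →
      |x (π m u) - x (π (m + δ) v)| ≤ K * ((1 / 2 : ℝ) ^ θ) ^ m)
    (hX : ∀ u ∈ A, (∃ l, Tendsto (fun m => x (π m u)) atTop (𝓝 l)) →
      Tendsto (fun m => x (π m u)) atTop (𝓝 (X u))) :
    (∀ u ∈ A, Tendsto (fun m => x (π m u)) atTop (𝓝 (X u))) ∧
      ∃ K' : ℝ, 0 ≤ K' ∧ ∀ u ∈ A, ∀ v ∈ A, |X u - X v| ≤ K' * ρ u v ^ θ := by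
  set r : ℝ := (1 / 2 : ℝ) ^ θ with hr
  have hr0 : 0 < r := by positivity
  have hr1 : r < 1 := Real.rpow_lt_one (by norm_num) (by norm_num) hθ
  have hstep : ∀ u ∈ A, ∀ m, dist (x (π m u)) (x (π (m + 1) u)) ≤ K * r ^ m := by
    intro u hu m
    rw [Real.dist_eq]
    refine hx u hu u hu m 1 (by simp) ((htri _ u _).trans ?_)
    rw [hsymm]
    have h1 := hπ m u
    have h2 := hπ (m + 1) u
    have h3 : (0 : ℝ) < (1 / 2) ^ m := by positivity
    rw [pow_succ] at h2
    nlinarith [mul_nonneg hc h3.le, mul_nonneg hD.le h3.le]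
  have hlim : ∀ u ∈ A, Tendsto (fun m => x (π m u)) atTop (𝓝 (X u)) := fun u hu =>
    hX u hu (cauchySeq_tendsto_of_complete (cauchySeq_of_le_geometric r K hr1 (hstep u hu)))
  have hdist : ∀ u ∈ A, ∀ m, |x (π m u) - X u| ≤ K * r ^ m / (1 - r) := fun u hu m => by
    rw [← Real.dist_eq]
    exact dist_le_of_le_geometric_of_tendsto r K hr1 (hstep u hu) (hlim u hu) m
  refine ⟨hlim, K * (1 + 2 / (1 - r)) * (2 / D) ^ θ, ?_, fun u hu v hv => ?_⟩
  · have : 0 < 1 - r := by linarith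
    positivity
  have h1r : 0 < 1 - r := by linarith
  rcases (hρ0 u v).eq_or_lt with h0 | h0
  · rw [hρ u v h0.symm, sub_self, abs_zero]
    have := hρ0 v v
    positivity
  obtain ⟨m, hm1, hm2⟩ := exists_nat_pow_near_of_lt_one (x := ρ u v / D) (y := 1 / 2)
    (by positivity) ((div_le_one hD).2 (hAD u hu v hv)) (by norm_num) (by norm_num)
  rw [div_le_iff₀ hD] at hm2
  have h2 : |x (π m u) - x (π m v)| ≤ K * r ^ m := by
    refine hx u hu v hv m 0 (by simp) ((htri _ u _).trans ?_)
    rw [hsymm]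
    have h1 := hπ m u
    have h2 := hπ m v
    have h3 := htri u v (π m v)
    rw [add_zero]
    linarith
  have h3 : r ^ m ≤ (2 / D) ^ θ * ρ u v ^ θ := by
    rw [hr, ← Real.rpow_natCast, ← Real.rpow_mul (by norm_num), mul_comm θ, Real.rpow_mul
      (by norm_num), Real.rpow_natCast, ← Real.mul_rpow (by positivity) h0.le]
    refine Real.rpow_le_rpow (by positivity) ?_ hθ.le
    rw [pow_succ] at hm1
    have : 2 / D * ρ u v = 2 * (ρ u v / D) := by ring
    rw [this]
    linarith
  have h4 : |X u - X v| ≤ |x (π m u) - X u| + |x (π m u) - x (π m v)| + |x (π m v) - X v| := by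
    have e : X u - X v = -(x (π m u) - X u) + (x (π m u) - x (π m v)) + (x (π m v) - X v) := by
      ring
    rw [e]
    refine (abs_add_le _ _).trans (add_le_add ((abs_add_le _ _).trans ?_) le_rfl)
    rw [abs_neg]
  calc |X u - X v| ≤ K * r ^ m / (1 - r) + K * r ^ m + K * r ^ m / (1 - r) :=
        h4.trans (add_le_add (add_le_add (hdist u hu m) h2) (hdist v hv m))
    _ = K * (1 + 2 / (1 - r)) * r ^ m := by ring
    _ ≤ K * (1 + 2 / (1 - r)) * ((2 / D) ^ θ * ρ u v ^ θ) := by gcongr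
    _ = _ := by ring

section Grid

variable {d : ℕ}

/-- The point of the grid of mesh `h` in `ℝ × ℝᵈ` with integer coordinates `w`. -/
noncomputable def gridPoint (h : ℝ) (w : ℤ × (Fin d → ℤ)) : ℝ × EuclideanSpace ℝ (Fin d) :=
  (w.1 * h, WithLp.toLp 2 fun i => w.2 i * h)

/-- Coordinates of the point of the grid of mesh `h` below `u`. -/
noncomputable def gridIndex (h : ℝ) (u : ℝ × EuclideanSpace ℝ (Fin d)) : ℤ × (Fin d → ℤ) :=
  (⌊u.1 / h⌋, fun i => ⌊u.2 i / h⌋)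

/-- Integer vectors with entries in `[-n, n]`. -/
noncomputable def gridBox (d n : ℕ) : Finset (ℤ × (Fin d → ℤ)) :=
  Finset.Icc (-(n : ℤ)) n ×ˢ Fintype.piFinset fun _ => Finset.Icc (-(n : ℤ)) n

theorem card_gridBox (n : ℕ) : (gridBox d n).card = (2 * n + 1) ^ (d + 1) := by
  rw [gridBox, Finset.card_product, Fintype.card_piFinset_const, Int.card_Icc, pow_succ']
  congr 2 <;> omega

theorem abs_sub_floor_mul_le {h : ℝ} (hh : 0 < h) (x : ℝ) : |x - ⌊x / h⌋ * h| ≤ h := by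
  have h1 := Int.floor_le (x / h)
  have h2 := Int.lt_floor_add_one (x / h)
  rw [le_div_iff₀ hh] at h1
  rw [div_lt_iff₀ hh] at h2
  rw [abs_le]
  constructor <;> nlinarith

theorem abs_sub_gridPoint_le {h : ℝ} (hh : 0 < h) (u : ℝ × EuclideanSpace ℝ (Fin d)) :
    |u.1 - (gridPoint h (gridIndex h u)).1| ≤ h := abs_sub_floor_mul_le hh _

theorem norm_sub_gridPoint_le {h : ℝ} (hh : 0 < h) (u : ℝ × EuclideanSpace ℝ (Fin d)) :
    ‖u.2 - (gridPoint h (gridIndex h u)).2‖ ≤ (1 + d) * h := by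
  rw [EuclideanSpace.norm_eq]
  refine Real.sqrt_le_iff.2 ⟨by positivity, ?_⟩
  calc ∑ i, ‖(u.2 - (gridPoint h (gridIndex h u)).2) i‖ ^ 2 ≤ ∑ _i : Fin d, h ^ 2 := by
        refine Finset.sum_le_sum fun i _ => ?_
        gcongr
        exact abs_sub_floor_mul_le hh (u.2 i)
    _ = d * h ^ 2 := by simp
    _ ≤ _ := by
        have : (0 : ℝ) ≤ d := by positivity
        nlinarith [sq_nonneg h, mul_nonneg this (sq_nonneg h),
          mul_nonneg (mul_nonneg this this) (sq_nonneg h)]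

theorem gridIndex_mem {h : ℝ} (hh : 0 < h) {n : ℕ} {R : ℝ} (hR : R / h = n)
    {u : ℝ × EuclideanSpace ℝ (Fin d)} (h1 : |u.1| ≤ R) (h2 : ‖u.2‖ ≤ R) :
    gridIndex h u ∈ gridBox d n := by
  have key : ∀ x : ℝ, |x| ≤ R → ⌊x / h⌋ ∈ Finset.Icc (-(n : ℤ)) n := by
    intro x hx
    rw [abs_le] at hx
    rw [Finset.mem_Icc]
    constructor
    · rw [Int.le_floor]
      push_cast
      rw [← hR, ← neg_div]
      gcongr
      exact hx.1
    · have h3 : x / h ≤ n := by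
        rw [← hR]
        gcongr
        exact hx.2
      have h4 : (⌊x / h⌋ : ℝ) ≤ n := (Int.floor_le _).trans h3
      exact_mod_cast h4
  rw [gridBox, Finset.mem_product]
  refine ⟨key _ h1, Fintype.mem_piFinset.2 fun i => key _ ?_⟩
  exact (PiLp.norm_apply_le u.2 i).trans h2

/-- The anisotropic distance `|t - t'|^β + ‖y - y'‖^λ` on `ℝ × ℝᵈ`. -/
noncomputable def anisoDist (β lam : ℝ) (u v : ℝ × EuclideanSpace ℝ (Fin d)) : ℝ :=
  |u.1 - v.1| ^ β + ‖u.2 - v.2‖ ^ lam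

variable {β lam : ℝ}

theorem anisoDist_nonneg (u v : ℝ × EuclideanSpace ℝ (Fin d)) : 0 ≤ anisoDist β lam u v := by
  unfold anisoDist
  positivity

theorem anisoDist_symm (u v : ℝ × EuclideanSpace ℝ (Fin d)) :
    anisoDist β lam u v = anisoDist β lam v u := by
  unfold anisoDist
  rw [abs_sub_comm, norm_sub_rev]

theorem eq_of_anisoDist_eq_zero {u v : ℝ × EuclideanSpace ℝ (Fin d)}
    (h : anisoDist β lam u v = 0) : u = v := by
  unfold anisoDist at h
  have h1 : 0 ≤ |u.1 - v.1| ^ β := by positivity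
  have h2 : 0 ≤ ‖u.2 - v.2‖ ^ lam := by positivity
  have h3 : |u.1 - v.1| ^ β = 0 := by linarith
  have h4 : ‖u.2 - v.2‖ ^ lam = 0 := by linarith
  have h5 := ((Real.rpow_eq_zero_iff_of_nonneg (abs_nonneg _)).1 h3).1
  have h6 := ((Real.rpow_eq_zero_iff_of_nonneg (norm_nonneg _)).1 h4).1
  exact Prod.ext (sub_eq_zero.1 (abs_eq_zero.1 h5)) (sub_eq_zero.1 (norm_eq_zero.1 h6))

theorem anisoDist_triangle (hβ : 0 ≤ β) (hβ1 : β ≤ 1) (hl : 0 ≤ lam) (hl1 : lam ≤ 1)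
    (u v w : ℝ × EuclideanSpace ℝ (Fin d)) :
    anisoDist β lam u w ≤ anisoDist β lam u v + anisoDist β lam v w := by
  unfold anisoDist
  have h1 : |u.1 - w.1| ^ β ≤ |u.1 - v.1| ^ β + |v.1 - w.1| ^ β :=
    (Real.rpow_le_rpow (abs_nonneg _) (abs_sub_le _ _ _) hβ).trans
      (Real.rpow_add_le_add_rpow (abs_nonneg _) (abs_nonneg _) hβ hβ1)
  have h2 : ‖u.2 - w.2‖ ^ lam ≤ ‖u.2 - v.2‖ ^ lam + ‖v.2 - w.2‖ ^ lam :=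
    (Real.rpow_le_rpow (norm_nonneg _) (norm_sub_le_norm_sub_add_norm_sub _ _ _) hl).trans
      (Real.rpow_add_le_add_rpow (norm_nonneg _) (norm_nonneg _) hl hl1)
  linarith

theorem rpow_le_one_add {x a : ℝ} (hx : 0 ≤ x) (ha : 0 ≤ a) (ha1 : a ≤ 1) : x ^ a ≤ 1 + x := by
  calc x ^ a ≤ (1 + x) ^ a := Real.rpow_le_rpow hx (by linarith) ha
    _ ≤ (1 + x) ^ (1 : ℝ) := Real.rpow_le_rpow_of_exponent_le (by linarith) ha1
    _ = _ := Real.rpow_one _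

theorem anisoDist_le_of_mem_box (hβ : 0 ≤ β) (hβ1 : β ≤ 1) (hl : 0 ≤ lam) (hl1 : lam ≤ 1) {R : ℝ}
    {u v : ℝ × EuclideanSpace ℝ (Fin d)} (hu : |u.1| ≤ R ∧ ‖u.2‖ ≤ R)
    (hv : |v.1| ≤ R ∧ ‖v.2‖ ≤ R) : anisoDist β lam u v ≤ 2 + 4 * R := by
  unfold anisoDist
  have h1 := rpow_le_one_add (abs_nonneg (u.1 - v.1)) hβ hβ1
  have h2 := rpow_le_one_add (norm_nonneg (u.2 - v.2)) hl hl1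
  have h3 := abs_sub u.1 v.1
  have h4 := norm_sub_le u.2 v.2
  linarith [hu.1, hu.2, hv.1, hv.2]

theorem half_pow_rpow_le {L m : ℕ} {a : ℝ} (ha : 1 ≤ L * a) :
    ((1 / 2 : ℝ) ^ (L * m)) ^ a ≤ (1 / 2) ^ m := by
  rw [← Real.rpow_natCast, ← Real.rpow_mul (by norm_num), ← Real.rpow_natCast]
  refine Real.rpow_le_rpow_of_exponent_ge (by norm_num) (by norm_num) ?_
  push_cast
  have : (0 : ℝ) ≤ m := by positivity
  nlinarith

theorem anisoDist_gridPoint_le (hβ : 0 ≤ β) (hl : 0 ≤ lam) (hl1 : lam ≤ 1) {L : ℕ}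
    (hLβ : 1 ≤ L * β) (hLl : 1 ≤ L * lam) (m : ℕ) (u : ℝ × EuclideanSpace ℝ (Fin d)) :
    anisoDist β lam u (gridPoint ((1 / 2) ^ (L * m)) (gridIndex ((1 / 2) ^ (L * m)) u)) ≤
      (3 + d) * (1 / 2) ^ m := by
  set h : ℝ := (1 / 2) ^ (L * m) with hh
  have hh0 : 0 < h := by positivity
  unfold anisoDist
  have h1 : |u.1 - (gridPoint h (gridIndex h u)).1| ^ β ≤ (1 / 2) ^ m :=
    (Real.rpow_le_rpow (abs_nonneg _) (abs_sub_gridPoint_le hh0 u) hβ).trans (half_pow_rpow_le hLβ)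
  have h2 : ‖u.2 - (gridPoint h (gridIndex h u)).2‖ ^ lam ≤ (2 + d) * (1 / 2) ^ m := by
    refine (Real.rpow_le_rpow (norm_nonneg _) (norm_sub_gridPoint_le hh0 u) hl).trans ?_
    rw [Real.mul_rpow (by positivity) hh0.le]
    have h3 := rpow_le_one_add (x := 1 + d) (by positivity) hl hl1
    have h4 : ((1 / 2 : ℝ) ^ (L * m)) ^ lam ≤ _ := half_pow_rpow_le (m := m) hLl
    refine mul_le_mul (by linarith) h4 (by positivity) (by positivity)
  calc _ ≤ (1 / 2 : ℝ) ^ m + (2 + d) * (1 / 2) ^ m := add_le_add h1 h2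
    _ = _ := by ring

theorem tendsto_gridPoint {L : ℕ} (hL : 0 < L) (u : ℝ × EuclideanSpace ℝ (Fin d)) :
    Tendsto (fun m => gridPoint ((1 / 2) ^ (L * m)) (gridIndex ((1 / 2) ^ (L * m)) u)) atTop
      (𝓝 u) := by
  have h0 : Tendsto (fun m : ℕ => (1 / 2 : ℝ) ^ (L * m)) atTop (𝓝 0) :=
    (tendsto_pow_atTop_nhds_zero_of_lt_one (by norm_num) (by norm_num)).comp
      (tendsto_id.const_mul_atTop' hL)
  refine Prod.tendsto_iff _ _ |>.2 ⟨?_, ?_⟩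
  · refine tendsto_iff_norm_sub_tendsto_zero.2 (squeeze_zero (fun _ => norm_nonneg _)
      (fun m => ?_) h0)
    rw [norm_sub_rev]
    exact abs_sub_gridPoint_le (by positivity) u
  · have h1 := h0.const_mul (1 + (d : ℝ))
    rw [mul_zero] at h1
    refine tendsto_iff_norm_sub_tendsto_zero.2 (squeeze_zero (fun _ => norm_nonneg _)
      (fun m => ?_) h1)
    rw [norm_sub_rev]
    exact norm_sub_gridPoint_le (by positivity) u

end Grid

section Chaining

variable {d : ℕ} {Ω : Type*} [MeasurableSpace Ω] {P : Measure Ω}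
  {Y : ℝ × EuclideanSpace ℝ (Fin d) → Ω → ℝ}

theorem card_gridBox_prod_le (R L m δ : ℕ) (hδ : δ < 2) :
    ((gridBox d (R * 2 ^ (L * m)) ×ˢ gridBox d (R * 2 ^ (L * (m + δ)))).card : ℝ≥0∞) ≤
      (((2 * R + 1) * 2 ^ L) ^ (2 * (d + 1)) : ℕ) * (2 : ℝ≥0∞) ^ (2 * (d + 1) * L * m) := by
  have h1 : ∀ i, i ≤ m + 1 → 2 * (R * 2 ^ (L * i)) + 1 ≤ (2 * R + 1) * 2 ^ L * 2 ^ (L * m) := by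
    intro i hi
    have h2 : 2 ^ (L * i) ≤ 2 ^ (L * (m + 1)) :=
      Nat.pow_le_pow_right two_pos (Nat.mul_le_mul_left _ hi)
    have h3 : 1 ≤ 2 ^ (L * (m + 1)) := Nat.one_le_two_pow
    calc 2 * (R * 2 ^ (L * i)) + 1 ≤ 2 * (R * 2 ^ (L * (m + 1))) + 2 ^ (L * (m + 1)) := by gcongr
      _ = _ := by ring
  have h2 : (gridBox d (R * 2 ^ (L * m)) ×ˢ gridBox d (R * 2 ^ (L * (m + δ)))).card ≤
      ((2 * R + 1) * 2 ^ L) ^ (2 * (d + 1)) * 2 ^ (2 * (d + 1) * L * m) := by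
    rw [Finset.card_product, card_gridBox, card_gridBox]
    calc _ ≤ ((2 * R + 1) * 2 ^ L * 2 ^ (L * m)) ^ (d + 1) *
          ((2 * R + 1) * 2 ^ L * 2 ^ (L * m)) ^ (d + 1) :=
          Nat.mul_le_mul (Nat.pow_le_pow_left (h1 m (by omega)) _)
            (Nat.pow_le_pow_left (h1 (m + δ) (by omega)) _)
      _ = ((2 * R + 1) * 2 ^ L * 2 ^ (L * m)) ^ (2 * (d + 1)) := by
          rw [← pow_add]
          congr 1
          omega
      _ = _ := by
          rw [mul_pow _ (2 ^ (L * m)), ← pow_mul 2 (L * m)]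
          congr 2
          ring
  exact_mod_cast h2

/-- Almost surely, the increments of the field along neighbouring points of consecutive grids of
meshes `2^{-Lm}` are `O(2^{-θm})`, if all their moments are controlled by the anisotropic
distance. -/
theorem ae_exists_grid_increment_le (hYm : ∀ u, AEStronglyMeasurable (Y u) P) {β lam θ : ℝ}
    (hθ1 : θ < 1)
    (hY : ∀ N : ℕ, 0 < N → ∃ C : ℝ≥0∞, C ≠ ∞ ∧ ∀ u v,
      eLpNorm (fun ω => Y u ω - Y v ω) ((2 * N : ℕ) : ℝ≥0∞) P ≤
        C * ENNReal.ofReal (anisoDist β lam u v)) (L R : ℕ) {c : ℝ} (hc : 0 ≤ c) :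
    ∀ᵐ ω ∂P, ∃ K : ℝ, 0 ≤ K ∧ ∀ u v : ℝ × EuclideanSpace ℝ (Fin d), |u.1| ≤ R ∧ ‖u.2‖ ≤ R →
      |v.1| ≤ R ∧ ‖v.2‖ ≤ R → ∀ m, ∀ δ ∈ Finset.range 2,
      anisoDist β lam (gridPoint ((1 / 2) ^ (L * m)) (gridIndex ((1 / 2) ^ (L * m)) u))
        (gridPoint ((1 / 2) ^ (L * (m + δ))) (gridIndex ((1 / 2) ^ (L * (m + δ))) v)) ≤
        c * (1 / 2) ^ m →
      |Y (gridPoint ((1 / 2) ^ (L * m)) (gridIndex ((1 / 2) ^ (L * m)) u)) ω -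
        Y (gridPoint ((1 / 2) ^ (L * (m + δ))) (gridIndex ((1 / 2) ^ (L * (m + δ))) v)) ω| ≤
        K * ((1 / 2 : ℝ) ^ θ) ^ m := by
  classical
  obtain ⟨N, hN⟩ := exists_nat_gt ((((2 * (d + 1) * L : ℕ) : ℝ) + 1) / (1 - θ))
  have h1θ : 0 < 1 - θ := by linarith
  have hN0 : 0 < N := by
    have : (0 : ℝ) < N := lt_of_le_of_lt (by positivity) hN
    exact_mod_cast this
  obtain ⟨C, hC, hb⟩ := hY N hN0
  have key : ∀ δ ∈ Finset.range 2, ∀ᵐ ω ∂P, ∃ K : ℝ, 0 ≤ K ∧ ∀ m,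
      ∀ i ∈ (gridBox d (R * 2 ^ (L * m)) ×ˢ gridBox d (R * 2 ^ (L * (m + δ)))).filter (fun i =>
        anisoDist β lam (gridPoint ((1 / 2) ^ (L * m)) i.1)
          (gridPoint ((1 / 2) ^ (L * (m + δ))) i.2) ≤ c * (1 / 2) ^ m),
      |Y (gridPoint ((1 / 2) ^ (L * m)) i.1) ω -
        Y (gridPoint ((1 / 2) ^ (L * (m + δ))) i.2) ω| ≤ K * ((1 / 2 : ℝ) ^ θ) ^ m := by
    intro δ hδ
    refine ae_exists_forall_abs_le (p := 2 * N) (Q := 2 * (d + 1) * L)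
      (fun m (i : (ℤ × (Fin d → ℤ)) × (ℤ × (Fin d → ℤ))) ω =>
        Y (gridPoint ((1 / 2) ^ (L * m)) i.1) ω - Y (gridPoint ((1 / 2) ^ (L * (m + δ))) i.2) ω)
      _ (fun m i => (hYm _).sub (hYm _)) (by omega) ?_ (A := C * ENNReal.ofReal c)
      (C := (((2 * R + 1) * 2 ^ L) ^ (2 * (d + 1)) : ℕ))
      (ENNReal.mul_ne_top hC ENNReal.ofReal_ne_top) (ENNReal.natCast_ne_top _) (fun m => ?_)
      (fun m i hi => ?_)
    · rw [div_lt_iff₀ h1θ] at hN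
      push_cast at hN ⊢
      nlinarith
    · refine le_trans ?_ (card_gridBox_prod_le R L m δ (Finset.mem_range.1 hδ))
      exact_mod_cast Finset.card_filter_le _ _
    · refine (hb _ _).trans ?_
      rw [mul_assoc]
      gcongr
      refine (ENNReal.ofReal_le_ofReal (Finset.mem_filter.1 hi).2).trans (le_of_eq ?_)
      rw [ENNReal.ofReal_mul hc, ENNReal.ofReal_pow (by norm_num),
        ENNReal.ofReal_div_of_pos two_pos]
      simp
  have hdiv : ∀ n : ℕ, (R : ℝ) / (1 / 2) ^ (L * n) = ((R * 2 ^ (L * n) : ℕ) : ℝ) := by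
    intro n
    push_cast
    rw [one_div, inv_pow, div_inv_eq_mul]
  filter_upwards [key 0 (by simp), key 1 (by simp)] with ω h0 h1
  obtain ⟨K₀, hK₀, h0⟩ := h0
  obtain ⟨K₁, hK₁, h1⟩ := h1
  refine ⟨max K₀ K₁, le_max_of_le_left hK₀, fun u v hu hv m δ hδ hle => ?_⟩
  have hmem : ∀ δ, anisoDist β lam (gridPoint ((1 / 2) ^ (L * m)) (gridIndex ((1 / 2) ^ (L * m)) u))
        (gridPoint ((1 / 2) ^ (L * (m + δ))) (gridIndex ((1 / 2) ^ (L * (m + δ))) v)) ≤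
        c * (1 / 2) ^ m → (gridIndex ((1 / 2) ^ (L * m)) u, gridIndex ((1 / 2) ^ (L * (m + δ))) v) ∈
      (gridBox d (R * 2 ^ (L * m)) ×ˢ gridBox d (R * 2 ^ (L * (m + δ)))).filter (fun i =>
        anisoDist β lam (gridPoint ((1 / 2) ^ (L * m)) i.1)
          (gridPoint ((1 / 2) ^ (L * (m + δ))) i.2) ≤ c * (1 / 2) ^ m) := fun δ h =>
    Finset.mem_filter.2 ⟨Finset.mem_product.2
      ⟨gridIndex_mem (by positivity) (hdiv _) hu.1 hu.2,
        gridIndex_mem (by positivity) (hdiv _) hv.1 hv.2⟩, h⟩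
  have hδ2 := Finset.mem_range.1 hδ
  have hr : (0 : ℝ) ≤ ((1 / 2 : ℝ) ^ θ) ^ m := by positivity
  interval_cases δ
  · exact (h0 m _ (hmem 0 hle)).trans (mul_le_mul_of_nonneg_right (le_max_left _ _) hr)
  · exact (h1 m _ (hmem 1 hle)).trans (mul_le_mul_of_nonneg_right (le_max_right _ _) hr)

/-- The Kolmogorov-Chentsov theorem for a real field on `ℝ × ℝᵈ` with all moments, for a family of
anisotropic distances. The exponents are exhausted by the sequences `σ_j β₀`, `σ_j λ₀` with
`σ_j = 1 - 1 / (j + 2)`. The modification is a pointwise limit of the field along a countable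
set. -/
theorem exists_holder_modification [IsFiniteMeasure P] (hYm : ∀ u, AEStronglyMeasurable (Y u) P)
    {β₀ lam₀ : ℝ} (hβ : 0 < β₀) (hβ1 : β₀ ≤ 1) (hl : 0 < lam₀) (hl1 : lam₀ ≤ 1)
    (hY : ∀ β lam : ℝ, 0 < β → β < β₀ → 0 < lam → lam < lam₀ → ∀ N : ℕ, 0 < N →
      ∃ C : ℝ≥0∞, C ≠ ∞ ∧ ∀ u v, eLpNorm (fun ω => Y u ω - Y v ω) ((2 * N : ℕ) : ℝ≥0∞) P ≤
        C * ENNReal.ofReal (anisoDist β lam u v)) :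
    ∃ (D : Set (ℝ × EuclideanSpace ℝ (Fin d))) (Y' : ℝ × EuclideanSpace ℝ (Fin d) → Ω → ℝ),
      D.Countable ∧ (∀ u, Y' u =ᵐ[P] Y u) ∧ ∀ᵐ ω ∂P,
        (∀ u, ∃ v : ℕ → ℝ × EuclideanSpace ℝ (Fin d), (∀ m, v m ∈ D) ∧ Tendsto v atTop (𝓝 u) ∧
          Tendsto (fun m => Y (v m) ω) atTop (𝓝 (Y' u ω))) ∧
        ∀ R j : ℕ, ∃ K : ℝ, 0 ≤ K ∧ ∀ u v : ℝ × EuclideanSpace ℝ (Fin d),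
          |u.1| ≤ R ∧ ‖u.2‖ ≤ R → |v.1| ≤ R ∧ ‖v.2‖ ≤ R →
          |Y' u ω - Y' v ω| ≤ K * anisoDist ((1 - 1 / ((j : ℝ) + 2)) * β₀)
            ((1 - 1 / ((j : ℝ) + 2)) * lam₀) u v ^ (1 - 1 / ((j : ℝ) + 2)) := by
  obtain ⟨L, hL⟩ := exists_nat_gt (2 / min β₀ lam₀)
  have hmin : 0 < min β₀ lam₀ := lt_min hβ hl
  have hL0 : 0 < L := by
    have : (0 : ℝ) < L := lt_of_le_of_lt (by positivity) hL
    exact_mod_cast this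
  rw [div_lt_iff₀ hmin] at hL
  set σ : ℕ → ℝ := fun j => 1 - 1 / ((j : ℝ) + 2) with hσ
  have hσ1 : ∀ j, σ j < 1 := fun j => by
    have : (0 : ℝ) < 1 / ((j : ℝ) + 2) := by positivity
    simp only [hσ]
    linarith
  have hσ2 : ∀ j, 1 / 2 ≤ σ j := fun j => by
    have : 1 / ((j : ℝ) + 2) ≤ 1 / 2 := by
      gcongr
      have : (0 : ℝ) ≤ j := by positivity
      linarith
    simp only [hσ]
    linarith
  have hσ0 : ∀ j, 0 < σ j := fun j => by linarith [hσ2 j]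
  have hlarge : ∀ a, min β₀ lam₀ ≤ a → ∀ j, 1 ≤ L * (σ j * a) := by
    intro a ha j
    have h1 : 2 < (L : ℝ) * a := hL.trans_le (by gcongr)
    nlinarith [hσ2 j]
  set π : ℕ → ℝ × EuclideanSpace ℝ (Fin d) → ℝ × EuclideanSpace ℝ (Fin d) := fun m u =>
    gridPoint ((1 / 2) ^ (L * m)) (gridIndex ((1 / 2) ^ (L * m)) u) with hπ
  set D : Set (ℝ × EuclideanSpace ℝ (Fin d)) :=
    Set.range fun i : ℕ × (ℤ × (Fin d → ℤ)) => gridPoint ((1 / 2) ^ (L * i.1)) i.2 with hD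
  set Y' : ℝ × EuclideanSpace ℝ (Fin d) → Ω → ℝ := fun u ω =>
    limUnder atTop fun m => Y (π m u) ω with hY'
  have hYj := fun j => hY (σ j * β₀) (σ j * lam₀) (by have := hσ0 j; positivity)
    (by nlinarith [hσ1 j]) (by have := hσ0 j; positivity) (by nlinarith [hσ1 j])
  have hae : ∀ᵐ ω ∂P, ∀ R j : ℕ,
      (∀ u ∈ {u : ℝ × EuclideanSpace ℝ (Fin d) | |u.1| ≤ R ∧ ‖u.2‖ ≤ R},
        Tendsto (fun m => Y (π m u) ω) atTop (𝓝 (Y' u ω))) ∧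
      ∃ K : ℝ, 0 ≤ K ∧ ∀ u ∈ {u : ℝ × EuclideanSpace ℝ (Fin d) | |u.1| ≤ R ∧ ‖u.2‖ ≤ R},
        ∀ v ∈ {u : ℝ × EuclideanSpace ℝ (Fin d) | |u.1| ≤ R ∧ ‖u.2‖ ≤ R},
        |Y' u ω - Y' v ω| ≤ K * anisoDist (σ j * β₀) (σ j * lam₀) u v ^ σ j := by
    rw [ae_all_iff]
    intro R
    rw [ae_all_iff]
    intro j
    have hj0 := hσ0 j
    have hb1 : σ j * β₀ ≤ 1 := by nlinarith [hσ1 j]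
    have hb2 : σ j * lam₀ ≤ 1 := by nlinarith [hσ1 j]
    filter_upwards [ae_exists_grid_increment_le hYm (hσ1 j) (hYj j) L R
      (c := 2 * (3 + d) + (2 + 4 * R)) (by positivity)] with ω hω
    obtain ⟨K, hK, hω⟩ := hω
    exact exists_holder_of_net (ρ := anisoDist (σ j * β₀) (σ j * lam₀)) (x := fun u => Y u ω)
      (X := fun u => Y' u ω) (c := 3 + d) (D := 2 + 4 * R) (π := π) hj0 (by positivity)
      (by positivity) hK anisoDist_nonneg (fun _ _ => eq_of_anisoDist_eq_zero) anisoDist_symm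
      (anisoDist_triangle (by positivity) hb1 (by positivity) hb2)
      (fun m u => anisoDist_gridPoint_le (by positivity) (by positivity) hb2
        (hlarge _ (min_le_left _ _) j) (hlarge _ (min_le_right _ _) j) m u)
      (fun u hu v hv => anisoDist_le_of_mem_box (by positivity) hb1 (by positivity) hb2 hu hv)
      (fun u hu v hv m δ hδ hle => hω u v hu hv m δ hδ hle)
      (fun u _ h => tendsto_nhds_limUnder h)
  have hlim : ∀ᵐ ω ∂P, ∀ u, Tendsto (fun m => Y (π m u) ω) atTop (𝓝 (Y' u ω)) := by
    filter_upwards [hae] with ω hω u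
    obtain ⟨R, hR⟩ := exists_nat_ge (max |u.1| ‖u.2‖)
    exact (hω R 0).1 u ⟨(le_max_left _ _).trans hR, (le_max_right _ _).trans hR⟩
  refine ⟨D, Y', Set.countable_range _, fun u => ?_, ?_⟩
  · obtain ⟨C, hC, hb⟩ := hYj 0 1 one_pos
    have hj0 := hσ0 0
    have hb2 : σ 0 * lam₀ ≤ 1 := by nlinarith [hσ1 0]
    have h1 : Tendsto (fun m => eLpNorm (fun ω => Y (π m u) ω - Y u ω) ((2 * 1 : ℕ) : ℝ≥0∞) P)
        atTop (𝓝 0) := by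
      have h2 : Tendsto (fun m : ℕ => C * ENNReal.ofReal ((3 + d) * (1 / 2 : ℝ) ^ m)) atTop
          (𝓝 0) := by
        have h3 : Tendsto (fun m : ℕ => (3 + d) * (1 / 2 : ℝ) ^ m) atTop (𝓝 ((3 + d) * 0)) :=
          (tendsto_pow_atTop_nhds_zero_of_lt_one (by norm_num) (by norm_num)).const_mul _
        rw [mul_zero] at h3
        have h4 := ENNReal.Tendsto.const_mul (a := C) (ENNReal.tendsto_ofReal h3) (Or.inr hC)
        simpa using h4
      refine tendsto_of_tendsto_of_tendsto_of_le_of_le tendsto_const_nhds h2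
        (fun _ => zero_le) fun m => (hb _ _).trans ?_
      gcongr
      rw [anisoDist_symm]
      exact anisoDist_gridPoint_le (by positivity) (by positivity) hb2
        (hlarge _ (min_le_left _ _) 0) (hlarge _ (min_le_right _ _) 0) m u
    obtain ⟨ns, hns, hns'⟩ := (tendstoInMeasure_of_tendsto_eLpNorm (by norm_num)
      (fun m => hYm (π m u)) (hYm u) h1).exists_seq_tendsto_ae
    filter_upwards [hlim, hns'] with ω h2 h3
    exact tendsto_nhds_unique ((h2 u).comp hns.tendsto_atTop) h3
  · filter_upwards [hae, hlim] with ω h1 h2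
    refine ⟨fun u => ⟨fun m => π m u, fun m => ⟨(m, _), rfl⟩, tendsto_gridPoint hL0 u, h2 u⟩,
      fun R j => ?_⟩
    obtain ⟨K, hK, h⟩ := (h1 R j).2
    exact ⟨K, hK, fun u v hu hv => h u hu v hv⟩

end Chaining

/-! ### Moments of the increments of the DSLT -/

section Moments

variable {d : ℕ} {Ω : Type*} [MeasurableSpace Ω] {P : Measure Ω} [IsProbabilityMeasure P] {H : ℝ}
  {B : ℝ≥0 → Ω → EuclideanSpace ℝ (Fin d)} {k : Fin d → ℕ}

/-- Under `H (|k| + d) < 1`, convergence in one `L^p` forces convergence in all of them. -/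
theorem IsDSLT.isLpLimit (h0 : 0 < H) (h1 : H < 1) (hd : 0 < d)
    (hB : IsFractionalBrownianMotion H B P) (hc : ∀ ω, Continuous fun t => B t ω)
    (hm : ∀ t, Measurable (B t)) (hk : H * (((∑ j, k j : ℕ) : ℝ) + (d : ℝ)) < 1)
    {t : ℝ} {y : EuclideanSpace ℝ (Fin d)} {X : Ω → ℝ} (hX : IsDSLT B P k t y X) {p : ℝ≥0∞}
    (hp0 : p ≠ 0) (hp : p ≠ ∞) : IsLpLimit B P k t y p X := by
  obtain ⟨X', hX'⟩ := exists_isLpLimit h0 h1 hd hB hc hm hk t y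
  have he : X =ᵐ[P] X' := IsDSLT.ae_eq hc hm hX ⟨p, hp0, hp, hX' p hp0 hp⟩
  refine ⟨(hX' p hp0 hp).1.ae_eq he.symm, ?_⟩
  have e : ∀ ε : ℝ, eLpNorm (fun ω => approxDSLT B k ε t y ω - X ω) p P =
      eLpNorm (fun ω => approxDSLT B k ε t y ω - X' ω) p P := fun ε =>
    eLpNorm_congr_ae (he.mono fun ω hω => by simp only [hω])
  simp only [e]
  exact (hX' p hp0 hp).2

theorem exists_eLpNorm_space_le (h0 : 0 < H) (h1 : H < 1) (hd : 0 < d)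
    (hB : IsFractionalBrownianMotion H B P) (hc : ∀ ω, Continuous fun t => B t ω)
    (hm : ∀ t, Measurable (B t)) (hk : H * (((∑ j, k j : ℕ) : ℝ) + (d : ℝ)) < 1) {T : ℝ}
    (hT : 0 < T) {α : ℝ → EuclideanSpace ℝ (Fin d) → Ω → ℝ}
    (hα : ∀ t ∈ Set.Icc 0 T, ∀ y, IsDSLT B P k t y (α t y)) {lam : ℝ} (hl0 : 0 ≤ lam)
    (hl : lam < min 1 ((1 - H * (d : ℝ) - H * ((∑ j, k j : ℕ) : ℝ)) / H)) {N : ℕ} (hN : 0 < N) :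
    ∃ C : ℝ≥0∞, C ≠ ∞ ∧ ∀ t ∈ Set.Icc 0 T, ∀ x y,
      eLpNorm (fun ω => α t x ω - α t y ω) ((2 * N : ℕ) : ℝ≥0∞) P ≤
        C * ENNReal.ofReal (‖x - y‖ ^ lam) := by
  rw [lt_min_iff, lt_div_iff₀ h0] at hl
  obtain ⟨C, hC, hb⟩ := exists_eLpNorm_approxDSLT_space_le (k := k) h0 h1 hd hB hc hm hN hl0
    hl.1.le (by linarith [hl.2]) hT
  refine ⟨C, hC, fun t ht x y => ?_⟩
  have h2N : (1 : ℝ≥0∞) ≤ ((2 * N : ℕ) : ℝ≥0∞) := by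
    exact_mod_cast (by omega : 1 ≤ 2 * N)
  have hp0 : ((2 * N : ℕ) : ℝ≥0∞) ≠ 0 := (one_pos.trans_le h2N).ne'
  exact eLpNorm_sub_le_of_isLpLimit hc hm h2N
    ((hα t ht x).isLpLimit h0 h1 hd hB hc hm hk hp0 (ENNReal.natCast_ne_top _))
    ((hα t ht y).isLpLimit h0 h1 hd hB hc hm hk hp0 (ENNReal.natCast_ne_top _))
    fun ε hε => hb t ht.2 ε hε x y

theorem exists_eLpNorm_time_le (h0 : 0 < H) (h1 : H < 1) (hd : 0 < d)
    (hB : IsFractionalBrownianMotion H B P) (hc : ∀ ω, Continuous fun t => B t ω)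
    (hm : ∀ t, Measurable (B t)) (hk : H * (((∑ j, k j : ℕ) : ℝ) + (d : ℝ)) < 1) {T : ℝ}
    (hT : 0 < T) {α : ℝ → EuclideanSpace ℝ (Fin d) → Ω → ℝ}
    (hα : ∀ t ∈ Set.Icc 0 T, ∀ y, IsDSLT B P k t y (α t y)) {β : ℝ} (hβ0 : 0 ≤ β)
    (hβ : β < 1 - H * ((∑ j, k j : ℕ) : ℝ) - H * (d : ℝ)) {N : ℕ} (hN : 0 < N) :
    ∃ C : ℝ≥0∞, C ≠ ∞ ∧ ∀ t ∈ Set.Icc 0 T, ∀ t' ∈ Set.Icc 0 T, ∀ y,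
      eLpNorm (fun ω => α t y ω - α t' y ω) ((2 * N : ℕ) : ℝ≥0∞) P ≤
        C * ENNReal.ofReal (|t - t'| ^ β) := by
  -- the endpoint `β = 0` follows from any positive exponent, as `|t - t'| ≤ T`
  obtain ⟨β', hβ'1, hβ'2⟩ := exists_between hβ
  have hβ'0 : 0 < β' := hβ0.trans_lt hβ'1
  obtain ⟨C, hC, hb⟩ := exists_eLpNorm_approxDSLT_time_le (k := k) h0 h1 hd hB hc hm hN hβ'0
    (by linarith) hT
  refine ⟨C * ENNReal.ofReal (T ^ (β' - β)), ENNReal.mul_ne_top hC ENNReal.ofReal_ne_top,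
    fun t ht t' ht' y => ?_⟩
  have h2N : (1 : ℝ≥0∞) ≤ ((2 * N : ℕ) : ℝ≥0∞) := by
    exact_mod_cast (by omega : 1 ≤ 2 * N)
  have hp0 : ((2 * N : ℕ) : ℝ≥0∞) ≠ 0 := (one_pos.trans_le h2N).ne'
  refine (eLpNorm_sub_le_of_isLpLimit hc hm h2N
    ((hα t ht y).isLpLimit h0 h1 hd hB hc hm hk hp0 (ENNReal.natCast_ne_top _))
    ((hα t' ht' y).isLpLimit h0 h1 hd hB hc hm hk hp0 (ENNReal.natCast_ne_top _))
    fun ε hε => hb t ht.2 t' ht'.2 ε hε y).trans ?_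
  rw [mul_assoc, ← ENNReal.ofReal_mul (by positivity)]
  gcongr
  have h3 : |t - t'| ≤ T := by
    rw [abs_le]
    constructor <;> linarith [ht.1, ht.2, ht'.1, ht'.2]
  calc |t - t'| ^ β' = |t - t'| ^ ((β' - β) + β) := by rw [sub_add_cancel]
    _ = |t - t'| ^ (β' - β) * |t - t'| ^ β :=
        Real.rpow_add' (abs_nonneg _) (by rw [sub_add_cancel]; exact hβ'0.ne')
    _ ≤ _ := by
        gcongr

theorem integrable_pow_and_abs_integral_pow_le {Z : Ω → ℝ} (hZ : AEStronglyMeasurable Z P) {n : ℕ}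
    (hn : 0 < n) {C : ℝ≥0∞} (hC : C ≠ ∞) {a : ℝ} (ha : 0 ≤ a)
    (hb : eLpNorm Z ((2 * n : ℕ) : ℝ≥0∞) P ≤ C * ENNReal.ofReal a) :
    Integrable (fun ω => Z ω ^ n) P ∧ |∫ ω, Z ω ^ n ∂P| ≤ C.toReal ^ n * a ^ n := by
  have h1 : eLpNorm Z n P ≤ C * ENNReal.ofReal a :=
    (eLpNorm_le_eLpNorm_of_exponent_le (by exact_mod_cast (by omega : n ≤ 2 * n)) hZ).trans hb
  have hfin : C * ENNReal.ofReal a ≠ ∞ := ENNReal.mul_ne_top hC ENNReal.ofReal_ne_top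
  have h2 : MemLp Z n P := ⟨hZ, h1.trans_lt hfin.lt_top⟩
  have h3 : ∫⁻ ω, ‖Z ω ^ n‖ₑ ∂P = eLpNorm Z n P ^ n := by
    have := eLpNorm_nnreal_pow_eq_lintegral (μ := P) (f := Z) (p := (n : ℝ≥0))
      (by exact_mod_cast hn.ne')
    simpa using this.symm
  refine ⟨⟨hZ.pow n, ?_⟩, ?_⟩
  · rw [hasFiniteIntegral_iff_enorm, h3]
    exact ENNReal.pow_lt_top h2.2
  · have h4 : ‖∫ ω, Z ω ^ n ∂P‖ₑ ≤ (C * ENNReal.ofReal a) ^ n :=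
      (enorm_integral_le_lintegral_enorm _).trans (h3.trans_le (pow_le_pow_left' h1 n))
    have h5 := ENNReal.toReal_mono (ENNReal.pow_ne_top hfin) h4
    rwa [toReal_enorm, ENNReal.toReal_pow, ENNReal.toReal_mul, ENNReal.toReal_ofReal ha, mul_pow,
      Real.norm_eq_abs] at h5

end Moments

/-! ### Hölder continuity of the modification -/

theorem holderOnWith_of_abs_sub_le {X : Type*} [PseudoMetricSpace X] {s : Set X} {f : X → ℝ}
    {C : ℝ} (hC : 0 ≤ C) {r : ℝ≥0}
    (h : ∀ x ∈ s, ∀ y ∈ s, |f x - f y| ≤ C * dist x y ^ (r : ℝ)) :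
    HolderOnWith C.toNNReal r f s := by
  intro x hx y hy
  rw [edist_dist, edist_dist, Real.dist_eq, ENNReal.ofReal_rpow_of_nonneg dist_nonneg r.coe_nonneg]
  change _ ≤ ENNReal.ofReal C * _
  rw [← ENNReal.ofReal_mul hC]
  exact ENNReal.ofReal_le_ofReal (h x hx y hy)

theorem rpow_le_mul_rpow {x D a b : ℝ} (hx : 0 ≤ x) (hxD : x ≤ D) (ha : 0 < a) (hab : a ≤ b) :
    x ^ b ≤ D ^ (b - a) * x ^ a := by
  calc x ^ b = x ^ (b - a + a) := by rw [sub_add_cancel]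
    _ = x ^ (b - a) * x ^ a := Real.rpow_add' hx (by rw [sub_add_cancel]; linarith)
    _ ≤ _ := by
        have : 0 ≤ b - a := by linarith
        gcongr

theorem exists_exponent_index {a b : ℝ} (hab : a < b) :
    ∃ j : ℕ, a ≤ (1 - 1 / ((j : ℝ) + 2)) * b * (1 - 1 / ((j : ℝ) + 2)) := by
  have h1 : Tendsto (fun j : ℕ => (1 - 1 / ((j : ℝ) + 2)) * b * (1 - 1 / ((j : ℝ) + 2))) atTop
      (𝓝 ((1 - 0) * b * (1 - 0))) := by
    have h2 : Tendsto (fun j : ℕ => 1 / ((j : ℝ) + 2)) atTop (𝓝 0) :=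
      (tendsto_natCast_atTop_atTop.atTop_add tendsto_const_nhds).const_div_atTop _
    exact ((h2.const_sub 1).mul_const b).mul (h2.const_sub 1)
  rw [sub_zero, one_mul, mul_one] at h1
  obtain ⟨j, hj⟩ := (h1.eventually (lt_mem_nhds hab)).exists
  exact ⟨j, hj.le⟩

/-- A function with bounded support that is Hölder continuous on a slightly larger ball is
globally Hölder continuous. -/
theorem exists_abs_sub_le_of_support_subset {E : Type*} [NormedAddCommGroup E] {f : E → ℝ}
    {r K lam : ℝ} (hr : 0 ≤ r) (hK : 0 ≤ K) (hl : 0 < lam) (hz : ∃ z : E, ‖z‖ = r + 1)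
    (hf : ∀ y, r < ‖y‖ → f y = 0)
    (h : ∀ y y' : E, ‖y‖ ≤ r + 1 → ‖y'‖ ≤ r + 1 → |f y - f y'| ≤ K * ‖y - y'‖ ^ lam) :
    ∃ K' : ℝ, 0 ≤ K' ∧ ∀ y y' : E, |f y - f y'| ≤ K' * ‖y - y'‖ ^ lam := by
  obtain ⟨z, hz⟩ := hz
  have hone : (1 : ℝ) ≤ (2 * r + 2) ^ lam := Real.one_le_rpow (by linarith) hl.le
  refine ⟨K * (2 * r + 2) ^ lam, by positivity, fun y y' => ?_⟩
  -- the case of a point in the support and a point far away from it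
  have key : ∀ y y' : E, r + 1 < ‖y'‖ → |f y - f y'| ≤ K * (2 * r + 2) ^ lam * ‖y - y'‖ ^ lam := by
    intro y y' hy'
    rw [hf y' (by linarith)]
    rcases le_or_gt ‖y‖ r with hy | hy
    · have h1 : (1 : ℝ) ≤ ‖y - y'‖ ^ lam := by
        refine Real.one_le_rpow ?_ hl.le
        have := norm_sub_norm_le y' y
        rw [norm_sub_rev] at this
        linarith
      calc |f y - 0| = |f y - f z| := by rw [hf z (by linarith)]
        _ ≤ K * ‖y - z‖ ^ lam := h y z (by linarith) hz.le
        _ ≤ K * (2 * r + 2) ^ lam := by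
            gcongr
            exact (norm_sub_le _ _).trans (by linarith)
        _ ≤ _ := le_mul_of_one_le_right (by positivity) h1
    · rw [hf y hy, sub_zero, abs_zero]
      positivity
  rcases le_or_gt ‖y'‖ (r + 1) with hy' | hy'
  · rcases le_or_gt ‖y‖ (r + 1) with hy | hy
    · refine (h y y' hy hy').trans ?_
      gcongr
      exact le_mul_of_one_le_right hK hone
    · rw [abs_sub_comm, norm_sub_rev]
      exact key y' y hy
  · exact key y y' hy'

section Modification

variable {d : ℕ} {Ω : Type*} [MeasurableSpace Ω] {P : Measure Ω} [IsProbabilityMeasure P] {H : ℝ}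
  {B : ℝ≥0 → Ω → EuclideanSpace ℝ (Fin d)} {k : Fin d → ℕ}

/-- The DSLT has a modification that is Hölder continuous in space and in time. -/
theorem exists_modification (h0 : 0 < H) (h1 : H < 1) (hd : 0 < d)
    (hB : IsFractionalBrownianMotion H B P) (hc : ∀ ω, Continuous fun t => B t ω)
    (hm : ∀ t, Measurable (B t)) (hk : H * (((∑ j, k j : ℕ) : ℝ) + (d : ℝ)) < 1) {T : ℝ}
    (hT : 0 < T) {α : ℝ → EuclideanSpace ℝ (Fin d) → Ω → ℝ}
    (hα : ∀ t ∈ Set.Icc 0 T, ∀ y, IsDSLT B P k t y (α t y)) :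
    ∃ α' : ℝ → EuclideanSpace ℝ (Fin d) → Ω → ℝ,
        (∀ t ∈ Set.Icc 0 T, ∀ y, α' t y =ᵐ[P] α t y) ∧
        ∀ᵐ ω ∂P,
          (∀ t ∈ Set.Icc 0 T, ∀ lam : ℝ≥0, 0 < lam →
            (lam : ℝ) < min 1 ((1 - H * (d : ℝ) - H * ((∑ j, k j : ℕ) : ℝ)) / H) →
            ∃ K : ℝ≥0, HolderWith K lam (fun y => α' t y ω)) ∧
          (∀ y : EuclideanSpace ℝ (Fin d), ∀ β : ℝ≥0, 0 < β →
            (β : ℝ) < 1 - H * ((∑ j, k j : ℕ) : ℝ) - H * (d : ℝ) →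
            ∃ K : ℝ≥0, HolderOnWith K β (fun t => α' t y ω) (Set.Icc 0 T)) := by
  set β₀ := 1 - H * ((∑ j, k j : ℕ) : ℝ) - H * (d : ℝ) with hβ₀
  set lam₀ := min 1 ((1 - H * (d : ℝ) - H * ((∑ j, k j : ℕ) : ℝ)) / H) with hlam₀
  have hβ₀0 : 0 < β₀ := by linarith
  have hβ₀1 : β₀ ≤ 1 := by
    have : 0 ≤ H * ((∑ j, k j : ℕ) : ℝ) := by positivity
    have : 0 ≤ H * (d : ℝ) := by positivity
    linarith
  have hlam₀0 : 0 < lam₀ := lt_min one_pos (div_pos (by linarith) h0)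
  -- the field is extended to all times by freezing it outside `[0, T]`
  set Y : ℝ × EuclideanSpace ℝ (Fin d) → Ω → ℝ := fun u => α (Set.projIcc 0 T hT.le u.1) u.2
    with hY
  have hYα : ∀ u, IsDSLT B P k (Set.projIcc 0 T hT.le u.1) u.2 (Y u) := fun u =>
    hα _ (Set.projIcc 0 T hT.le u.1).2 _
  have hYm : ∀ u, AEStronglyMeasurable (Y u) P := fun u => by
    obtain ⟨p, -, -, hp⟩ := hYα u
    exact hp.1.aestronglyMeasurable
  obtain ⟨D, Y', hD, hmod, hpath⟩ := exists_holder_modification hYm hβ₀0 hβ₀1 hlam₀0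
    (min_le_left _ _) (fun β lam hβ hβ' hl hl' N hN => by
      obtain ⟨C₁, hC₁, hb₁⟩ :=
        exists_eLpNorm_space_le h0 h1 hd hB hc hm hk hT hα hl.le hl' hN
      obtain ⟨C₂, hC₂, hb₂⟩ :=
        exists_eLpNorm_time_le h0 h1 hd hB hc hm hk hT hα hβ.le hβ' hN
      refine ⟨C₁ + C₂, ENNReal.add_ne_top.2 ⟨hC₁, hC₂⟩, fun u v => ?_⟩
      have e : (fun ω => Y u ω - Y v ω) =
          (fun ω => α (Set.projIcc 0 T hT.le u.1) u.2 ω - α (Set.projIcc 0 T hT.le u.1) v.2 ω) +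
          fun ω => α (Set.projIcc 0 T hT.le u.1) v.2 ω -
            α (Set.projIcc 0 T hT.le v.1) v.2 ω := by
        funext ω
        simp [hY]
      have hmix : AEStronglyMeasurable (α (Set.projIcc 0 T hT.le u.1) v.2) P := hYm (u.1, v.2)
      rw [e]
      refine (eLpNorm_add_le ((hYm u).sub hmix) (hmix.sub (hYm v))
        (by exact_mod_cast (by omega : 1 ≤ 2 * N))).trans ?_
      rw [add_mul]
      have hlip : |(Set.projIcc 0 T hT.le u.1 : ℝ) - Set.projIcc 0 T hT.le v.1| ≤ |u.1 - v.1| := by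
        have := (LipschitzWith.projIcc hT.le).dist_le_mul u.1 v.1
        simpa [Subtype.dist_eq, Real.dist_eq] using this
      refine add_le_add ((hb₁ _ (Set.projIcc 0 T hT.le u.1).2 _ _).trans ?_)
        ((hb₂ _ (Set.projIcc 0 T hT.le u.1).2 _ (Set.projIcc 0 T hT.le v.1).2 _).trans ?_)
      · gcongr
        exact le_add_of_nonneg_left (by positivity)
      · gcongr
        exact (Real.rpow_le_rpow (abs_nonneg _) hlip hβ.le).trans
          (le_add_of_nonneg_right (by positivity)))
  have hzero := (ae_ball_iff hD).2 fun v _ => (hYα v).ae_eq_zero hc hm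
  refine ⟨fun t y => Y' (t, y), fun t ht y => ?_, ?_⟩
  · have e : Y (t, y) = α t y := by
      simp only [hY, Set.projIcc_of_mem hT.le ht]
    rw [← e]
    exact hmod (t, y)
  filter_upwards [hpath, hzero] with ω hω hω0
  obtain ⟨hlim, hloc⟩ := hω
  obtain ⟨M, hM⟩ := (isCompact_Icc (a := (0 : ℝ≥0)) (b := T.toNNReal)).exists_bound_of_continuousOn
    (hc ω).continuousOn
  have hM' : ∀ s : ℝ≥0, (s : ℝ) ≤ T → ‖B s ω‖ ≤ M := fun s hs =>
    hM s ⟨zero_le, NNReal.le_toNNReal_of_coe_le hs⟩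
  have hM0 : 0 ≤ M := (norm_nonneg _).trans (hM' 0 hT.le)
  have hvanish : ∀ t y, 2 * M < ‖y‖ → Y' (t, y) ω = 0 := by
    intro t y hy
    obtain ⟨v, hv, hvlim, hvY⟩ := hlim (t, y)
    have h2 : Tendsto (fun m => ‖(v m).2‖) atTop (𝓝 ‖y‖) :=
      ((continuous_snd.tendsto _).comp hvlim).norm
    have h3 : ∀ᶠ m in atTop, Y (v m) ω = 0 := by
      filter_upwards [h2.eventually (lt_mem_nhds hy)] with m hm2
      exact hω0 (v m) (hv m) M
        (fun s hs => hM' s (hs.trans (Set.projIcc 0 T hT.le (v m).1).2.2)) hm2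
    exact tendsto_nhds_unique hvY ((tendsto_congr' h3).2 tendsto_const_nhds)
  have hσ : ∀ j : ℕ, 0 < 1 - 1 / ((j : ℝ) + 2) := fun j => by
    rw [sub_pos, div_lt_one (by positivity)]
    have : (0 : ℝ) ≤ j := by positivity
    linarith
  constructor
  · intro t ht lam hl0 hl
    obtain ⟨j, hj⟩ := exists_exponent_index hl
    obtain ⟨R, hR⟩ := exists_nat_ge (max T (2 * M + 1))
    have hR1 := (le_max_left _ _).trans hR
    have hR2 := (le_max_right _ _).trans hR
    obtain ⟨K, hK, hb⟩ := hloc R j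
    have hl0' : (0 : ℝ) < lam := hl0
    obtain ⟨K', hK', hb'⟩ := exists_abs_sub_le_of_support_subset (f := fun y => Y' (t, y) ω)
      (r := 2 * M) (K := K * (2 * (2 * M + 1)) ^
        ((1 - 1 / ((j : ℝ) + 2)) * lam₀ * (1 - 1 / ((j : ℝ) + 2)) - lam)) (lam := lam)
      (by positivity) (by positivity) hl0'
      ⟨EuclideanSpace.single ⟨0, hd⟩ (2 * M + 1), by
        rw [PiLp.norm_single, Real.norm_of_nonneg (by positivity)]⟩
      (fun y hy => hvanish t y hy) (fun y y' hy hy' => by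
        have ht' : |t| ≤ R := by
          rw [abs_of_nonneg ht.1]
          exact ht.2.trans hR1
        refine (hb (t, y) (t, y') ⟨ht', hy.trans hR2⟩ ⟨ht', hy'.trans hR2⟩).trans ?_
        rw [mul_assoc]
        refine mul_le_mul_of_nonneg_left ?_ hK
        unfold anisoDist
        rw [sub_self, abs_zero, Real.zero_rpow (mul_pos (hσ j) hβ₀0).ne', zero_add,
          ← Real.rpow_mul (norm_nonneg _)]
        exact rpow_le_mul_rpow (norm_nonneg _) ((norm_sub_le _ _).trans (by linarith)) hl0' hj)
    refine ⟨K'.toNNReal, (holderOnWith_univ).1 (holderOnWith_of_abs_sub_le hK' ?_)⟩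
    intro y _ y' _
    rw [dist_eq_norm]
    exact hb' y y'
  · intro y β hβ0 hβ
    obtain ⟨j, hj⟩ := exists_exponent_index hβ
    obtain ⟨R, hR⟩ := exists_nat_ge (max T ‖y‖)
    have hR1 := (le_max_left _ _).trans hR
    have hR2 := (le_max_right _ _).trans hR
    obtain ⟨K, hK, hb⟩ := hloc R j
    refine ⟨_, holderOnWith_of_abs_sub_le (C := K * T ^
        ((1 - 1 / ((j : ℝ) + 2)) * β₀ * (1 - 1 / ((j : ℝ) + 2)) - β)) (by positivity) ?_⟩
    intro t ht t' ht'
    have habs : ∀ t ∈ Set.Icc 0 T, |t| ≤ R := fun t ht => by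
      rw [abs_of_nonneg ht.1]
      exact ht.2.trans hR1
    refine (hb (t, y) (t', y) ⟨habs t ht, hR2⟩ ⟨habs t' ht', hR2⟩).trans ?_
    rw [mul_assoc]
    refine mul_le_mul_of_nonneg_left ?_ hK
    unfold anisoDist
    rw [sub_self, norm_zero, Real.zero_rpow (mul_pos (hσ j) hlam₀0).ne', add_zero,
      ← Real.rpow_mul (abs_nonneg _), Real.dist_eq]
    refine rpow_le_mul_rpow (abs_nonneg _) ?_ hβ0 hj
    rw [abs_le]
    constructor <;> linarith [ht.1, ht.2, ht'.1, ht'.2]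

end Modification

end SelfIntersection

theorem theorem1p3 {d : ℕ} (hd : 0 < d) {Ω : Type*} [MeasurableSpace Ω] (P : Measure Ω)
    [IsProbabilityMeasure P] (H : ℝ) (hH₀ : 0 < H) (hH₁ : H < 1)
    (B : ℝ≥0 → Ω → EuclideanSpace ℝ (Fin d))
    (hB : SelfIntersection.IsFractionalBrownianMotion H B P)
    (k : Fin d → ℕ) (hk : H * (((∑ j, k j : ℕ) : ℝ) + (d : ℝ)) < 1)
    (T : ℝ) (hT : 0 < T) :
    -- the DSLT exists, as a limit in every `L^p`
    (∀ t ∈ Set.Icc 0 T, ∀ y : EuclideanSpace ℝ (Fin d), ∃ X : Ω → ℝ,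
      ∀ p : ℝ≥0∞, p ≠ 0 → p ≠ ∞ → SelfIntersection.IsLpLimit B P k t y p X) ∧
    ∀ α : ℝ → EuclideanSpace ℝ (Fin d) → Ω → ℝ,
      (∀ t ∈ Set.Icc 0 T, ∀ y, SelfIntersection.IsDSLT B P k t y (α t y)) →
      -- moments of the increments in space
      (∀ (n : ℕ) (lam : ℝ), 0 ≤ lam →
        lam < min 1 ((1 - H * (d : ℝ) - H * ((∑ j, k j : ℕ) : ℝ)) / H) →
        ∃ C : ℝ, 0 < C ∧ ∀ t ∈ Set.Icc 0 T, ∀ x y : EuclideanSpace ℝ (Fin d),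
          Integrable (fun ω => (α t x ω - α t y ω) ^ n) P ∧
          |∫ ω, (α t x ω - α t y ω) ^ n ∂P| ≤ C * ‖x - y‖ ^ ((n : ℝ) * lam)) ∧
      -- moments of the increments in time
      (∀ (n : ℕ) (β : ℝ), 0 ≤ β →
        β < 1 - H * ((∑ j, k j : ℕ) : ℝ) - H * (d : ℝ) →
        ∃ C : ℝ, 0 < C ∧ ∀ t ∈ Set.Icc 0 T, ∀ t' ∈ Set.Icc 0 T,
          ∀ y : EuclideanSpace ℝ (Fin d),
          Integrable (fun ω => (α t y ω - α t' y ω) ^ n) P ∧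
          |∫ ω, (α t y ω - α t' y ω) ^ n ∂P| ≤ C * |t - t'| ^ ((n : ℝ) * β)) ∧
      -- a modification with Hölder continuous paths in space and in time
      ∃ α' : ℝ → EuclideanSpace ℝ (Fin d) → Ω → ℝ,
        (∀ t ∈ Set.Icc 0 T, ∀ y, α' t y =ᵐ[P] α t y) ∧
        ∀ᵐ ω ∂P,
          (∀ t ∈ Set.Icc 0 T, ∀ lam : ℝ≥0, 0 < lam →
            (lam : ℝ) < min 1 ((1 - H * (d : ℝ) - H * ((∑ j, k j : ℕ) : ℝ)) / H) →
            ∃ K : ℝ≥0, HolderWith K lam (fun y => α' t y ω)) ∧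
          (∀ y : EuclideanSpace ℝ (Fin d), ∀ β : ℝ≥0, 0 < β →
            (β : ℝ) < 1 - H * ((∑ j, k j : ℕ) : ℝ) - H * (d : ℝ) →
            ∃ K : ℝ≥0, HolderOnWith K β (fun t => α' t y ω) (Set.Icc 0 T)) := by
  obtain ⟨B', hB', hc, hm, hBB'⟩ := hB.exists_regular
  refine ⟨fun t _ y => ?_, fun α hα => ?_⟩
  · obtain ⟨X, hX⟩ := SelfIntersection.exists_isLpLimit hH₀ hH₁ hd hB' hc hm hk t y
    exact ⟨X, fun p hp0 hp => (SelfIntersection.isLpLimit_congr hBB').1 (hX p hp0 hp)⟩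
  have hα' : ∀ t ∈ Set.Icc 0 T, ∀ y, SelfIntersection.IsDSLT B' P k t y (α t y) := fun t ht y =>
    (SelfIntersection.isDSLT_congr hBB').2 (hα t ht y)
  have hαm : ∀ t ∈ Set.Icc 0 T, ∀ y, AEStronglyMeasurable (α t y) P := fun t ht y => by
    obtain ⟨p, -, -, hp⟩ := hα t ht y
    exact hp.1.aestronglyMeasurable
  refine ⟨fun n lam hl0 hl => ?_, fun n β hβ0 hβ => ?_,
    SelfIntersection.exists_modification hH₀ hH₁ hd hB' hc hm hk hT hα'⟩
  · obtain rfl | hn := n.eq_zero_or_pos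
    · exact ⟨1, one_pos, fun t _ x y => by simp⟩
    obtain ⟨C, hC, hb⟩ := SelfIntersection.exists_eLpNorm_space_le hH₀ hH₁ hd hB' hc hm hk hT hα' hl0 hl hn
    refine ⟨C.toReal ^ n + 1, by positivity, fun t ht x y => ?_⟩
    obtain ⟨h1, h2⟩ := SelfIntersection.integrable_pow_and_abs_integral_pow_le
      ((hαm t ht x).sub (hαm t ht y)) hn hC (by positivity) (hb t ht x y)
    refine ⟨h1, h2.trans ?_⟩
    rw [mul_comm (n : ℝ), Real.rpow_mul (norm_nonneg _), Real.rpow_natCast]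
    gcongr
    linarith
  · obtain rfl | hn := n.eq_zero_or_pos
    · exact ⟨1, one_pos, fun t _ t' _ y => by simp⟩
    obtain ⟨C, hC, hb⟩ := SelfIntersection.exists_eLpNorm_time_le hH₀ hH₁ hd hB' hc hm hk hT hα' hβ0 hβ hn
    refine ⟨C.toReal ^ n + 1, by positivity, fun t ht t' ht' y => ?_⟩
    obtain ⟨h1, h2⟩ := SelfIntersection.integrable_pow_and_abs_integral_pow_le
      ((hαm t ht y).sub (hαm t' ht' y)) hn hC (by positivity) (hb t ht t' ht' y)
    refine ⟨h1, h2.trans ?_⟩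
    rw [mul_comm (n : ℝ), Real.rpow_mul (abs_nonneg _), Real.rpow_natCast]
    gcongr
    linarith
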